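/- **Setting.** Let $d\ge 0$ be an integer, $I=\{+,z,-\}$, with the involution $\bar{\ }:(+,z,-)\mapsto(-,z,+)$, and let $\tilde\epsilon_{ijk}$ $(i,j,k\in I)$ be given by $\tilde\epsilon_{\pm\mp z}=\pm1$, $\tilde\epsilon_{\pm z\pm}=\mp1$, $\tilde\epsilon_{z\pm\pm}=\pm1$ and $\tilde\epsilon_{ijk}=0$ otherwise. To each multi-index $\alpha\in\mathbb N^{I\times\mathbb Z^d}$ with $|\alpha|=\sum_{x,i}\alpha_i(x)<\infty$ let there be given $V(\alpha)\in\mathbb C$ such that $\overline{V(\alpha)}=V(\bar\alpha)$, where $\bar\alpha_i(x)=\alpha_{\bar i}(x)$, and $$\|V\|=\sum_{n\in\mathbb N}\ \sup_{x\in\mathbb Z^d}\ \sum_{|\alpha|=n}|\alpha(x)|\,|V(\alpha)|\,e^n<\infty,\qquad |\alpha(x)|=\sum_{i\in I}\alpha_i(x).$$ *Classical system.* Let $\Xi=\prod_{x\in\mathbb Z^d}\overline{B_1(0)}$, $\overline{B_1(0)}\subset\mathbb R^3$ the closed unit ball, with the product topology; $M_\pm(x)=(M_1(x)\pm iM_2(x))/\sqrt2$,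 $M_z(x)=M_3(x)$; let $\mathfrak A=C(\Xi;\mathbb C)$ with $\|\cdot\|_\infty$, and $\mathfrak P=\mathbb C[\{M_i(x):i\in I,x\in\mathbb Z^d\}]$. For $\Lambda\subset\mathbb Z^d$ let $\phi^t_\Lambda$ be the flow on $\Xi$ of $$\frac{d}{dt}M_i(t,x)=\sum_{\alpha\in\mathbb N^{I\times\Lambda}}V(\alpha)\sum_{j,k\in I}i\,\tilde\epsilon_{jik}\,\alpha_j(x)\,M^{\alpha-\delta_j(x)+\delta_k(x)}(t)$$ (so that spins outside $\Lambda$ do not move). The infinite-volume dynamics $(\alpha^t)_{t\in\mathbb R}$ is the strongly continuous one-parameter group of $*$-automorphisms of $\mathfrak A$ with $\alpha^tA=\lim_{\Lambda\to\infty}A\circ\phi^t_\Lambda$ uniformly for each $A$ depending on finitely many spins (the limit is over finite $\Lambda$ eventually containing every finite set), and $\alpha^tA=A\circ\phi^t_{\mathbb Z^d}$ for all $A\in\mathfrak A$. *Quantum system.* For $s\in\{\tfrac12,1,\tfrac32,\dots\}$ let $\widehat{\mathfrak A}_\Lambda$ be the algebra of operators on $\bigotimes_{x\in\Lambda}\mathbb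 C^{2s+1}$ for finite $\Lambda$, with $\widehat{\mathfrak A}_{\Lambda_1}\subset\widehat{\mathfrak A}_{\Lambda_2}$ for $\Lambda_1\subset\Lambda_2$ via $\mathcal A\mapsto\mathcal A\otimes 1$, and let $\widehat{\mathfrak A}$ be the quasi-local $C^*$-algebra, i.e. the norm closure of $\bigcup_\Lambda\widehat{\mathfrak A}_\Lambda$. Let $\widehat S_1(x),\widehat S_2(x),\widehat S_3(x)$ be $s^{-1}$ times the generators of the spin-$s$ representation of $su(2)$ at the site $x$, $\widehat S_\pm(x)=(\widehat S_1(x)\pm i\widehat S_2(x))/\sqrt2$ and $\widehat S_z(x)=\widehat S_3(x)$. Quantization $A\mapsto\widehat A$ is the linear map $\mathfrak P\to\widehat{\mathfrak A}$ that replaces each $M_i(x)$ in a monomial by $\widehat S_i(x)$ and orders the factors so that all $\widehat S_+$ stand to the left of all $\widehat S_z$ and these to the left of all $\widehat S_-$. Put $\widehat H_\Lambda=\sum_{\alpha\in\mathbb N^{I\times\Lambda}}V(\alpha)\,\widehat{M^\alpha}$. The infinite-volume dynamics $(\widehat\alpha^t)_{t\in\mathbb R}$ is the strongly continuous one-parameter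 group of $*$-automorphisms of $\widehat{\mathfrak A}$ with $\widehat\alpha^t\mathcal A=\lim_{\Lambda\to\infty}e^{is\widehat H_\Lambda t}\mathcal A\,e^{-is\widehat H_\Lambda t}$ in norm for each local $\mathcal A$. **Theorem.** The dynamics $\alpha^t$ and, for every $s$, $\widehat\alpha^t$ exist and are unique. For every $A\in\mathfrak P$ and $\epsilon>0$ there is a family $A(t)\in\mathfrak P$, $t\in\mathbb R$, not depending on $s$, such that $$\sup_{t\in\mathbb R}\|\alpha^tA-A(t)\|_\infty\le\epsilon,$$ and, for every $t\in\mathbb R$, there is a constant $C(\epsilon,t,A)$ not depending on $s$ such that for all $s\in\{\tfrac12,1,\tfrac32,\dots\}$ $$\big\|\widehat\alpha^t\widehat A-\widehat{A(t)}\big\|\le\epsilon+\frac{C(\epsilon,t,A)}{s}.$$ -/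

import Mathlib

open Filter Topology
open scoped ENNReal

namespace SpinSystem

/-! ### Lattice, multi-indices, potentials -/

/-- The lattice `ℤ^d`. -/
abbrev Site (d : ℕ) : Type := Fin d → ℤ

/-- The index set `I = {+, z, -}`. -/
inductive Idx : Type
  | plus
  | z
  | minus
  deriving DecidableEq

instance : Fintype Idx := ⟨{.plus, .z, .minus}, fun i => by cases i <;> decide⟩

/-- The involution `(+, z, -) ↦ (-, z, +)` of `I`. -/
def Idx.bar : Idx → Idx
  | .plus => .minus
  | .z => .z
  | .minus => .plus

/-- The structure constants `ε̃ i j k`. -/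
def eps : Idx → Idx → Idx → ℤ
  | .plus, .minus, .z => 1
  | .minus, .plus, .z => -1
  | .plus, .z, .plus => -1
  | .minus, .z, .minus => 1
  | .z, .plus, .plus => 1
  | .z, .minus, .minus => -1
  | _, _, _ => 0

/-- Multi-indices `α ∈ ℕ^{I × ℤ^d}` with `|α| < ∞`; `|α|` is `Finsupp.degree α`. -/
abbrev MultiIndex (d : ℕ) : Type := (Site d × Idx) →₀ ℕ

/-- The conjugate multi-index, `ᾱ_i(x) = α_{ī}(x)`. -/
noncomputable def MultiIndex.bar {d : ℕ} (α : MultiIndex d) : MultiIndex d :=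
  α.mapDomain (fun p => (p.1, p.2.bar))

/-- `|α(x)| = ∑_i α_i(x)`. -/
def MultiIndex.at {d : ℕ} (α : MultiIndex d) (x : Site d) : ℕ :=
  ∑ i : Idx, α (x, i)

/-- An interaction potential: a complex number `V(α)` for every multi-index. -/
abbrev Potential (d : ℕ) : Type := MultiIndex d → ℂ

/-- The reality condition `conj V(α) = V(ᾱ)`. -/
def Potential.IsReal {d : ℕ} (V : Potential d) : Prop :=
  ∀ α : MultiIndex d, (starRingEnd ℂ) (V α) = V α.bar

/-- `‖V‖ = ∑_n sup_x ∑_{|α| = n} |α(x)| |V(α)| e^n`, with values in `[0, ∞]`. -/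
noncomputable def Potential.norm {d : ℕ} (V : Potential d) : ℝ≥0∞ :=
  ∑' n : ℕ, ⨆ x : Site d, ∑' α : {α : MultiIndex d // α.degree = n},
    (α.1.at x : ℝ≥0∞) * ‖V α.1‖ₑ * ENNReal.ofReal (Real.exp n)

open Classical in
/-- The part of the potential living on the region `Λ`: only multi-indices in `ℕ^{I × Λ}`
are kept. -/
noncomputable def Potential.restrict {d : ℕ} (V : Potential d) (Λ : Finset (Site d)) :
    Potential d :=
  fun α => if ∀ p ∈ α.support, p.1 ∈ Λ then V α else 0

/-! ### Classical spins -/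

/-- The closed unit ball of `ℝ³`. -/
abbrev Ball3 : Type := Metric.closedBall (0 : EuclideanSpace ℝ (Fin 3)) 1

/-- The phase space `Ξ = ∏_{x ∈ ℤ^d} (closed unit ball)`, with the product topology. -/
abbrev Phase (d : ℕ) : Type := Site d → Ball3

/-- The complex coordinates `M_± = (M₁ ± i M₂)/√2` and `M_z = M₃`. -/
noncomputable def coord : Idx → Ball3 → ℂ
  | .plus, m => ((m.1 0 : ℂ) + Complex.I * (m.1 1 : ℂ)) / (Real.sqrt 2 : ℂ)
  | .z, m => (m.1 2 : ℂ)
  | .minus, m => ((m.1 0 : ℂ) - Complex.I * (m.1 1 : ℂ)) / (Real.sqrt 2 : ℂ)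

theorem continuous_coord (i : Idx) : Continuous (coord i) := by
  cases i <;> unfold coord <;> fun_prop

/-- The classical quasi-local algebra `𝔄`, i.e. the continuous complex functions on `Ξ`
with the supremum norm. -/
abbrev ClassicalAlg (d : ℕ) : Type := C(Phase d, ℂ)

/-- The function `M_i(x) ∈ 𝔄`. -/
noncomputable def classicalSpin {d : ℕ} (p : Site d × Idx) : ClassicalAlg d :=
  ⟨fun M => coord p.2 (M p.1), (continuous_coord p.2).comp (continuous_apply p.1)⟩

/-- The algebra `𝔓 = ℂ[{M_i(x)}]`. -/
abbrev Poly (d : ℕ) : Type := MvPolynomial (Site d × Idx) ℂ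

/-- A polynomial viewed as an element of `𝔄`. -/
noncomputable def Poly.toFun {d : ℕ} : Poly d →ₐ[ℂ] ClassicalAlg d :=
  MvPolynomial.aeval classicalSpin

/-- The monomial `M^α`, evaluated at a spin configuration. -/
noncomputable def monomialAt {d : ℕ} (α : MultiIndex d) (M : Phase d) : ℂ :=
  α.prod fun p e => coord p.2 (M p.1) ^ e

/-- The right-hand side of the Hamiltonian equation of motion for `M_i(x)`:
`∑_α V(α) ∑_{j,k} i ε̃_{jik} α_j(x) M^{α - δ_j(x) + δ_k(x)}`. -/
noncomputable def vectorField {d : ℕ} (V : Potential d) (M : Phase d) (x : Site d) (i : Idx) : ℂ :=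
  ∑' α : MultiIndex d, V α * ∑ j : Idx, ∑ k : Idx,
    Complex.I * (eps j i k : ℂ) * (α (x, j) : ℂ) *
      monomialAt (α - Finsupp.single (x, j) 1 + Finsupp.single (x, k) 1) M

/-- `φ` is the Hamiltonian (Landau-Lifschitz) flow of the potential `V` on `Ξ`: for every initial
configuration `M₀`, the curve `t ↦ φ t M₀` is a global solution of the equation of motion that
starts at `M₀`. For the potential `V.restrict Λ` the spins in `Λ` follow the flow of the
Hamiltonian `H_Λ` and the spins outside of `Λ` do not move. -/
def IsFlow {d : ℕ} (V : Potential d) (φ : ℝ → Phase d → Phase d) : Prop :=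
  ∀ M₀ : Phase d, φ 0 M₀ = M₀ ∧
    ∀ (t : ℝ) (x : Site d) (i : Idx),
      HasDerivAt (fun τ : ℝ => coord i (φ τ M₀ x)) (vectorField V (φ t M₀) x i) t

/-- `α` is the infinite-volume dynamics on `𝔄`: a strongly continuous one-parameter group of
automorphisms that on local functions `A` is the uniform limit, as `Λ → ℤ^d`, of the
finite-volume dynamics `A ↦ A ∘ φ_Λ^t`, and that is given by the Landau-Lifschitz flow on the
whole lattice. -/
structure IsClassicalDynamics {d : ℕ} (V : Potential d)
    (α : ℝ → ClassicalAlg d ≃⋆ₐ[ℂ] ClassicalAlg d) : Prop where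
  zero : ∀ A, α 0 A = A
  add : ∀ t u A, α (t + u) A = α t (α u A)
  continuous : ∀ A, Continuous fun t => α t A
  limit : ∃ φ : Finset (Site d) → ℝ → Phase d → Phase d,
    (∀ Λ, IsFlow (V.restrict Λ) (φ Λ)) ∧
    ∀ (Λ₀ : Finset (Site d)) (A : ClassicalAlg d), DependsOn A (Λ₀ : Set (Site d)) →
      ∀ t : ℝ, TendstoUniformly (fun Λ M => A (φ Λ t M)) (α t A) atTop
  flow : ∃ φ : ℝ → Phase d → Phase d, IsFlow V φ ∧ ∀ t A M, α t A M = A (φ t M)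

/-! ### Quantum spins

The spin is `s = n / 2` with `n : ℕ`, and `ℂ^{2s+1}` has the orthonormal basis indexed by
`Fin (n + 1)`, the index `k` standing for the weight `s - k`. -/

/-- The spin operators of the spin-`n/2` representation of `su(2)`, rescaled by `1/s`:
`S_z = diag((s - k)/s)`, and `S_± = (S₁ ± i S₂)/√2`, i.e. `J_±/(√2 s)` with the standard ladder
operators `J_+ e_{k+1} = √((k+1)(2s-k)) e_k` and `J_- = J_+^*`. -/
noncomputable def spinMatrix (n : ℕ) : Idx → Matrix (Fin (n + 1)) (Fin (n + 1)) ℂ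
  | .plus => fun k l =>
      if (l : ℕ) = k + 1 then
        ((Real.sqrt (((k : ℝ) + 1) * ((n : ℝ) - k)) / (Real.sqrt 2 * ((n : ℝ) / 2)) : ℝ) : ℂ)
      else 0
  | .z => fun k l => if k = l then ((((n : ℝ) / 2 - k) / ((n : ℝ) / 2) : ℝ) : ℂ) else 0
  | .minus => fun k l =>
      if (k : ℕ) = l + 1 then
        ((Real.sqrt (((l : ℝ) + 1) * ((n : ℝ) - l)) / (Real.sqrt 2 * ((n : ℝ) / 2)) : ℝ) : ℂ)
      else 0

/-- Product-basis labels of the lattice spin system. -/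
abbrev Config (d n : ℕ) : Type := Site d → Fin (n + 1)

/-- The Hilbert space `ℓ²(Config)` on which all local operators act faithfully: for each finite
`Λ` it is `(⨂_{x ∈ Λ} ℂ^{2s+1}) ⊗ ℓ²(configurations outside of Λ)`. -/
abbrev Hilb (d n : ℕ) : Type := lp (fun _ : Config d n => ℂ) 2

/-- The coefficients of `(a at site x, identity at all other sites) ψ`. -/
noncomputable def siteCoeff {d n : ℕ} (x : Site d) (a : Matrix (Fin (n + 1)) (Fin (n + 1)) ℂ)
    (ψ : Config d n → ℂ) (η : Config d n) : ℂ :=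
  ∑ k, a (η x) k * ψ (Function.update η x k)

theorem hilb_summable {d n : ℕ} (ψ : Hilb d n) : Summable fun η => ‖ψ η‖ ^ 2 := by
  simpa using (lp.memℓp ψ).summable (by norm_num)

theorem hilb_norm_sq {d n : ℕ} (ψ : Hilb d n) : ‖ψ‖ ^ 2 = ∑' η, ‖ψ η‖ ^ 2 := by
  simpa using lp.norm_rpow_eq_tsum (p := 2) (by norm_num) ψ

/-- The permutation of configurations that applies `π` at the site `x`. -/
def sitePerm {d n : ℕ} (x : Site d) (π : Equiv.Perm (Fin (n + 1))) : Equiv.Perm (Config d n) :=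
  Equiv.piCongrRight fun y => if y = x then π else Equiv.refl _

theorem sitePerm_swap {d n : ℕ} (x : Site d) (η : Config d n) (k : Fin (n + 1)) :
    sitePerm x (Equiv.swap (η x) k) η = Function.update η x k := by
  funext y
  by_cases h : y = x
  · subst h; simp [sitePerm]
  · simp [sitePerm, h]

theorem siteCoeff_bound {d n : ℕ} (x : Site d) (a : Matrix (Fin (n + 1)) (Fin (n + 1)) ℂ)
    (ψ : Config d n → ℂ) (η : Config d n) :
    ‖siteCoeff x a ψ η‖ ^ 2 ≤
      (∑ j, ∑ k, ‖a j k‖ ^ 2) * ∑ k, ∑ j, ‖ψ (sitePerm x (Equiv.swap j k) η)‖ ^ 2 := by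
  have h1 : ‖siteCoeff x a ψ η‖ ^ 2 ≤ (∑ k, ‖a (η x) k‖ * ‖ψ (Function.update η x k)‖) ^ 2 := by
    gcongr
    refine (norm_sum_le _ _).trans (le_of_eq ?_)
    simp
  refine h1.trans ((Finset.sum_mul_sq_le_sq_mul_sq _ _ _).trans ?_)
  refine mul_le_mul ?_ (Finset.sum_le_sum fun k _ => ?_) (by positivity) (by positivity)
  · exact Finset.single_le_sum (f := fun j => ∑ k, ‖a j k‖ ^ 2)
      (fun j _ => by positivity) (Finset.mem_univ (η x))
  · rw [← sitePerm_swap x η k]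
    exact Finset.single_le_sum (f := fun j => ‖ψ (sitePerm x (Equiv.swap j k) η)‖ ^ 2)
      (fun j _ => by positivity) (Finset.mem_univ (η x))

theorem siteCoeff_hasSum {d n : ℕ} (x : Site d) (ψ : Hilb d n) :
    HasSum (fun η => ∑ k : Fin (n + 1), ∑ j, ‖ψ (sitePerm x (Equiv.swap j k) η)‖ ^ 2)
      (((n : ℝ) + 1) ^ 2 * ‖ψ‖ ^ 2) := by
  have h : ∀ j k : Fin (n + 1),
      HasSum (fun η => ‖ψ (sitePerm x (Equiv.swap j k) η)‖ ^ 2) (‖ψ‖ ^ 2) := by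
    intro j k
    have := (hilb_summable ψ).hasSum
    rw [← hilb_norm_sq] at this
    exact (Equiv.hasSum_iff (sitePerm x (Equiv.swap j k))).2 this
  have := hasSum_sum (s := Finset.univ) fun k _ => hasSum_sum (s := Finset.univ) fun j _ => h j k
  convert this using 1
  simp
  ring

theorem siteCoeff_memℓp {d n : ℕ} (x : Site d) (a : Matrix (Fin (n + 1)) (Fin (n + 1)) ℂ)
    (ψ : Hilb d n) : Memℓp (siteCoeff x a ψ) 2 := by
  refine memℓp_gen ?_
  have := ((siteCoeff_hasSum x ψ).summable.mul_left (∑ j, ∑ k, ‖a j k‖ ^ 2))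
  simpa using Summable.of_nonneg_of_le (fun η => by positivity) (siteCoeff_bound x a ψ) this

/-- The operator on `Hilb` acting as `a` at the site `x` and as the identity at all other
sites. -/
noncomputable def siteOp {d n : ℕ} (x : Site d) (a : Matrix (Fin (n + 1)) (Fin (n + 1)) ℂ) :
    Hilb d n →L[ℂ] Hilb d n :=
  LinearMap.mkContinuous
    { toFun := fun ψ => ⟨siteCoeff x a ψ, siteCoeff_memℓp x a ψ⟩
      map_add' := fun ψ χ => by
        ext η
        change siteCoeff x a (ψ + χ) η = siteCoeff x a ψ η + siteCoeff x a χ η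
        simp [siteCoeff, mul_add, Finset.sum_add_distrib]
      map_smul' := fun c ψ => by
        ext η
        simp [siteCoeff, Finset.mul_sum, mul_left_comm] }
    (Real.sqrt ((∑ j, ∑ k, ‖a j k‖ ^ 2) * ((n : ℝ) + 1) ^ 2))
    (fun ψ => by
      refine le_of_sq_le_sq ?_ (by positivity)
      rw [hilb_norm_sq, mul_pow, Real.sq_sqrt (by positivity), mul_assoc]
      have h := (siteCoeff_hasSum x ψ).mul_left (∑ j, ∑ k, ‖a j k‖ ^ 2)
      rw [← h.tsum_eq]
      exact Summable.tsum_le_tsum (siteCoeff_bound x a ψ)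
        (Summable.of_nonneg_of_le (fun η => by positivity) (siteCoeff_bound x a ψ) h.summable)
        h.summable)

/-- The local algebra `𝔄̂_Λ` of all operators on `⨂_{x ∈ Λ} ℂ^{2s+1}`, acting on `Hilb` as
`𝒜 ⊗ 1`; it is generated by the operators that act at one site of `Λ`. -/
noncomputable def localAlg (d n : ℕ) (Λ : Finset (Site d)) :
    StarSubalgebra ℂ (Hilb d n →L[ℂ] Hilb d n) :=
  StarAlgebra.adjoin ℂ {T | ∃ x ∈ Λ, ∃ a, T = siteOp x a}

/-- The quantum quasi-local algebra `𝔄̂`, the norm closure of the algebra generated by all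
`𝔄̂_Λ` with `Λ` finite. -/
noncomputable def quasiLocal (d n : ℕ) : StarSubalgebra ℂ (Hilb d n →L[ℂ] Hilb d n) :=
  (⨆ Λ : Finset (Site d), localAlg d n Λ).topologicalClosure

/-- The C*-algebra `𝔄̂` as a type. -/
abbrev QuantumAlg (d n : ℕ) : Type := quasiLocal d n

theorem localAlg_le {d n : ℕ} (Λ : Finset (Site d)) : localAlg d n Λ ≤ quasiLocal d n :=
  (le_iSup (fun Λ => localAlg d n Λ) Λ).trans (StarSubalgebra.le_topologicalClosure _)

/-- The spin operator `Ŝ_i(x) ∈ 𝔄̂`. -/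
noncomputable def quantumSpin {d : ℕ} (n : ℕ) (p : Site d × Idx) : QuantumAlg d n :=
  ⟨siteOp p.1 (spinMatrix n p.2),
    localAlg_le {p.1} (StarAlgebra.subset_adjoin ℂ _ ⟨p.1, by simp, _, rfl⟩)⟩

/-- The product `∏_x Ŝ_i(x)^{α_i(x)}` for fixed `i`. The factors commute, so the order of the
sites is irrelevant. -/
noncomputable def spinPower {d : ℕ} (n : ℕ) (i : Idx) (α : MultiIndex d) : QuantumAlg d n :=
  ((α.support.image Prod.fst).toList.map fun x => quantumSpin n (x, i) ^ α (x, i)).prod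

/-- The normal-ordered quantization of the monomial `M^α`: all `Ŝ_+` stand to the left of all
`Ŝ_z`, which stand to the left of all `Ŝ_-`. -/
noncomputable def quantizeMonomial {d : ℕ} (n : ℕ) (α : MultiIndex d) : QuantumAlg d n :=
  spinPower n .plus α * spinPower n .z α * spinPower n .minus α

/-- Quantization `𝔓 → 𝔄̂`, the linear extension of `quantizeMonomial`. -/
noncomputable def quantize {d : ℕ} (n : ℕ) (A : Poly d) : QuantumAlg d n :=
  ∑ α ∈ A.support, A.coeff α • quantizeMonomial n α

/-- The Hamiltonian `Ĥ_Λ`, the term by term quantization of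
`H_Λ = ∑_{α ∈ ℕ^{I × Λ}} V(α) M^α`. -/
noncomputable def hamiltonian {d : ℕ} (V : Potential d) (n : ℕ) (Λ : Finset (Site d)) :
    QuantumAlg d n :=
  ∑' α : MultiIndex d, V.restrict Λ α • quantizeMonomial n α

/-- The propagator `U_s(t; Ĥ_Λ) = exp(-i s t Ĥ_Λ)` with `s = n / 2`. -/
noncomputable def propagator {d : ℕ} (V : Potential d) (n : ℕ) (Λ : Finset (Site d)) (t : ℝ) :
    QuantumAlg d n :=
  NormedSpace.exp ((-(Complex.I * ((n : ℂ) / 2) * (t : ℂ))) • hamiltonian V n Λ)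

/-- `α` is the infinite-volume dynamics on `𝔄̂` for spin `s = n / 2`: a strongly continuous
one-parameter group of automorphisms that on each local algebra is the norm limit, as
`Λ → ℤ^d`, of the finite-volume dynamics `𝒜 ↦ U_s(t; Ĥ_Λ)^* 𝒜 U_s(t; Ĥ_Λ)`. -/
structure IsQuantumDynamics {d : ℕ} (V : Potential d) (n : ℕ)
    (α : ℝ → QuantumAlg d n ≃⋆ₐ[ℂ] QuantumAlg d n) : Prop where
  zero : ∀ a, α 0 a = a
  add : ∀ t u a, α (t + u) a = α t (α u a)
  continuous : ∀ a, Continuous fun t => α t a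
  limit : ∀ (Λ₀ : Finset (Site d)) (a : QuantumAlg d n),
    (a : Hilb d n →L[ℂ] Hilb d n) ∈ localAlg d n Λ₀ →
      ∀ t : ℝ, Tendsto (fun Λ => star (propagator V n Λ t) * a * propagator V n Λ t) atTop
        (𝓝 (α t a))

end SpinSystem

/-! Classical and quantum spins obey one and the same equation of motion once it is written for
noncommutative words in the letters M_i(x). The bracket with H is a derivation of words, fixed by
the Leibniz rule and the structure constants iε̃. Evaluated in commuting numbers it is the Poisson
bracket (`rep_adLetter`); evaluated in spin operators it is exactly is[H, ·], for every s
(`rep_adWord_quantumSpin`). So a classical trajectory, in finite or infinite volume, and every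
finite-volume Heisenberg evolution are curves of linear maps f_t on words that solve the same
equation, and at all times a word of length l is bounded by e^{l/2} (`IsWordSolution`).

On the norms Σ |B_w| e^{r|w|} the derivation is bounded from radius r + h to radius r by K/h
(`sum_norm_mul_wnorm_bracket_le`). Descending from radius 1 to 1/2 in N + 1 equal steps costs
(2K(N+1))^{N+1}, which the 1/N! of Taylor's formula beats for times shorter than 1/(2Ke). Hence f_t
A is close to f_0 B for some B in `Words`. The a priori bound does not deteriorate in time, so short
steps can be iterated up to any t (`exists_approx`). The element B and a finite set F of
multi-indices are chosen before the solution: the same B serves the classical system, all s, and all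
volumes whose restricted potential agrees with V on F.

This uniformity carries the rest. Two evolutions close to the same f_0 B are close to each other,
which gives uniqueness of the flow and convergence of the finite-volume dynamics, with density of
the evaluated words extending the limits to the whole algebra. Existence of the flow is
Picard–Lindelöf on bounded configurations, where conservation of each spin length keeps the solution
in the phase space (`exists_solutionCurve`). Finally A(t) is the commutative image of B. Classically
nothing is lost in passing to it; quantum mechanically, reordering letters costs O(1/s), because two
rescaled spins commute up to O(1/s) (`exists_norm_rep_sub_quantize_le`). -/

namespace SpinSystem

/-! ### Potentials with finite norm -/

/-- The letters `M_i(x)` of the noncommutative words. -/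
abbrev Letter (d : ℕ) : Type := Site d × Idx

/-- `K` bounds all the sums `∑_α |α(x)| |V(α)| e^{|α|}`. -/
def Potential.BoundedBy {d : ℕ} (V : Potential d) (K : ℝ) : Prop :=
  ∀ (x : Site d) (F : Finset (MultiIndex d)),
    ∑ α ∈ F, (α.at x : ℝ) * ‖V α‖ * Real.exp (α.degree : ℝ) ≤ K

/-- Moving the supremum over x outside the sum over the degree only decreases the norm, after which
the sum over α is regrouped by degree. Bounds on finite real sums pass at once to every dominated
potential. -/
theorem Potential.boundedBy_of_norm_lt_top {d : ℕ} {V : Potential d} (h : V.norm < ⊤) :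
    V.BoundedBy V.norm.toReal := by
  intro x F
  have key : ∑ α ∈ F, (α.at x : ℝ≥0∞) * ‖V α‖ₑ * ENNReal.ofReal (Real.exp (α.degree : ℝ)) ≤
      V.norm := by
    refine (ENNReal.sum_le_tsum F).trans ?_
    rw [← (Equiv.sigmaFiberEquiv (fun α : MultiIndex d => α.degree)).tsum_eq, ENNReal.tsum_sigma']
    refine ENNReal.tsum_le_tsum fun n => ?_
    refine le_trans ?_ (le_iSup _ x)
    refine ENNReal.tsum_le_tsum fun α => ?_
    rcases α with ⟨α, rfl⟩
    exact le_rfl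
  have := ENNReal.toReal_mono h.ne key
  rw [ENNReal.toReal_sum (fun α _ => by finiteness)] at this
  refine le_trans (le_of_eq (Finset.sum_congr rfl fun α _ => ?_)) this
  simp [ENNReal.toReal_mul, ENNReal.toReal_ofReal (Real.exp_pos _).le]

theorem Potential.BoundedBy.mono {d : ℕ} {V V' : Potential d} {K : ℝ} (h : V.BoundedBy K)
    (hV : ∀ α, ‖V' α‖ ≤ ‖V α‖) : V'.BoundedBy K := by
  intro x F
  refine le_trans (Finset.sum_le_sum fun α _ => ?_) (h x F)
  gcongr
  exact hV α

theorem Potential.BoundedBy.nonneg {d : ℕ} {V : Potential d} {K : ℝ} (h : V.BoundedBy K) :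
    0 ≤ K := by simpa using h 0 ∅

theorem Potential.norm_restrict_le {d : ℕ} (V : Potential d) (Λ : Finset (Site d))
    (α : MultiIndex d) : ‖V.restrict Λ α‖ ≤ ‖V α‖ := by
  unfold Potential.restrict
  split_ifs <;> simp

/-! ### Words -/

/-- Formal linear combinations of words in the letters `M_i(x)`. -/
abbrev Words (d : ℕ) : Type := List (Letter d) →₀ ℂ

/-- The word of a single list. -/
noncomputable abbrev ofWord {d : ℕ} (w : List (Letter d)) : Words d := Finsupp.single w 1

/-- Multiplication by a letter from the left. -/
noncomputable def lcons {d : ℕ} (a : Letter d) : Words d →ₗ[ℂ] Words d :=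
  Finsupp.lmapDomain ℂ ℂ (List.cons a)

/-- Multiplication by a word from the right. -/
noncomputable def rappend {d : ℕ} (w : List (Letter d)) : Words d →ₗ[ℂ] Words d :=
  Finsupp.lmapDomain ℂ ℂ (· ++ w)

/-- The bracket of two letters. -/
noncomputable def letterBracket {d : ℕ} (a b : Letter d) (u : List (Letter d)) : Words d :=
  if a.1 = b.1 then
    ∑ k : Idx, (Complex.I * (eps a.2 b.2 k : ℂ)) • ofWord ((b.1, k) :: u)
  else 0

/-- The bracket of the word `u` with the letter `b`. -/
noncomputable def adLetter {d : ℕ} : List (Letter d) → Letter d → Words d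
  | [], _ => 0
  | a :: u, b => letterBracket a b u + lcons a (adLetter u b)

/-- The bracket of the word `u` with a word. -/
noncomputable def adWord {d : ℕ} (u : List (Letter d)) : List (Letter d) → Words d
  | [] => 0
  | b :: w => rappend w (adLetter u b) + lcons b (adWord u w)

/-- The bracket with the word `u`, as a linear map. -/
noncomputable def bracket {d : ℕ} (u : List (Letter d)) : Words d →ₗ[ℂ] Words d :=
  Finsupp.linearCombination ℂ (adWord u)

@[simp] theorem bracket_ofWord {d : ℕ} (u w : List (Letter d)) :
    bracket u (ofWord w) = adWord u w := by
  simp [bracket]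

/-- The evaluation of words, given the values of the letters. -/
noncomputable def rep {d : ℕ} {𝔅 : Type*} [Ring 𝔅] [Algebra ℂ 𝔅] (s : Letter d → 𝔅) :
    Words d →ₗ[ℂ] 𝔅 :=
  Finsupp.linearCombination ℂ fun w => (w.map s).prod

section rep
variable {d : ℕ} {𝔅 : Type*} [Ring 𝔅] [Algebra ℂ 𝔅] (s : Letter d → 𝔅)

@[simp] theorem rep_ofWord (w : List (Letter d)) : rep s (ofWord w) = (w.map s).prod := by
  simp [rep]

theorem rep_lcons (a : Letter d) (B : Words d) : rep s (lcons a B) = s a * rep s B := by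
  induction B using Finsupp.induction_linear with
  | zero => simp
  | add f g hf hg => simp [hf, hg, mul_add]
  | single w c => simp [rep, lcons]

theorem rep_rappend (w : List (Letter d)) (B : Words d) :
    rep s (rappend w B) = rep s B * (w.map s).prod := by
  induction B using Finsupp.induction_linear with
  | zero => simp
  | add f g hf hg => simp [hf, hg, add_mul]
  | single w c => simp [rep, rappend]

end rep

/-! ### The normally ordered word of a multi-index -/

/-- The letters `M_i(x)`, for fixed `i`, of the monomial `M^α`. -/
noncomputable def wordPart {d : ℕ} (i : Idx) (α : MultiIndex d) : List (Letter d) :=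
  (α.support.image Prod.fst).toList.flatMap fun x => List.replicate (α (x, i)) (x, i)

/-- The normally ordered word of the monomial `M^α`. -/
noncomputable def normalWord {d : ℕ} (α : MultiIndex d) : List (Letter d) :=
  wordPart .plus α ++ wordPart .z α ++ wordPart .minus α

theorem count_wordPart {d : ℕ} (i : Idx) (α : MultiIndex d) (p : Letter d) :
    (wordPart i α).count p = if p.2 = i then α p else 0 := by
  classical
  have aux : ∀ l : List (Site d), l.Nodup →
      (l.flatMap fun x => List.replicate (α (x, i)) (x, i)).count p =
        if p.1 ∈ l ∧ p.2 = i then α p else 0 := by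
    intro l hl
    induction l with
    | nil => simp
    | cons y l ih =>
      rw [List.nodup_cons] at hl
      rw [List.flatMap_cons, List.count_append, ih hl.2, List.count_replicate]
      obtain ⟨x, j⟩ := p
      by_cases hy : x = y
      · subst hy
        by_cases hj : j = i
        · subst hj; simp [hl.1]
        · simp [hj, Ne.symm hj]
      · simp [hy, Ne.symm hy]
  rw [wordPart, aux _ (Finset.nodup_toList _)]
  by_cases hp : α p = 0
  · simp [hp]
  · have : p.1 ∈ α.support.image Prod.fst :=
      Finset.mem_image_of_mem _ (Finsupp.mem_support_iff.2 hp)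
    simp only [Finset.mem_toList, this, true_and]

theorem count_normalWord {d : ℕ} (α : MultiIndex d) (p : Letter d) :
    (normalWord α).count p = α p := by
  rw [normalWord, List.count_append, List.count_append, count_wordPart, count_wordPart,
    count_wordPart]
  rcases p with ⟨x, i⟩
  cases i <;> simp

/-- The order of the letters is all that `normalWord` adds to α, so commutative statements about it
reduce to multisets. -/
theorem toMultiset_eq_normalWord {d : ℕ} (α : MultiIndex d) :
    Finsupp.toMultiset α = (normalWord α : Multiset (Letter d)) := by
  classical
  ext p
  rw [Finsupp.count_toMultiset, Multiset.coe_count, ← count_normalWord]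
  congr!

theorem length_normalWord {d : ℕ} (α : MultiIndex d) : (normalWord α).length = α.degree := by
  rw [← Multiset.coe_card, ← toMultiset_eq_normalWord, Finsupp.card_toMultiset]
  rfl

/-- The number of letters of `u` at the site `x`. -/
def siteCount {d : ℕ} (x : Site d) (u : List (Letter d)) : ℕ := u.countP (fun a => a.1 = x)

theorem siteCount_cons {d : ℕ} (x : Site d) (a : Letter d) (u : List (Letter d)) :
    siteCount x (a :: u) = siteCount x u + if a.1 = x then 1 else 0 := by
  simp [siteCount, List.countP_cons]

theorem siteCount_eq_sum {d : ℕ} (x : Site d) (u : List (Letter d)) :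
    siteCount x u = ∑ i : Idx, u.count (x, i) := by
  induction u with
  | nil => simp [siteCount]
  | cons a u ih =>
    rw [siteCount_cons, ih]
    simp only [List.count_cons, Finset.sum_add_distrib]
    congr 1
    rcases a with ⟨y, j⟩
    by_cases h : y = x
    · subst h; simp
    · simp [h]

theorem siteCount_normalWord {d : ℕ} (x : Site d) (α : MultiIndex d) :
    siteCount x (normalWord α) = α.at x := by
  rw [siteCount_eq_sum, MultiIndex.at]
  simp only [count_normalWord]

/-! ### Weighted norms of words -/

/-- The norm `∑_w |B_w| e^{r |w|}`. -/
noncomputable def wnorm {d : ℕ} (r : ℝ) (B : Words d) : ℝ :=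
  B.sum fun w c => ‖c‖ * Real.exp (r * w.length)

section wnorm
variable {d : ℕ} (r : ℝ)

theorem wnorm_eq_sum {B : Words d} {S : Finset (List (Letter d))} (h : B.support ⊆ S) :
    wnorm r B = ∑ w ∈ S, ‖B w‖ * Real.exp (r * w.length) :=
  Finsupp.sum_of_support_subset _ h _ (by simp)

theorem wnorm_nonneg (B : Words d) : 0 ≤ wnorm r B :=
  Finset.sum_nonneg fun w _ => by positivity

@[simp] theorem wnorm_zero : wnorm r (0 : Words d) = 0 := by simp [wnorm]

theorem wnorm_add_le (B C : Words d) : wnorm r (B + C) ≤ wnorm r B + wnorm r C := by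
  classical
  rw [wnorm_eq_sum r (Finsupp.support_add : _ ⊆ B.support ∪ C.support),
    wnorm_eq_sum r (Finset.subset_union_left : B.support ⊆ B.support ∪ C.support),
    wnorm_eq_sum r (Finset.subset_union_right : C.support ⊆ B.support ∪ C.support),
    ← Finset.sum_add_distrib]
  refine Finset.sum_le_sum fun w _ => ?_
  rw [← add_mul]
  gcongr
  exact norm_add_le _ _

theorem wnorm_sum_le {ι : Type*} (S : Finset ι) (B : ι → Words d) :
    wnorm r (∑ i ∈ S, B i) ≤ ∑ i ∈ S, wnorm r (B i) :=
  Finset.le_sum_of_subadditive _ (wnorm_zero r).le (wnorm_add_le r) _ _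

theorem wnorm_smul (c : ℂ) (B : Words d) : wnorm r (c • B) = ‖c‖ * wnorm r B := by
  rw [wnorm_eq_sum r (Finsupp.support_smul : (c • B).support ⊆ B.support),
    wnorm_eq_sum r (subset_refl B.support), Finset.mul_sum]
  simp [mul_assoc]

theorem wnorm_ofWord (w : List (Letter d)) : wnorm r (ofWord w) = Real.exp (r * w.length) := by
  simp [wnorm]

/-- To bound the norm of the image under a linear map, it is enough to consider words. -/
theorem wnorm_map_le {r' C : ℝ} (T : Words d →ₗ[ℂ] Words d)
    (h : ∀ w, wnorm r (T (ofWord w)) ≤ C * Real.exp (r' * w.length)) (B : Words d) :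
    wnorm r (T B) ≤ C * wnorm r' B := by
  have hB : B = ∑ w ∈ B.support, B w • ofWord w := by
    conv_lhs => rw [← Finsupp.sum_single B]
    simp [Finsupp.sum]
  conv_lhs => rw [hB, map_sum]
  refine (wnorm_sum_le r _ _).trans ?_
  rw [wnorm_eq_sum r' (subset_refl B.support), Finset.mul_sum]
  refine Finset.sum_le_sum fun w _ => ?_
  rw [map_smul, wnorm_smul]
  calc ‖B w‖ * wnorm r (T (ofWord w)) ≤ ‖B w‖ * (C * Real.exp (r' * w.length)) := by
        gcongr; exact h w
    _ = _ := by ring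

theorem wnorm_lcons_le (a : Letter d) (B : Words d) :
    wnorm r (lcons a B) ≤ Real.exp r * wnorm r B := by
  refine wnorm_map_le r _ (fun w => le_of_eq ?_) B
  rw [lcons, Finsupp.lmapDomain_apply, Finsupp.mapDomain_single, wnorm_ofWord, ← Real.exp_add]
  congr 1
  push_cast [List.length_cons]
  ring

theorem wnorm_rappend_le (w : List (Letter d)) (B : Words d) :
    wnorm r (rappend w B) ≤ Real.exp (r * w.length) * wnorm r B := by
  refine wnorm_map_le r _ (fun v => le_of_eq ?_) B
  rw [rappend, Finsupp.lmapDomain_apply, Finsupp.mapDomain_single, wnorm_ofWord, ← Real.exp_add]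
  congr 1
  push_cast [List.length_append]
  ring

theorem sum_abs_eps_le (i j : Idx) : ∑ k : Idx, |eps i j k| ≤ 1 := by
  cases i <;> cases j <;> decide

theorem wnorm_letterBracket_le (a b : Letter d) (u : List (Letter d)) :
    wnorm r (letterBracket a b u) ≤
      (if a.1 = b.1 then 1 else 0) * Real.exp (r * (u.length + 1)) := by
  unfold letterBracket
  split_ifs with h
  · refine (wnorm_sum_le r _ _).trans ?_
    simp only [wnorm_smul, wnorm_ofWord, List.length_cons, Nat.cast_add, Nat.cast_one]
    rw [← Finset.sum_mul]
    gcongr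
    have := sum_abs_eps_le a.2 b.2
    have h2 : ((∑ k : Idx, |eps a.2 b.2 k| : ℤ) : ℝ) ≤ 1 := by exact_mod_cast this
    push_cast at h2
    simpa using h2
  · simp

/-- Bracketing with `b` exchanges one letter of `u` at the site of `b` for another letter, so the
length stays |u|. Each such letter contributes at most once, since two letters bracket to at most
one letter with coefficient of modulus one. -/
theorem wnorm_adLetter_le (u : List (Letter d)) (b : Letter d) :
    wnorm r (adLetter u b) ≤ siteCount b.1 u * Real.exp (r * u.length) := by
  induction u with
  | nil => simp [adLetter, siteCount]
  | cons a u ih =>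
    rw [adLetter]
    refine (wnorm_add_le r _ _).trans ?_
    refine (add_le_add (wnorm_letterBracket_le r a b u) ((wnorm_lcons_le r a _).trans
      (mul_le_mul_of_nonneg_left ih (Real.exp_pos r).le))).trans (le_of_eq ?_)
    have : Real.exp (r * (u.length + 1)) = Real.exp r * Real.exp (r * u.length) := by
      rw [← Real.exp_add]; congr 1; ring
    rw [siteCount_cons]
    push_cast [List.length_cons]
    rw [this]
    split_ifs <;> ring

/-- The words produced have length |u| + |w| − 1. The missing letter is wasted through 1 ≤ e^r,
which makes the induction close. -/
theorem wnorm_adWord_le (hr : 0 ≤ r) (u w : List (Letter d)) :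
    wnorm r (adWord u w) ≤
      ((w.map fun b => (siteCount b.1 u : ℝ)).sum) * Real.exp (r * u.length) *
        Real.exp (r * w.length) := by
  induction w with
  | nil => simp [adWord]
  | cons b w ih =>
    rw [adWord]
    refine (wnorm_add_le r _ _).trans ?_
    refine (add_le_add ((wnorm_rappend_le r w _).trans
      (mul_le_mul_of_nonneg_left (wnorm_adLetter_le r u b) (Real.exp_pos _).le))
      ((wnorm_lcons_le r b _).trans (mul_le_mul_of_nonneg_left ih (Real.exp_pos r).le))).trans ?_
    have : Real.exp (r * (w.length + 1)) = Real.exp r * Real.exp (r * w.length) := by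
      rw [← Real.exp_add]; congr 1; ring
    push_cast [List.length_cons, List.map_cons, List.sum_cons]
    rw [this]
    have h1 : 1 ≤ Real.exp r := Real.one_le_exp hr
    have h2 : 0 ≤ Real.exp (r * w.length) * (siteCount b.1 u * Real.exp (r * u.length)) := by
      positivity
    nlinarith [mul_le_mul_of_nonneg_right h1 h2]

end wnorm

/-! ### The derivation of a potential -/

section derivation
variable {d : ℕ} {V : Potential d} {K : ℝ}

/-- Each letter of `w` sees only the letters of α at its own site, hence the weight |α(x)| in the
norm of V, and contributes at most K. The restriction r ≤ 1 lets e^{r|α|} be absorbed by the weight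
e^{|α|}. -/
theorem sum_norm_mul_wnorm_adWord_le (hV : V.BoundedBy K) {r : ℝ} (hr : 0 ≤ r) (hr1 : r ≤ 1)
    (w : List (Letter d)) (F : Finset (MultiIndex d)) :
    ∑ α ∈ F, ‖V α‖ * wnorm r (adWord (normalWord α) w) ≤
      w.length * K * Real.exp (r * w.length) := by
  have step : ∀ α ∈ F, ‖V α‖ * wnorm r (adWord (normalWord α) w) ≤
      (w.map fun b => (α.at b.1 : ℝ) * ‖V α‖ * Real.exp (α.degree : ℝ)).sum *
        Real.exp (r * w.length) := by
    intro α _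
    refine (mul_le_mul_of_nonneg_left (wnorm_adWord_le r hr _ w) (norm_nonneg _)).trans ?_
    simp only [siteCount_normalWord, length_normalWord]
    rw [← mul_assoc, ← mul_assoc, List.sum_map_mul_right, List.sum_map_mul_right,
      mul_comm ‖V α‖]
    have h0 : 0 ≤ (w.map fun b => (α.at b.1 : ℝ)).sum := List.sum_nonneg (by
      simp only [List.mem_map]
      rintro _ ⟨b, _, rfl⟩
      positivity)
    gcongr
    exact mul_le_of_le_one_left (by positivity) hr1
  refine (Finset.sum_le_sum step).trans ?_
  rw [← Finset.sum_mul]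
  gcongr
  clear step
  induction w with
  | nil => simp
  | cons b w ih =>
    simp only [List.map_cons, List.sum_cons, Finset.sum_add_distrib]
    push_cast [List.length_cons]
    linarith [hV b.1 F]

/-- A Cauchy estimate: the length factor |w| produced by the Leibniz rule is paid for by h|w| ≤
e^{h|w|}, that is, by a loss h of radius. -/
theorem sum_norm_mul_wnorm_bracket_le (hV : V.BoundedBy K) {r h : ℝ} (hr : 0 ≤ r) (hh : 0 < h)
    (hr1 : r ≤ 1) (B : Words d) (F : Finset (MultiIndex d)) :
    ∑ α ∈ F, ‖V α‖ * wnorm r (bracket (normalWord α) B) ≤ K / h * wnorm (r + h) B := by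
  have hB : B = ∑ w ∈ B.support, B w • ofWord w := by
    conv_lhs => rw [← Finsupp.sum_single B]
    simp [Finsupp.sum]
  have h1 : ∀ α ∈ F, ‖V α‖ * wnorm r (bracket (normalWord α) B) ≤
      ∑ w ∈ B.support, ‖B w‖ * (‖V α‖ * wnorm r (adWord (normalWord α) w)) := by
    intro α _
    conv_lhs => rw [hB, map_sum]
    refine (mul_le_mul_of_nonneg_left (wnorm_sum_le r _ _) (norm_nonneg _)).trans ?_
    rw [Finset.mul_sum]
    refine Finset.sum_le_sum fun w _ => le_of_eq ?_
    rw [map_smul, wnorm_smul, bracket_ofWord]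
    ring
  refine (Finset.sum_le_sum h1).trans ?_
  rw [Finset.sum_comm, wnorm_eq_sum (r + h) (subset_refl B.support), Finset.mul_sum]
  refine Finset.sum_le_sum fun w _ => ?_
  rw [← Finset.mul_sum]
  refine (mul_le_mul_of_nonneg_left (sum_norm_mul_wnorm_adWord_le hV hr hr1 w F)
    (norm_nonneg _)).trans ?_
  have h2 : h * w.length ≤ Real.exp (h * w.length) :=
    (by linarith : h * w.length ≤ h * w.length + 1).trans (Real.add_one_le_exp _)
  have h3 : (w.length : ℝ) ≤ Real.exp (h * w.length) / h := by
    rw [le_div_iff₀ hh]; linarith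
  have hK := hV.nonneg
  calc ‖B w‖ * (w.length * K * Real.exp (r * w.length))
      ≤ ‖B w‖ * (Real.exp (h * w.length) / h * K * Real.exp (r * w.length)) := by gcongr
    _ = K / h * (‖B w‖ * (Real.exp (h * w.length) * Real.exp (r * w.length))) := by ring
    _ = K / h * (‖B w‖ * Real.exp ((r + h) * w.length)) := by
        rw [← Real.exp_add]; congr 4; ring

/-- The bracket with the part of `V` that is supported in `F`. -/
noncomputable def finBracket (V : Potential d) (F : Finset (MultiIndex d)) (B : Words d) :
    Words d := ∑ α ∈ F, V α • bracket (normalWord α) B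

theorem wnorm_finBracket_le (hV : V.BoundedBy K) {r h : ℝ} (hr : 0 ≤ r) (hh : 0 < h)
    (hr1 : r ≤ 1) (B : Words d) (F : Finset (MultiIndex d)) :
    wnorm r (finBracket V F B) ≤ K / h * wnorm (r + h) B := by
  refine (wnorm_sum_le r _ _).trans ?_
  simp only [wnorm_smul]
  exact sum_norm_mul_wnorm_bracket_le hV hr hh hr1 B F

theorem summable_norm_mul_wnorm_bracket (hV : V.BoundedBy K) (B : Words d) :
    Summable fun α => ‖V α‖ * wnorm (1 / 2) (bracket (normalWord α) B) :=
  summable_of_sum_le (fun α => mul_nonneg (norm_nonneg _) (wnorm_nonneg _ _))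
    (sum_norm_mul_wnorm_bracket_le hV (by norm_num) (by norm_num : (0 : ℝ) < 1 / 2)
      (by norm_num) B)

end derivation

/-! ### Solutions of the equation of motion on words -/

/-- `f` solves the equation of motion of the potential `V` on words: `f t w` is the value of the
word `w` at time `t`. -/
structure IsWordSolution {d : ℕ} (V : Potential d) {E : Type*} [NormedAddCommGroup E]
    [NormedSpace ℂ E] (f : ℝ → Words d →ₗ[ℂ] E) : Prop where
  bound : ∀ t w, ‖f t (ofWord w)‖ ≤ Real.exp (1 / 2 * w.length)
  deriv : ∀ t w, HasDerivAt (fun τ => f τ (ofWord w))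
    (∑' α : MultiIndex d, V α • f t (bracket (normalWord α) (ofWord w))) t

theorem Words.eq_sum {d : ℕ} (B : Words d) : B = ∑ w ∈ B.support, B w • ofWord w := by
  conv_lhs => rw [← Finsupp.sum_single B]
  simp [Finsupp.sum]

theorem norm_apply_le_mul_wnorm {d : ℕ} {E : Type*} [NormedAddCommGroup E] [NormedSpace ℂ E]
    {f : Words d →ₗ[ℂ] E} {r C : ℝ} (hf : ∀ w, ‖f (ofWord w)‖ ≤ C * Real.exp (r * w.length))
    (B : Words d) : ‖f B‖ ≤ C * wnorm r B := by
  conv_lhs => rw [B.eq_sum, map_sum]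
  refine (norm_sum_le _ _).trans ?_
  rw [wnorm, Finsupp.sum, Finset.mul_sum]
  refine Finset.sum_le_sum fun w _ => ?_
  rw [map_smul, norm_smul, mul_left_comm]
  exact mul_le_mul_of_nonneg_left (hf w) (norm_nonneg _)

theorem norm_apply_le_wnorm {d : ℕ} {E : Type*} [NormedAddCommGroup E] [NormedSpace ℂ E]
    {f : Words d →ₗ[ℂ] E} {r : ℝ} (hf : ∀ w, ‖f (ofWord w)‖ ≤ Real.exp (r * w.length))
    (B : Words d) : ‖f B‖ ≤ wnorm r B := by
  simpa using norm_apply_le_mul_wnorm (C := 1) (by simpa using hf) B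

namespace IsWordSolution

variable {d : ℕ} {V V' : Potential d} {K : ℝ} {E : Type*} [NormedAddCommGroup E]
  [NormedSpace ℂ E] {f : ℝ → Words d →ₗ[ℂ] E}

theorem norm_le (hf : IsWordSolution V f) (t : ℝ) (B : Words d) : ‖f t B‖ ≤ wnorm (1 / 2) B :=
  norm_apply_le_wnorm (hf.bound t) B

/-- The equation is autonomous and its bound is the same at all times, so short-time estimates may
be restarted anywhere. -/
theorem shift (hf : IsWordSolution V f) (u : ℝ) : IsWordSolution V fun t => f (t + u) where
  bound _ w := hf.bound _ w
  deriv t w := (hf.deriv (t + u) w).comp_add_const t u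

theorem norm_smul_bracket_le (hf : IsWordSolution V f) (t : ℝ) (B : Words d) (α : MultiIndex d) :
    ‖V α • f t (bracket (normalWord α) B)‖ ≤
      ‖V α‖ * wnorm (1 / 2) (bracket (normalWord α) B) := by
  rw [norm_smul]
  exact mul_le_mul_of_nonneg_left (hf.norm_le t _) (norm_nonneg _)

theorem norm_tsum_le (hf : IsWordSolution V f) (hV : V.BoundedBy K) (t : ℝ) (B : Words d)
    {h : ℝ} (hh : 0 < h) :
    ‖∑' α, V α • f t (bracket (normalWord α) B)‖ ≤ K / h * wnorm (1 / 2 + h) B := by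
  have hs := summable_norm_mul_wnorm_bracket hV B
  refine (tsum_of_norm_bounded hs.hasSum (hf.norm_smul_bracket_le t B)).trans ?_
  exact hs.tsum_le_of_sum_le
    (sum_norm_mul_wnorm_bracket_le hV (by norm_num) hh (by norm_num) B)

variable [CompleteSpace E]

theorem summable (hf : IsWordSolution V f) (hV : V.BoundedBy K) (t : ℝ) (B : Words d) :
    Summable fun α => V α • f t (bracket (normalWord α) B) :=
  Summable.of_norm_bounded (summable_norm_mul_wnorm_bracket hV B) (hf.norm_smul_bracket_le t B)

theorem hasDerivAt (hf : IsWordSolution V f) (hV : V.BoundedBy K) (t : ℝ) (B : Words d) :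
    HasDerivAt (fun τ => f τ B) (∑' α, V α • f t (bracket (normalWord α) B)) t := by
  have h1 : (fun τ => f τ B) = fun τ => ∑ w ∈ B.support, B w • f τ (ofWord w) := by
    funext τ
    conv_lhs => rw [B.eq_sum, map_sum]
    simp only [map_smul]
  have h2 : ∑' α, V α • f t (bracket (normalWord α) B) = ∑ w ∈ B.support,
      B w • ∑' α, V α • f t (bracket (normalWord α) (ofWord w)) := by
    have h3 : ∀ w ∈ B.support, HasSum
        (fun α => B w • V α • f t (bracket (normalWord α) (ofWord w)))
        (B w • ∑' α, V α • f t (bracket (normalWord α) (ofWord w))) :=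
      fun w _ => (hf.summable hV t (ofWord w)).hasSum.const_smul (B w)
    rw [← (hasSum_sum h3).tsum_eq]
    congr 1
    funext α
    conv_lhs => rw [B.eq_sum, map_sum, map_sum, Finset.smul_sum]
    refine Finset.sum_congr rfl fun w _ => ?_
    rw [map_smul, map_smul, smul_comm]
  rw [h1, h2]
  exact HasDerivAt.fun_sum fun w _ => (hf.deriv t w).const_smul (B w)

theorem lipschitz (hf : IsWordSolution V f) (hV : V.BoundedBy K) (t u : ℝ) (B : Words d) :
    ‖f t B - f u B‖ ≤ 2 * K * wnorm 1 B * |t - u| := by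
  have := Convex.norm_image_sub_le_of_norm_hasDerivWithin_le (𝕜 := ℝ) (s := Set.univ)
    (fun τ _ => (hf.hasDerivAt hV τ B).hasDerivWithinAt)
    (fun τ _ => hf.norm_tsum_le hV τ B (h := 1 / 2) (by norm_num)) convex_univ
    (Set.mem_univ u) (Set.mem_univ t)
  refine this.trans (le_of_eq ?_)
  rw [Real.norm_eq_abs, add_halves]
  ring

end IsWordSolution

/-- `V'` is dominated by `V` and agrees with it on `F`. -/
def Potential.Approximates {d : ℕ} (V' V : Potential d) (F : Finset (MultiIndex d)) : Prop :=
  (∀ α, ‖V' α‖ ≤ ‖V α‖) ∧ ∀ α ∈ F, V' α = V α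

theorem Potential.Approximates.mono {d : ℕ} {V' V : Potential d} {F G : Finset (MultiIndex d)}
    (h : V'.Approximates V G) (hFG : F ⊆ G) : V'.Approximates V F :=
  ⟨h.1, fun α hα => h.2 α (hFG hα)⟩

theorem Potential.Approximates.refl {d : ℕ} (V : Potential d) (F : Finset (MultiIndex d)) :
    V.Approximates V F := ⟨fun _ => le_rfl, fun _ _ => rfl⟩

/-! ### Taylor approximation, uniform over all solutions and approximating potentials -/

section approximation

variable {d : ℕ} {V : Potential d} {K : ℝ}

/-- `F` is read off from the tail of the majorant Σ |V(α)| ‖{M^α, B}‖, which knows nothing of the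
solution. This is the source of all uniformity in s, in the volume and in time. -/
theorem exists_finBracket_approx (hV : V.BoundedBy K) (B : Words d) {δ : ℝ} (hδ : 0 < δ) :
    ∃ F : Finset (MultiIndex d), ∀ V' : Potential d, V'.Approximates V F →
      ∀ {E : Type} [NormedAddCommGroup E] [NormedSpace ℂ E] [CompleteSpace E]
        {f : ℝ → Words d →ₗ[ℂ] E}, IsWordSolution V' f → ∀ t,
        ‖(∑' α, V' α • f t (bracket (normalWord α) B)) - f t (finBracket V F B)‖ ≤ δ := by
  obtain ⟨F, hF⟩ := summable_iff_vanishing_norm.1 (summable_norm_mul_wnorm_bracket hV B) δ hδ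
  refine ⟨F, fun V' hV' E _ _ _ f hf t => ?_⟩
  classical
  have hs := (hf.summable (hV.mono hV'.1) t B).hasSum
  refine le_of_tendsto (hs.sub_const _).norm ?_
  filter_upwards [eventually_ge_atTop F] with S hS
  have h1 : f t (finBracket V F B) = ∑ α ∈ F, V' α • f t (bracket (normalWord α) B) := by
    rw [finBracket, map_sum]
    refine Finset.sum_congr rfl fun α hα => ?_
    rw [map_smul, hV'.2 α hα]
  rw [h1, ← Finset.sum_sdiff_eq_sub hS]
  refine (norm_sum_le _ _).trans ((Finset.sum_le_sum fun α _ => ?_).trans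
    ((le_abs_self _).trans (hF (S \ F) Finset.sdiff_disjoint).le))
  refine (hf.norm_smul_bracket_le t B α).trans ?_
  exact mul_le_mul_of_nonneg_right (hV'.1 α) (wnorm_nonneg _ _)

/-- Iterated brackets with finite parts of the potential. -/
noncomputable def iterBracket (V : Potential d) (F : Words d → Finset (MultiIndex d))
    (A : Words d) : ℕ → Words d
  | 0 => A
  | k + 1 => finBracket V (F (iterBracket V F A k)) (iterBracket V F A k)

theorem wnorm_iterBracket_le (hV : V.BoundedBy K) (F : Words d → Finset (MultiIndex d))
    (A : Words d) {h : ℝ} (hh : 0 < h) (k : ℕ) (hk : k * h ≤ 1) :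
    wnorm (1 - k * h) (iterBracket V F A k) ≤ (K / h) ^ k * wnorm 1 A := by
  induction k with
  | zero => simp [iterBracket]
  | succ k ih =>
    push_cast at hk ⊢
    have hK := hV.nonneg
    have h0 : 0 ≤ (k : ℝ) * h := by positivity
    refine (wnorm_finBracket_le hV (h := h) (by linarith) hh (by linarith) _ _).trans ?_
    have : 1 - ((k : ℝ) + 1) * h + h = 1 - k * h := by ring
    rw [this, pow_succ', mul_assoc]
    exact mul_le_mul_of_nonneg_left (ih (by linarith)) (by positivity)

/-- This is the Taylor remainder with h = 1/(2(N+1)), so that N + 1 brackets lead from radius 1 to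
radius 1/2. The time 1/(4Ke) is half the critical 1/(2Ke), which leaves a factor (N+1) 2^{-N}. -/
theorem exists_remainder_le (hK : 0 < K) (C : ℝ) {η : ℝ} (hη : 0 < η) :
    ∃ N : ℕ, (1 / (4 * K * Real.exp 1)) ^ N / N.factorial *
      ((K / (1 / (2 * ((N : ℝ) + 1)))) ^ (N + 1) * C) ≤ η := by
  wlog hC : 0 ≤ C generalizing C
  · obtain ⟨N, hN⟩ := this 0 le_rfl
    refine ⟨N, le_trans ?_ hN⟩
    gcongr
    exact (not_le.1 hC).le
  have e0 := Real.exp_pos 1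
  have lim : Tendsto (fun N : ℕ => 2 * K * Real.exp 1 * C * (((N : ℝ) + 1) * (1 / 2) ^ N)) atTop
      (𝓝 0) := by
    have h1 := tendsto_self_mul_const_pow_of_lt_one (r := 1 / 2) (by norm_num) (by norm_num)
    have h2 := tendsto_pow_atTop_nhds_zero_of_lt_one (r := (1 / 2 : ℝ)) (by norm_num)
      (by norm_num)
    have := (h1.add h2).const_mul (2 * K * Real.exp 1 * C)
    simp only [add_zero, mul_zero] at this
    refine this.congr fun N => ?_
    ring
  obtain ⟨N, hN⟩ := (lim.eventually (eventually_le_nhds hη)).exists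
  refine ⟨N, le_trans ?_ hN⟩
  -- The bound x^k/k! ≤ e^x at x = k = N + 1 replaces Stirling's formula.
  have h1 := Real.pow_div_factorial_le_exp ((N : ℝ) + 1) (by positivity) (N + 1)
  rw [Nat.factorial_succ] at h1
  push_cast at h1
  have hf : (0 : ℝ) < N.factorial := by positivity
  have h2 : ((N : ℝ) + 1) ^ (N + 1) / N.factorial ≤ (N + 1) * Real.exp (N + 1) := by
    rw [div_le_iff₀ (by positivity)] at h1 ⊢
    linarith
  have h3 : Real.exp ((N : ℝ) + 1) = Real.exp 1 ^ (N + 1) := by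
    rw [← Real.exp_nat_mul]; push_cast; ring_nf
  calc (1 / (4 * K * Real.exp 1)) ^ N / N.factorial *
      ((K / (1 / (2 * ((N : ℝ) + 1)))) ^ (N + 1) * C)
      = (1 / (4 * K * Real.exp 1)) ^ N * (2 * K) ^ (N + 1) * C *
        (((N : ℝ) + 1) ^ (N + 1) / N.factorial) := by
        rw [div_div_eq_mul_div, div_one, show K * (2 * ((N : ℝ) + 1)) = (2 * K) * (N + 1) by ring,
          mul_pow]
        ring
    _ ≤ (1 / (4 * K * Real.exp 1)) ^ N * (2 * K) ^ (N + 1) * C *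
        ((N + 1) * Real.exp (N + 1)) := by gcongr
    _ = 2 * K * Real.exp 1 * C * (((N : ℝ) + 1) *
        ((1 / (4 * K * Real.exp 1)) * (2 * K * Real.exp 1)) ^ N) := by
        rw [h3, mul_pow (1 / (4 * K * Real.exp 1)), mul_pow (2 * K)]
        generalize (1 / (4 * K * Real.exp 1)) = y
        generalize 2 * K = z
        ring
    _ = _ := by
        have : (1 / (4 * K * Real.exp 1)) * (2 * K * Real.exp 1) = 1 / 2 := by
          field_simp
          norm_num
        rw [this]

theorem exists_approx_of_abs_le (hV : V.BoundedBy K) (hK : 0 < K) (A : Words d) {t : ℝ}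
    (ht : |t| ≤ 1 / (4 * K * Real.exp 1)) {ε : ℝ} (hε : 0 < ε) :
    ∃ (B : Words d) (F : Finset (MultiIndex d)), ∀ V' : Potential d, V'.Approximates V F →
      ∀ {E : Type} [NormedAddCommGroup E] [NormedSpace ℂ E] [CompleteSpace E]
        {f : ℝ → Words d →ₗ[ℂ] E}, IsWordSolution V' f → ‖f t A - f 0 B‖ ≤ ε := by
  -- The constants are tuned so that the truncation errors, at most e^T δ, and the remainder each
  -- contribute ε/(2(T+1)) to the derivative of the interpolating function; integrating over a time
  -- |t| ≤ T then gives at most ε.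
  set T : ℝ := 1 / (4 * K * Real.exp 1) with hT
  have hT0 : 0 < T := by positivity
  have hδ : 0 < ε / (2 * Real.exp T * (T + 1)) := by positivity
  set δ := ε / (2 * Real.exp T * (T + 1)) with hδdef
  have hη : 0 < ε / (2 * (T + 1)) := by positivity
  choose F hF using fun B => exists_finBracket_approx hV B hδ
  obtain ⟨N, hN⟩ := exists_remainder_le hK (wnorm 1 A) hη
  set a : ℕ → Words d := iterBracket V F A with ha
  classical
  refine ⟨∑ k ∈ Finset.range (N + 1), ((t ^ k / k.factorial : ℝ) : ℂ) • a k,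
    (Finset.range (N + 1)).biUnion fun k => F (a k), fun V' hV' E _ _ _ f hf => ?_⟩
  have hV'K := hV.mono hV'.1
  set Df : ℕ → ℝ → E := fun k τ => ∑' α, V' α • f τ (bracket (normalWord α) (a k)) with hDf
  have happrox : ∀ k ∈ Finset.range (N + 1), ∀ τ, ‖Df k τ - f τ (a (k + 1))‖ ≤ δ := by
    intro k hk τ
    exact hF (a k) V' (hV'.mono (Finset.subset_biUnion_of_mem (fun k => F (a k)) hk)) hf τ
  have hlast : ∀ τ, ‖Df N τ‖ ≤ (K / (1 / (2 * ((N : ℝ) + 1)))) ^ (N + 1) * wnorm 1 A := by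
    intro τ
    have hh : (0 : ℝ) < 1 / (2 * ((N : ℝ) + 1)) := by positivity
    refine (hf.norm_tsum_le hV'K τ (a N) hh).trans ?_
    have h1 : (1 : ℝ) / 2 + 1 / (2 * ((N : ℝ) + 1)) = 1 - N * (1 / (2 * ((N : ℝ) + 1))) := by
      field_simp; ring
    rw [h1, pow_succ', mul_assoc]
    refine mul_le_mul_of_nonneg_left (wnorm_iterBracket_le hV F A hh N ?_) (by positivity)
    rw [mul_one_div, div_le_one (by positivity)]
    have : (0 : ℝ) ≤ N := by positivity
    linarith
  set c : ℕ → ℝ → ℝ := fun k τ => (t - τ) ^ k / k.factorial with hc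
  -- The Taylor sum expanded about τ: it equals f_t A at τ = t and f_0 B at τ = 0, so its derivative
  -- measures the error.
  set g : ℝ → E := fun τ => ∑ k ∈ Finset.range (N + 1), c k τ • f τ (a k) with hg
  have hcderiv : ∀ k τ, HasDerivAt (c (k + 1)) (-c k τ) τ := by
    intro k τ
    have := (((hasDerivAt_id τ).const_sub t).pow (k + 1)).div_const ((k + 1).factorial : ℝ)
    refine this.congr_deriv ?_
    simp only [hc, Nat.factorial_succ]
    push_cast
    field_simp
    simp
  have hderiv : ∀ τ, HasDerivAt g
      (∑ k ∈ Finset.range N, c k τ • (Df k τ - f τ (a (k + 1))) + c N τ • Df N τ) τ := by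
    intro τ
    have h0 : HasDerivAt (fun τ => c 0 τ • f τ (a 0)) (c 0 τ • Df 0 τ) τ := by
      simpa [hc] using hf.hasDerivAt hV'K τ (a 0)
    have hk : ∀ k, HasDerivAt (fun τ => c (k + 1) τ • f τ (a (k + 1)))
        (c (k + 1) τ • Df (k + 1) τ - c k τ • f τ (a (k + 1))) τ := by
      intro k
      refine ((hcderiv k τ).smul (hf.hasDerivAt hV'K τ (a (k + 1)))).congr_deriv ?_
      rw [neg_smul, sub_eq_add_neg]
    have hsum := (HasDerivAt.fun_sum (u := Finset.range N) fun k _ => hk k).add h0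
    have e1 : g = fun τ => (∑ k ∈ Finset.range N, c (k + 1) τ • f τ (a (k + 1))) +
        c 0 τ • f τ (a 0) := by
      funext τ
      exact Finset.sum_range_succ' (fun k => c k τ • f τ (a k)) N
    rw [e1]
    refine hsum.congr_deriv ?_
    -- The derivative telescopes: the term from differentiating c_{k+1} cancels the k-th bracket up
    -- to its truncation error, and only the last bracket survives.
    have e2 := Finset.sum_range_succ' (fun k => c k τ • Df k τ) N
    rw [Finset.sum_range_succ] at e2
    simp only [smul_sub, Finset.sum_sub_distrib]
    rw [sub_add_eq_add_sub, ← e2]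
    abel
  have hbound : ∀ τ ∈ Set.uIcc 0 t,
      ‖∑ k ∈ Finset.range N, c k τ • (Df k τ - f τ (a (k + 1))) + c N τ • Df N τ‖ ≤
        Real.exp T * δ + ε / (2 * (T + 1)) := by
    intro τ hτ
    have hτT : |t - τ| ≤ T := by
      have := Set.abs_sub_right_of_mem_uIcc hτ
      rw [sub_zero] at this
      exact this.trans ht
    have hcabs : ∀ k, ‖c k τ‖ ≤ T ^ k / k.factorial := by
      intro k
      simp only [hc, norm_div, norm_pow, Real.norm_eq_abs, Nat.abs_cast]
      gcongr
    refine (norm_add_le _ _).trans (add_le_add ?_ ?_)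
    · refine (norm_sum_le _ _).trans ?_
      have : ∀ k ∈ Finset.range N, ‖c k τ • (Df k τ - f τ (a (k + 1)))‖ ≤
          T ^ k / k.factorial * δ := by
        intro k hk
        rw [norm_smul]
        exact mul_le_mul (hcabs k)
          (happrox k (Finset.mem_range.2 ((Finset.mem_range.1 hk).trans (Nat.lt_succ_self N))) τ)
          (norm_nonneg _) (by positivity)
      refine (Finset.sum_le_sum this).trans ?_
      rw [← Finset.sum_mul]
      exact mul_le_mul_of_nonneg_right (Real.sum_le_exp_of_nonneg hT0.le N) hδ.le
    · rw [norm_smul]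
      refine (mul_le_mul (hcabs N) (hlast τ) (norm_nonneg _) (by positivity)).trans hN
  have hmv := Convex.norm_image_sub_le_of_norm_hasDerivWithin_le (𝕜 := ℝ) (s := Set.uIcc 0 t)
    (fun τ _ => (hderiv τ).hasDerivWithinAt) hbound (convex_uIcc 0 t) Set.left_mem_uIcc
    Set.right_mem_uIcc
  have gt : g t = f t A := by
    simp only [hg, hc, sub_self]
    rw [Finset.sum_range_succ', Finset.sum_eq_zero (fun k _ => by simp)]
    simp [ha, iterBracket]
  have g0 : g 0 = f 0 (∑ k ∈ Finset.range (N + 1), ((t ^ k / k.factorial : ℝ) : ℂ) • a k) := by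
    simp only [hg, hc, sub_zero, map_sum, map_smul]
    rfl
  rw [gt, g0] at hmv
  refine hmv.trans ?_
  rw [sub_zero, Real.norm_eq_abs]
  have e3 : Real.exp T * δ + ε / (2 * (T + 1)) = ε / (T + 1) := by
    rw [hδdef]; field_simp; norm_num
  rw [e3, div_mul_eq_mul_div, div_le_iff₀ (by positivity)]
  exact mul_le_mul_of_nonneg_left (by linarith) hε.le

/-- The value of a word at time `t` is, up to `ε`, the value at time `0` of an element `B` of
`Words` that depends neither on the solution nor on the potential outside of a finite set. -/
theorem exists_approx (hV : V.BoundedBy K) (t : ℝ) (A : Words d) {ε : ℝ} (hε : 0 < ε) :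
    ∃ (B : Words d) (F : Finset (MultiIndex d)), ∀ V' : Potential d, V'.Approximates V F →
      ∀ {E : Type} [NormedAddCommGroup E] [NormedSpace ℂ E] [CompleteSpace E]
        {f : ℝ → Words d →ₗ[ℂ] E}, IsWordSolution V' f → ‖f t A - f 0 B‖ ≤ ε := by
  classical
  -- The time step has K in its denominator; enlarging K is harmless.
  wlog hK : 0 < K generalizing K
  · exact this (K := K + 1) (fun x F => (hV x F).trans (by linarith)) (by linarith [hV.nonneg])
  have main : ∀ (m : ℕ) (A : Words d) (τ ε : ℝ), |τ| ≤ 1 / (4 * K * Real.exp 1) → 0 < ε →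
      ∃ (B : Words d) (F : Finset (MultiIndex d)), ∀ V' : Potential d, V'.Approximates V F →
      ∀ {E : Type} [NormedAddCommGroup E] [NormedSpace ℂ E] [CompleteSpace E]
        {f : ℝ → Words d →ₗ[ℂ] E}, IsWordSolution V' f → ‖f (m * τ) A - f 0 B‖ ≤ ε := by
    intro m
    induction m with
    | zero =>
      intro A τ ε _ hε
      exact ⟨A, ∅, fun V' _ E _ _ _ f _ => by simpa using hε.le⟩
    | succ m ih =>
      intro A τ ε hτ hε
      obtain ⟨B₁, F₁, h₁⟩ := exists_approx_of_abs_le hV hK A hτ (half_pos hε)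
      obtain ⟨B₂, F₂, h₂⟩ := ih B₁ τ (ε / 2) hτ (half_pos hε)
      refine ⟨B₂, F₁ ∪ F₂, fun V' hV' E _ _ _ f hf => ?_⟩
      -- The last time step is undone first, on the solution restarted at time mτ; the resulting
      -- element is then carried back to time 0 by induction.
      have a₁ := h₁ V' (hV'.mono Finset.subset_union_left) (hf.shift (m * τ))
      have a₂ := h₂ V' (hV'.mono Finset.subset_union_right) hf
      rw [zero_add] at a₁
      have : ((m + 1 : ℕ) : ℝ) * τ = τ + m * τ := by push_cast; ring
      rw [this]
      calc _ = ‖(f (τ + m * τ) A - f (m * τ) B₁) + (f (m * τ) B₁ - f 0 B₂)‖ := by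
            congr 1; abel
        _ ≤ ε / 2 + ε / 2 := (norm_add_le _ _).trans (add_le_add a₁ a₂)
        _ = ε := by ring
  have hT0 : 0 < 1 / (4 * K * Real.exp 1) := by positivity
  obtain ⟨m, hm⟩ := exists_nat_gt (|t| / (1 / (4 * K * Real.exp 1)))
  have hm0 : (0 : ℝ) < m := lt_of_le_of_lt (by positivity) hm
  have := main m A (t / m) ε (by
    rw [abs_div, Nat.abs_cast, div_le_iff₀ hm0]
    rw [div_lt_iff₀ hT0] at hm
    linarith) hε
  rwa [mul_div_cancel₀ _ hm0.ne'] at this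

end approximation

/-! ### Nonexpansive families of maps on a dense set -/

theorem tendsto_of_dense {𝔅 𝔅' ι : Type*} [SeminormedAddCommGroup 𝔅] [SeminormedAddCommGroup 𝔅']
    {l : Filter ι} {T : ι → 𝔅 → 𝔅'} {T₀ : 𝔅 → 𝔅'} (hT : ∀ i a b, ‖T i a - T i b‖ ≤ ‖a - b‖)
    (hT₀ : ∀ a b, ‖T₀ a - T₀ b‖ ≤ ‖a - b‖) {S : Set 𝔅} (hS : Dense S)
    (h : ∀ a ∈ S, Tendsto (fun i => T i a) l (𝓝 (T₀ a))) (a : 𝔅) :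
    Tendsto (fun i => T i a) l (𝓝 (T₀ a)) := by
  rw [Metric.tendsto_nhds]
  intro ε hε
  obtain ⟨b, hb, hab⟩ := Metric.dense_iff.1 hS a (ε / 3) (by positivity)
  rw [Metric.mem_ball, dist_comm, dist_eq_norm] at hb
  filter_upwards [Metric.tendsto_nhds.1 (h b hab) (ε / 3) (by positivity)] with i hi
  rw [dist_eq_norm] at hi ⊢
  have e : T i a - T₀ a = (T i a - T i b) + (T i b - T₀ b) + -(T₀ a - T₀ b) := by abel
  rw [e]
  refine (norm_add₃_le).trans_lt ?_
  rw [norm_neg]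
  linarith [hT i a b, hT₀ a b]

/-! ### The range of the evaluation of words -/

theorem mem_range_rep_of_mem_adjoin {d : ℕ} {𝔅 : Type*} [Ring 𝔅] [Algebra ℂ 𝔅] (s : Letter d → 𝔅)
    {a : 𝔅} (ha : a ∈ Algebra.adjoin ℂ (Set.range s)) : a ∈ LinearMap.range (rep s) := by
  rw [← Subalgebra.mem_toSubmodule, Algebra.adjoin_eq_span] at ha
  refine Submodule.span_le.2 ?_ ha
  intro y hy
  obtain ⟨l, hl, rfl⟩ := Submonoid.exists_list_of_mem_closure hy
  obtain ⟨w, rfl⟩ : ∃ w : List (Letter d), w.map s = l := by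
    clear hy ha
    induction l with
    | nil => exact ⟨[], rfl⟩
    | cons a l ih =>
      obtain ⟨w, rfl⟩ := ih fun y hy => hl y (List.mem_cons_of_mem _ hy)
      obtain ⟨p, rfl⟩ := hl a List.mem_cons_self
      exact ⟨p :: w, rfl⟩
  exact ⟨ofWord w, rep_ofWord s w⟩

theorem mem_range_rep_of_mem_star_adjoin {d : ℕ} {𝔅 : Type*} [Ring 𝔅] [StarRing 𝔅] [Algebra ℂ 𝔅]
    [StarModule ℂ 𝔅] (s : Letter d → 𝔅) (hs : ∀ p, star (s p) ∈ Set.range s)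
    {a : 𝔅} (ha : a ∈ StarAlgebra.adjoin ℂ (Set.range s)) : a ∈ LinearMap.range (rep s) := by
  refine mem_range_rep_of_mem_adjoin s ?_
  rw [← StarSubalgebra.mem_toSubalgebra, StarAlgebra.adjoin_toSubalgebra,
    Set.union_eq_self_of_subset_right] at ha
  · exact ha
  · intro y hy
    obtain ⟨p, hp⟩ := hy
    rw [← star_star y, ← hp]
    exact hs p

/-! ### Classical evaluation of words -/

/-- The values of the letters at a spin configuration. -/
noncomputable def letterVal {d : ℕ} (M : Phase d) (p : Letter d) : ℂ := coord p.2 (M p.1)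

theorem ball3_sq_le (m : Ball3) : (m.1 0) ^ 2 + (m.1 1) ^ 2 + (m.1 2) ^ 2 ≤ 1 := by
  have h := m.2
  rw [mem_closedBall_zero_iff, EuclideanSpace.norm_eq, Real.sqrt_le_one] at h
  simpa [Fin.sum_univ_three] using h

theorem norm_coord_le (i : Idx) (m : Ball3) : ‖coord i m‖ ≤ 1 := by
  have h := ball3_sq_le m
  have h2 : 0 < Real.sqrt 2 := by positivity
  have key : ∀ a b : ℝ, a ^ 2 + b ^ 2 ≤ 1 →
      ‖((a : ℂ) + Complex.I * (b : ℂ)) / (Real.sqrt 2 : ℂ)‖ ≤ 1 := by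
    intro a b hab
    rw [norm_div, Complex.norm_real, Real.norm_eq_abs, abs_of_pos h2, div_le_one h2, mul_comm,
      Complex.norm_add_mul_I]
    exact Real.sqrt_le_sqrt (by linarith)
  cases i
  · exact key _ _ (by nlinarith [sq_nonneg (m.1 2)])
  · simp only [coord, Complex.norm_real, Real.norm_eq_abs]
    rw [← sq_le_one_iff_abs_le_one]
    nlinarith [sq_nonneg (m.1 0), sq_nonneg (m.1 1)]
  · have := key (m.1 0) (-(m.1 1)) (by nlinarith [sq_nonneg (m.1 2)])
    simpa [coord, sub_eq_add_neg] using this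

theorem norm_list_prod_letterVal_le {d : ℕ} (M : Phase d) (w : List (Letter d)) :
    ‖(w.map (letterVal M)).prod‖ ≤ 1 := by
  induction w with
  | nil => simp
  | cons a w ih =>
    rw [List.map_cons, List.prod_cons, norm_mul]
    exact mul_le_one₀ (norm_coord_le _ _) (norm_nonneg _) ih

theorem norm_rep_ofWord_le {d : ℕ} (M : Phase d) (w : List (Letter d)) :
    ‖rep (letterVal M) (ofWord w)‖ ≤ Real.exp (1 / 2 * w.length) := by
  rw [rep_ofWord]
  exact (norm_list_prod_letterVal_le M w).trans (Real.one_le_exp (by positivity))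

theorem rep_classicalSpin_apply {d : ℕ} (B : Words d) (M : Phase d) :
    rep classicalSpin B M = rep (letterVal M) B := by
  induction B using Finsupp.induction_linear with
  | zero => simp
  | add f g hf hg => simp [hf, hg]
  | single w c =>
    have : (w.map classicalSpin).prod M = (w.map (letterVal M)).prod := by
      induction w with
      | nil => simp
      | cons a w ih =>
        rw [List.map_cons, List.prod_cons, List.map_cons, List.prod_cons, ContinuousMap.mul_apply,
          ih]
        rfl
    simp [rep, this]

theorem prod_normalWord {d : ℕ} {R : Type*} [CommMonoid R] (g : Letter d → R) (α : MultiIndex d) :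
    ((normalWord α).map g).prod = α.prod fun p e => g p ^ e := by
  rw [← Multiset.prod_coe, ← Multiset.map_coe, ← toMultiset_eq_normalWord, Finsupp.toMultiset_map,
    Finsupp.prod_toMultiset, Finsupp.prod_mapDomain_index (by simp) (fun _ _ _ => pow_add _ _ _)]

/-- When letters commute, their position in the word is irrelevant and the Leibniz expansion
collects into partial derivatives. This links the word bracket to the Hamiltonian equations. -/
theorem rep_adLetter {d : ℕ} (χ : Letter d → ℂ) (u : List (Letter d)) (x : Site d) (i : Idx) :
    rep χ (adLetter u (x, i)) = ∑ j : Idx, ∑ k : Idx, Complex.I * (eps j i k : ℂ) *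
      MvPolynomial.eval χ (MvPolynomial.pderiv (x, j) (u.map MvPolynomial.X).prod) * χ (x, k) := by
  induction u with
  | nil => simp [adLetter]
  | cons a u ih =>
    have hu : MvPolynomial.eval χ (u.map MvPolynomial.X).prod = (u.map χ).prod := by
      rw [map_list_prod, List.map_map]
      congr 2
      funext p
      simp
    have h1 : ∀ j, MvPolynomial.eval χ
        (MvPolynomial.pderiv (x, j) ((a :: u).map MvPolynomial.X).prod) =
        (if a = (x, j) then (u.map χ).prod else 0) + χ a * MvPolynomial.eval χ
          (MvPolynomial.pderiv (x, j) (u.map MvPolynomial.X).prod) := by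
      intro j
      rw [List.map_cons, List.prod_cons, Derivation.leibniz, MvPolynomial.pderiv_X, smul_eq_mul,
        smul_eq_mul, map_add, map_mul, map_mul, hu, MvPolynomial.eval_X, add_comm]
      congr 1
      by_cases h : a = (x, j)
      · subst h; simp
      · simp [h]
    simp only [h1, mul_add, add_mul, Finset.sum_add_distrib]
    rw [adLetter, map_add, rep_lcons, ih]
    congr 1
    · rcases a with ⟨y, l⟩
      by_cases hy : y = x
      · subst hy
        simp only [letterBracket, if_true, map_sum, map_smul, rep_ofWord, List.map_cons,
          List.prod_cons, smul_eq_mul, Prod.mk.injEq, true_and]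
        conv_rhs => rw [Finset.sum_eq_single l (fun j _ hj => by simp [Ne.symm hj]) (by simp)]
        refine Finset.sum_congr rfl fun k _ => ?_
        simp only [if_true]
        ring
      · simp [letterBracket, hy]
    · simp only [Finset.mul_sum]
      refine Finset.sum_congr rfl fun j _ => Finset.sum_congr rfl fun k _ => ?_
      ring

theorem monomialAt_eq_eval {d : ℕ} (β : MultiIndex d) (M : Phase d) :
    monomialAt β M = MvPolynomial.eval (letterVal M) (MvPolynomial.monomial β 1) := by
  rw [MvPolynomial.eval_monomial, one_mul]
  rfl

theorem prod_X_normalWord {d : ℕ} (α : MultiIndex d) :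
    ((normalWord α).map (MvPolynomial.X (R := ℂ))).prod = MvPolynomial.monomial α 1 := by
  rw [prod_normalWord, MvPolynomial.monomial_eq]
  simp

/-- The truncated subtraction in α − δ_j(x) does no harm: where it truncates, the factor α_j(x)
vanishes. -/
theorem vectorField_eq {d : ℕ} (V : Potential d) (M : Phase d) (x : Site d) (i : Idx) :
    vectorField V M x i =
      ∑' α : MultiIndex d, V α * rep (letterVal M) (adLetter (normalWord α) (x, i)) := by
  refine tsum_congr fun α => ?_
  congr 1
  rw [rep_adLetter, prod_X_normalWord]
  refine Finset.sum_congr rfl fun j _ => Finset.sum_congr rfl fun k _ => ?_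
  rw [monomialAt_eq_eval, MvPolynomial.pderiv_monomial, one_mul]
  have : MvPolynomial.monomial (α - Finsupp.single (x, j) 1 + Finsupp.single (x, k) 1) (1 : ℂ) =
      MvPolynomial.monomial (α - Finsupp.single (x, j) 1) 1 * MvPolynomial.X (x, k) := by
    rw [MvPolynomial.X, MvPolynomial.monomial_mul, one_mul]
  rw [this, map_mul, MvPolynomial.eval_X, MvPolynomial.eval_monomial, MvPolynomial.eval_monomial]
  ring

theorem adWord_singleton {d : ℕ} (u : List (Letter d)) (b : Letter d) :
    adWord u [b] = adLetter u b := by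
  rw [adWord, adWord, map_zero, add_zero, rappend]
  have : (fun l : List (Letter d) => l ++ []) = id := by funext l; simp
  rw [this, Finsupp.lmapDomain_id]
  rfl

/-- A curve of spin configurations that solves the equation of motion. -/
def IsSolutionCurve {d : ℕ} (V : Potential d) (m : ℝ → Phase d) : Prop :=
  ∀ (t : ℝ) (x : Site d) (i : Idx),
    HasDerivAt (fun τ : ℝ => coord i (m τ x)) (vectorField V (m t) x i) t

/-! ### Uniqueness and continuity of the flow, and the classical dynamics it defines -/

section classical

variable {d : ℕ} {V : Potential d} {K : ℝ}

theorem summable_rep_adWord (hV : V.BoundedBy K) (M : Phase d) (w : List (Letter d)) :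
    Summable fun α => V α * rep (letterVal M) (adWord (normalWord α) w) := by
  refine Summable.of_norm_bounded (summable_norm_mul_wnorm_bracket hV (ofWord w)) fun α => ?_
  rw [norm_mul, bracket_ofWord]
  exact mul_le_mul_of_nonneg_left (norm_apply_le_wnorm (norm_rep_ofWord_le M) _) (norm_nonneg _)

/-- The product rule in time matches, term by term, the Leibniz rule defining `adWord`, so the
equation for single letters propagates to words. -/
theorem IsSolutionCurve.isWordSolution {m : ℝ → Phase d} (hm : IsSolutionCurve V m)
    (hV : V.BoundedBy K) : IsWordSolution V fun t => rep (letterVal (m t)) where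
  bound t w := norm_rep_ofWord_le (m t) w
  deriv t w := by
    simp only [bracket_ofWord, rep_ofWord, smul_eq_mul]
    induction w with
    | nil => simpa [adWord] using hasDerivAt_const t (1 : ℂ)
    | cons b w ih =>
      simp only [List.map_cons, List.prod_cons]
      have hb := hm t b.1 b.2
      rw [vectorField_eq] at hb
      refine (hb.mul ih).congr_deriv ?_
      have s1 : Summable fun α => V α * rep (letterVal (m t)) (adLetter (normalWord α) b) := by
        simpa only [adWord_singleton] using summable_rep_adWord hV (m t) [b]
      have s2 := summable_rep_adWord hV (m t) w
      rw [← tsum_mul_right, ← tsum_mul_left,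
        ← (s1.mul_right _).tsum_add (s2.mul_left _)]
      refine tsum_congr fun α => ?_
      rw [adWord, map_add, rep_rappend, rep_lcons]
      simp only [letterVal]
      ring

theorem letterVal_injective : Function.Injective (letterVal : Phase d → Letter d → ℂ) := by
  intro M M' h
  funext x
  have h2 : (Real.sqrt 2 : ℂ) ≠ 0 := by
    rw [Complex.ofReal_ne_zero]; positivity
  have hz := congr_fun h (x, .z)
  have hp := congr_fun h (x, .plus)
  simp only [letterVal, coord] at hz hp
  rw [div_left_inj' h2] at hp
  have e0 := congr_arg Complex.re hp
  have e1 := congr_arg Complex.im hp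
  simp at e0 e1
  have e2 := Complex.ofReal_injective hz
  ext k
  fin_cases k
  · exact e0
  · exact e1
  · exact e2

theorem continuous_letterVal : Continuous (letterVal : Phase d → Letter d → ℂ) :=
  continuous_pi fun p => (continuous_coord p.2).comp (continuous_apply p.1)

theorem isClosedEmbedding_letterVal :
    IsClosedEmbedding (letterVal : Phase d → Letter d → ℂ) :=
  continuous_letterVal.isClosedEmbedding letterVal_injective

/-- Both curves are within ε/2 of one number, the value of `B` at the common starting point; no
Gronwall argument is needed. -/
theorem IsSolutionCurve.ext (hV : V.BoundedBy K) {m m' : ℝ → Phase d} (hm : IsSolutionCurve V m)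
    (hm' : IsSolutionCurve V m') (h0 : m 0 = m' 0) : m = m' := by
  funext t
  refine letterVal_injective (funext fun p => ?_)
  refine eq_of_forall_dist_le fun ε hε => ?_
  obtain ⟨B, F, h⟩ := exists_approx hV t (ofWord [p]) (half_pos hε)
  have h1 := h V (Potential.Approximates.refl V F) (hm.isWordSolution hV)
  have h2 := h V (Potential.Approximates.refl V F) (hm'.isWordSolution hV)
  simp only [rep_ofWord, List.map_cons, List.map_nil, List.prod_singleton, ← dist_eq_norm] at h1 h2
  rw [h0] at h1
  linarith [dist_triangle_right (letterVal (m t) p) (letterVal (m' t) p)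
    (rep (letterVal (m' 0)) B)]

theorem IsSolutionCurve.shift {m : ℝ → Phase d} (hm : IsSolutionCurve V m) (u : ℝ) :
    IsSolutionCurve V fun t => m (t + u) :=
  fun t x i => (hm (t + u) x i).comp_add_const t u

theorem IsFlow.isSolutionCurve {φ : ℝ → Phase d → Phase d} (hφ : IsFlow V φ) (M : Phase d) :
    IsSolutionCurve V fun t => φ t M := (hφ M).2

theorem IsFlow.unique (hV : V.BoundedBy K) {φ ψ : ℝ → Phase d → Phase d} (hφ : IsFlow V φ)
    (hψ : IsFlow V ψ) : φ = ψ := by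
  funext t M
  exact congr_fun ((hφ.isSolutionCurve M).ext hV (hψ.isSolutionCurve M)
    ((hφ M).1.trans (hψ M).1.symm)) t

theorem IsFlow.add (hV : V.BoundedBy K) {φ : ℝ → Phase d → Phase d} (hφ : IsFlow V φ) (t u : ℝ)
    (M : Phase d) : φ (t + u) M = φ t (φ u M) :=
  congr_fun (((hφ.isSolutionCurve M).shift u).ext hV (hφ.isSolutionCurve (φ u M))
    (by simp [(hφ (φ u M)).1])) t

/-- The approximation of the evolved words, uniformly in the initial configuration. -/
theorem exists_flow_approx (hV : V.BoundedBy K) (t : ℝ) (A : Words d) {ε : ℝ} (hε : 0 < ε) :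
    ∃ (B : Words d) (F : Finset (MultiIndex d)),
      (∀ V' : Potential d, V'.Approximates V F → ∀ φ, IsFlow V' φ → ∀ M,
        ‖rep (letterVal (φ t M)) A - rep (letterVal M) B‖ ≤ ε) ∧
      ∀ V' : Potential d, V'.Approximates V F →
        ∀ {E : Type} [NormedAddCommGroup E] [NormedSpace ℂ E] [CompleteSpace E]
        {f : ℝ → Words d →ₗ[ℂ] E}, IsWordSolution V' f → ‖f t A - f 0 B‖ ≤ ε := by
  obtain ⟨B, F, h⟩ := exists_approx hV t A hε
  refine ⟨B, F, fun V' hV' φ hφ M => ?_, h⟩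
  have := h V' hV' ((hφ.isSolutionCurve M).isWordSolution (hV.mono hV'.1))
  simpa only [(hφ M).1] using this

theorem continuous_rep_letterVal (B : Words d) :
    Continuous fun M : Phase d => rep (letterVal M) B := by
  simp only [← rep_classicalSpin_apply]
  exact (rep classicalSpin B).continuous

/-- Each coordinate of the flow is a uniform limit of polynomials in the initial spins, and the
coordinates embed the phase space. -/
theorem IsFlow.continuous (hV : V.BoundedBy K) {φ : ℝ → Phase d → Phase d} (hφ : IsFlow V φ)
    (t : ℝ) : Continuous (φ t) := by
  rw [isClosedEmbedding_letterVal.isInducing.continuous_iff]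
  refine continuous_pi fun p => ?_
  refine continuous_of_uniform_approx_of_continuous fun U hU => ?_
  obtain ⟨ε, hε, hεU⟩ := Metric.mem_uniformity_dist.1 hU
  obtain ⟨B, F, h, -⟩ := exists_flow_approx hV t (ofWord [p]) (half_pos hε)
  refine ⟨fun M => rep (letterVal M) B, continuous_rep_letterVal B, fun M => hεU ?_⟩
  have := h V (Potential.Approximates.refl V F) φ hφ M
  rw [← dist_eq_norm] at this
  simp only [rep_ofWord, List.map_cons, List.map_nil, List.prod_singleton] at this
  exact this.trans_lt (half_lt_self hε)

/-- The homeomorphism of the phase space given by the flow at time `t`. -/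
noncomputable def IsFlow.homeomorph (hV : V.BoundedBy K) {φ : ℝ → Phase d → Phase d}
    (hφ : IsFlow V φ) (t : ℝ) : Phase d ≃ₜ Phase d where
  toFun := φ t
  invFun := φ (-t)
  left_inv M := by rw [← hφ.add hV, neg_add_cancel, (hφ M).1]
  right_inv M := by rw [← hφ.add hV, add_neg_cancel, (hφ M).1]
  continuous_toFun := hφ.continuous hV t
  continuous_invFun := hφ.continuous hV (-t)

/-- The automorphism of the classical algebra given by the flow at time `t`. -/
noncomputable def IsFlow.automorphism (hV : V.BoundedBy K) {φ : ℝ → Phase d → Phase d}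
    (hφ : IsFlow V φ) (t : ℝ) : ClassicalAlg d ≃⋆ₐ[ℂ] ClassicalAlg d :=
  (hφ.homeomorph hV t).compStarAlgEquiv' ℂ ℂ

@[simp] theorem IsFlow.automorphism_apply (hV : V.BoundedBy K) {φ : ℝ → Phase d → Phase d}
    (hφ : IsFlow V φ) (t : ℝ) (A : ClassicalAlg d) (M : Phase d) :
    hφ.automorphism hV t A M = A (φ t M) := rfl

theorem star_classicalSpin (p : Letter d) :
    star (classicalSpin p) = classicalSpin (p.1, p.2.bar) := by
  ext M
  rcases p with ⟨x, i⟩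
  cases i <;> simp [classicalSpin, coord, Idx.bar, sub_eq_add_neg]

/-- Stone–Weierstrass: the coordinates separate points and are permuted by conjugation. -/
theorem dense_range_rep_classicalSpin :
    Dense (Set.range (rep (classicalSpin : Letter d → ClassicalAlg d))) := by
  have hsep : (StarAlgebra.adjoin ℂ
      (Set.range (classicalSpin : Letter d → ClassicalAlg d))).SeparatesPoints := by
    intro M M' hne
    obtain ⟨p, hp⟩ := Function.ne_iff.1 (letterVal_injective.ne hne)
    exact ⟨_, ⟨classicalSpin p, StarAlgebra.subset_adjoin ℂ _ ⟨p, rfl⟩, rfl⟩, hp⟩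
  have h := ContinuousMap.starSubalgebra_topologicalClosure_eq_top_of_separatesPoints _ hsep
  rw [dense_iff_closure_eq, Set.eq_univ_iff_forall]
  intro A
  have hA : A ∈ (StarAlgebra.adjoin ℂ
      (Set.range (classicalSpin : Letter d → ClassicalAlg d))).topologicalClosure := by
    rw [h]; trivial
  refine closure_mono ?_ hA
  intro a ha
  obtain ⟨B, hB⟩ := mem_range_rep_of_mem_star_adjoin classicalSpin
    (fun p => ⟨_, (star_classicalSpin p).symm⟩) ha
  exact ⟨B, hB⟩

theorem eventually_restrict_approximates (V : Potential d) (F : Finset (MultiIndex d)) :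
    ∀ᶠ Λ in atTop, (V.restrict Λ).Approximates V F := by
  classical
  filter_upwards [eventually_ge_atTop (F.biUnion fun α => α.support.image Prod.fst)] with Λ hΛ
  refine ⟨V.norm_restrict_le Λ, fun α hα => ?_⟩
  rw [Potential.restrict, if_pos]
  intro p hp
  exact hΛ (Finset.mem_biUnion.2 ⟨α, hα, Finset.mem_image_of_mem _ hp⟩)

theorem norm_automorphism_sub_le {𝔅 : Type*} [NonUnitalCStarAlgebra 𝔅] (T : 𝔅 ≃⋆ₐ[ℂ] 𝔅)
    (a b : 𝔅) : ‖T a - T b‖ ≤ ‖a - b‖ := by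
  rw [← map_sub, StarAlgEquiv.norm_map]

/-- Automorphisms are isometric, so continuity and the limit need only be checked on words. There
the Lipschitz constant in time, and the element `B` approximating both the finite-volume and the
infinite flow, are independent of the initial configuration. -/
theorem IsFlow.isClassicalDynamics (hV : V.BoundedBy K) {φ : ℝ → Phase d → Phase d}
    (hφ : IsFlow V φ) (hΛ : ∀ Λ, ∃ ψ, IsFlow (V.restrict Λ) ψ) :
    IsClassicalDynamics V (hφ.automorphism hV) where
  zero A := by ext M; simp [(hφ M).1]
  add t u A := by
    ext M
    simp only [IsFlow.automorphism_apply]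
    rw [add_comm, hφ.add hV]
  continuous A := by
    rw [continuous_iff_continuousAt]
    intro t
    refine tendsto_of_dense (T := fun t A => hφ.automorphism hV t A)
      (T₀ := fun A => hφ.automorphism hV t A) (fun u => norm_automorphism_sub_le _)
      (norm_automorphism_sub_le _) dense_range_rep_classicalSpin ?_ A
    rintro _ ⟨B, rfl⟩
    rw [tendsto_iff_norm_sub_tendsto_zero]
    have hlim : Tendsto (fun u : ℝ => 2 * K * wnorm 1 B * |u - t|) (𝓝 t) (𝓝 0) := by
      have : Continuous fun u : ℝ => 2 * K * wnorm 1 B * |u - t| := by fun_prop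
      simpa using this.tendsto t
    refine squeeze_zero (fun _ => norm_nonneg _) (fun u => ?_) hlim
    have hK := hV.nonneg
    have hB := wnorm_nonneg 1 B
    rw [ContinuousMap.norm_le _ (by positivity)]
    intro M
    have := ((hφ.isSolutionCurve M).isWordSolution hV).lipschitz hV u t B
    simpa only [ContinuousMap.sub_apply, IsFlow.automorphism_apply, rep_classicalSpin_apply]
      using this
  limit := by
    choose ψ hψ using hΛ
    refine ⟨ψ, hψ, fun Λ₀ A _ t => ?_⟩
    have hVΛ : ∀ Λ, (V.restrict Λ).BoundedBy K := fun Λ => hV.mono (V.norm_restrict_le Λ)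
    have := tendsto_of_dense (T := fun Λ A => (hψ Λ).automorphism (hVΛ Λ) t A) (l := atTop)
      (T₀ := fun A => hφ.automorphism hV t A) (fun u => norm_automorphism_sub_le _)
      (norm_automorphism_sub_le _) dense_range_rep_classicalSpin ?_ A
    · exact ContinuousMap.tendsto_iff_tendstoUniformly.1 this
    rintro _ ⟨A, rfl⟩
    rw [Metric.tendsto_nhds]
    intro ε hε
    obtain ⟨B, F, h, -⟩ := exists_flow_approx hV t A (ε := ε / 3) (by positivity)
    filter_upwards [eventually_restrict_approximates V F] with Λ hΛ
    refine lt_of_le_of_lt (b := 2 * ε / 3) ?_ (by linarith)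
    rw [ContinuousMap.dist_le (by positivity)]
    intro M
    have h1 := h _ hΛ _ (hψ Λ) M
    have h2 := h V (Potential.Approximates.refl V F) φ hφ M
    simp only [IsFlow.automorphism_apply, rep_classicalSpin_apply]
    rw [← dist_eq_norm] at h1 h2
    linarith [dist_triangle_right (rep (letterVal (ψ Λ t M)) A) (rep (letterVal (φ t M)) A)
      (rep (letterVal M) B)]
  flow := ⟨φ, hφ, fun t A M => rfl⟩

theorem IsClassicalDynamics.eq_automorphism (hV : V.BoundedBy K) {φ : ℝ → Phase d → Phase d}
    (hφ : IsFlow V φ) {α : ℝ → ClassicalAlg d ≃⋆ₐ[ℂ] ClassicalAlg d}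
    (hα : IsClassicalDynamics V α) : α = hφ.automorphism hV := by
  obtain ⟨ψ, hψ, h⟩ := hα.flow
  obtain rfl := hψ.unique hV hφ
  funext t
  ext A M
  exact h t A M

end classical

/-! ### Global solutions of bounded Lipschitz differential equations -/

open Set in
-- With ‖F‖ ≤ L, a solution moves at most L(n+1) on [−(n+1), n+1], so Picard–Lindelöf applies on
-- each such interval; uniqueness glues the pieces.
theorem exists_global_solution {E : Type*} [NormedAddCommGroup E] [NormedSpace ℝ E]
    [CompleteSpace E] {F : E → E} {k L : NNReal} (hF : LipschitzWith k F) (hL : ∀ x, ‖F x‖ ≤ L)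
    (x₀ : E) : ∃ γ : ℝ → E, γ 0 = x₀ ∧ ∀ t, HasDerivAt γ (F (γ t)) t := by
  have hloc : ∀ n : ℕ, ∃ γ : ℝ → E, γ 0 = x₀ ∧ ∀ t ∈ Icc (-((n : ℝ) + 1)) (n + 1),
      HasDerivWithinAt γ (F (γ t)) (Icc (-((n : ℝ) + 1)) (n + 1)) t := by
    intro n
    have h0 : (0 : ℝ) ∈ Icc (-((n : ℝ) + 1)) (n + 1) :=
      ⟨by linarith [n.cast_nonneg (α := ℝ)], by positivity⟩
    have hPL : IsPicardLindelof (fun _ => F) (⟨0, h0⟩ : Icc (-((n : ℝ) + 1)) (n + 1)) x₀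
        (L * (n + 1)) 0 L k :=
      { lipschitzOnWith := fun t _ => hF.lipschitzOnWith
        continuousOn := fun x _ => continuousOn_const
        norm_le := fun t _ x _ => hL x
        mul_max_le := by simp }
    exact hPL.exists_eq_forall_mem_Icc_hasDerivWithinAt₀
  choose γ hγ0 hγ using hloc
  have hagree : ∀ (m n : ℕ), m ≤ n → ∀ t ∈ Icc (-((m : ℝ) + 1)) (m + 1), γ m t = γ n t := by
    intro m n hmn
    have hsub : Icc (-((m : ℝ) + 1)) (m + 1) ⊆ Icc (-((n : ℝ) + 1)) (n + 1) := by
      have : (m : ℝ) ≤ n := by exact_mod_cast hmn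
      exact Icc_subset_Icc (by linarith) (by linarith)
    have h0 : (0 : ℝ) ∈ Ioo (-((m : ℝ) + 1)) (m + 1) :=
      ⟨by linarith [m.cast_nonneg (α := ℝ)], by positivity⟩
    have key : ∀ t ∈ Ioo (-((m : ℝ) + 1)) (m + 1), ∀ j, m ≤ j →
        HasDerivAt (γ j) (F (γ j t)) t := by
      intro t ht j hj
      have : (m : ℝ) ≤ j := by exact_mod_cast hj
      exact (hγ j t ⟨by linarith [ht.1], by linarith [ht.2]⟩).hasDerivAt
        (Icc_mem_nhds (by linarith [ht.1]) (by linarith [ht.2]))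
    exact ODE_solution_unique_of_mem_Icc (v := fun _ => F) (s := fun _ => univ) (K := k)
      (fun t _ => hF.lipschitzOnWith) h0 (fun t ht => (hγ m t ht).continuousWithinAt)
      (fun t ht => key t ht m le_rfl) (fun t _ => mem_univ _)
      (fun t ht => ((hγ n t (hsub ht)).continuousWithinAt).mono hsub)
      (fun t ht => key t ht n hmn) (fun t _ => mem_univ _) ((hγ0 m).trans (hγ0 n).symm)
  have hmem : ∀ (t : ℝ) (n : ℕ), |t| ≤ n + 1 → t ∈ Icc (-((n : ℝ) + 1)) (n + 1) :=
    fun t n h => abs_le.1 h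
  have heq : ∀ (t : ℝ) (n : ℕ), |t| ≤ n + 1 → γ ⌈|t|⌉₊ t = γ n t := by
    intro t n hn
    rcases le_total ⌈|t|⌉₊ n with h | h
    · exact hagree _ _ h t (hmem t _ ((Nat.le_ceil _).trans (by linarith)))
    · exact (hagree _ _ h t (hmem t _ hn)).symm
  -- The extra 1 in the interval length keeps t in the interior of its interval, so the derivative
  -- there is two-sided.
  refine ⟨fun t => γ ⌈|t|⌉₊ t, by simp [hγ0], fun t => ?_⟩
  set n := ⌈|t|⌉₊ with hn
  have htn : |t| < n + 1 := (Nat.le_ceil _).trans_lt (by linarith)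
  have hev : (fun t : ℝ => γ ⌈|t|⌉₊ t) =ᶠ[𝓝 t] γ n := by
    have : ∀ᶠ u : ℝ in 𝓝 t, |u| < (n : ℝ) + 1 := continuous_abs.continuousAt.eventually_lt_const htn
    filter_upwards [this] with u hu
    exact heq u n hu.le
  refine HasDerivAt.congr_of_eventuallyEq ?_ hev
  rw [abs_lt] at htn
  exact (hγ n t ⟨htn.1.le, htn.2.le⟩).hasDerivAt (Icc_mem_nhds htn.1 htn.2)

/-! ### Reality of the vector field -/

section reality

variable {d : ℕ}

theorem Idx.bar_bar (i : Idx) : i.bar.bar = i := by cases i <;> rfl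

/-- The involution of the index set, as an equivalence. -/
def Idx.barEquiv : Idx ≃ Idx := ⟨Idx.bar, Idx.bar, Idx.bar_bar, Idx.bar_bar⟩

theorem eps_bar (i j k : Idx) : eps i.bar j.bar k.bar = -eps i j k := by
  cases i <;> cases j <;> cases k <;> rfl

/-- The involution of the letters. -/
def letterBar (p : Letter d) : Letter d := (p.1, p.2.bar)

theorem letterBar_injective : Function.Injective (letterBar : Letter d → Letter d) := by
  intro p q h
  have := congr_arg letterBar h
  simpa [letterBar, Idx.bar_bar] using this

theorem MultiIndex.bar_apply (α : MultiIndex d) (p : Letter d) : α.bar p = α (letterBar p) := by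
  have : letterBar (letterBar p) = p := by simp [letterBar, Idx.bar_bar]
  conv_lhs => rw [← this]
  exact Finsupp.mapDomain_apply letterBar_injective α _

theorem MultiIndex.bar_bar (α : MultiIndex d) : α.bar.bar = α := by
  ext p
  simp [MultiIndex.bar_apply, letterBar, Idx.bar_bar]

/-- The involution of the multi-indices, as an equivalence. -/
noncomputable def MultiIndex.barEquiv : MultiIndex d ≃ MultiIndex d :=
  ⟨MultiIndex.bar, MultiIndex.bar, MultiIndex.bar_bar, MultiIndex.bar_bar⟩

theorem MultiIndex.bar_sub_add (α : MultiIndex d) (x : Site d) (j k : Idx) :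
    MultiIndex.bar (α - Finsupp.single (x, j) 1 + Finsupp.single (x, k) 1) =
      α.bar - Finsupp.single (x, j.bar) 1 + Finsupp.single (x, k.bar) 1 := by
  have h : ∀ (j l : Idx) , j = l.bar ↔ j.bar = l := by
    intro j l; cases j <;> cases l <;> decide
  ext ⟨y, l⟩
  simp [MultiIndex.bar_apply, letterBar, Finsupp.single_apply, h]

theorem conj_coord (i : Idx) (m : Ball3) : (starRingEnd ℂ) (coord i m) = coord i.bar m := by
  cases i <;> simp [coord, Idx.bar, sub_eq_add_neg]

theorem conj_monomialAt (β : MultiIndex d) (M : Phase d) :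
    (starRingEnd ℂ) (monomialAt β M) = monomialAt β.bar M := by
  change _ = (Finsupp.mapDomain letterBar β).prod _
  rw [monomialAt, Finsupp.prod_mapDomain_index_inj (letterBar_injective (d := d)),
    map_finsuppProd]
  simp [letterBar, conj_coord]

/-- Under conjugation the sign of i and the sign of ε̃ both flip and cancel; reindexing by the
involution does the rest. -/
theorem Potential.IsReal.conj_vectorField {V : Potential d} (hV : V.IsReal) (M : Phase d)
    (x : Site d) (i : Idx) :
    (starRingEnd ℂ) (vectorField V M x i) = vectorField V M x i.bar := by
  unfold vectorField
  rw [Complex.conj_tsum, ← MultiIndex.barEquiv.tsum_eq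
    (f := fun α => V α * ∑ j : Idx, ∑ k : Idx, Complex.I * (eps j i.bar k : ℂ) *
      (α (x, j) : ℂ) * monomialAt (α - Finsupp.single (x, j) 1 + Finsupp.single (x, k) 1) M)]
  refine tsum_congr fun α => ?_
  rw [map_mul, hV α, map_sum]
  change _ = V α.bar * _
  congr 1
  conv_rhs => rw [← Idx.barEquiv.sum_comp]
  refine Finset.sum_congr rfl fun j _ => ?_
  rw [map_sum]
  conv_rhs => rw [← Idx.barEquiv.sum_comp]
  refine Finset.sum_congr rfl fun k _ => ?_
  change _ = Complex.I * (eps j.bar i.bar k.bar : ℂ) * (α.bar (x, j.bar) : ℂ) *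
    monomialAt (α.bar - Finsupp.single (x, j.bar) 1 + Finsupp.single (x, k.bar) 1) M
  have : letterBar (x, j.bar) = (x, j) := by simp [letterBar, Idx.bar_bar]
  rw [map_mul, map_mul, map_mul, Complex.conj_I, conj_monomialAt, MultiIndex.bar_sub_add,
    eps_bar, MultiIndex.bar_apply, this]
  simp

theorem Potential.IsReal.restrict {V : Potential d} (hV : V.IsReal) (Λ : Finset (Site d)) :
    (V.restrict Λ).IsReal := by
  intro α
  have : (∀ p ∈ α.bar.support, p.1 ∈ Λ) ↔ ∀ p ∈ α.support, p.1 ∈ Λ := by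
    simp only [Finsupp.mem_support_iff, MultiIndex.bar_apply]
    constructor
    · intro h p hp
      exact h (letterBar p) (by simpa [letterBar, Idx.bar_bar] using hp)
    · intro h p hp
      exact h (letterBar p) hp
  unfold Potential.restrict
  simp only [this]
  split_ifs
  · exact hV α
  · simp

end reality

/-! ### Existence of the flow -/

section existence

variable {d : ℕ} {V : Potential d} {K : ℝ}

/-- The coordinates `M_i` as real linear maps on `ℝ³`. -/
noncomputable def coordL (i : Idx) : EuclideanSpace ℝ (Fin 3) →L[ℝ] ℂ :=
  LinearMap.toContinuousLinearMap
    { toFun := fun m => match i with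
        | .plus => ((m 0 : ℂ) + Complex.I * (m 1 : ℂ)) / (Real.sqrt 2 : ℂ)
        | .z => (m 2 : ℂ)
        | .minus => ((m 0 : ℂ) - Complex.I * (m 1 : ℂ)) / (Real.sqrt 2 : ℂ)
      map_add' := fun m m' => by cases i <;> simp <;> ring
      map_smul' := fun c m => by cases i <;> simp <;> ring }

theorem coord_eq_coordL (i : Idx) (m : Ball3) : coord i m = coordL i m.1 := by
  cases i <;> rfl

theorem norm_coordL_le (i : Idx) (v : EuclideanSpace ℝ (Fin 3)) : ‖coordL i v‖ ≤ ‖v‖ := by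
  by_cases hv : v = 0
  · simp [hv]
  have hv' : 0 < ‖v‖ := norm_pos_iff.2 hv
  have hmem : ‖v‖⁻¹ • v ∈ Metric.closedBall (0 : EuclideanSpace ℝ (Fin 3)) 1 := by
    rw [mem_closedBall_zero_iff, norm_smul, norm_inv, norm_norm, inv_mul_cancel₀ hv'.ne']
  have h := norm_coord_le i ⟨_, hmem⟩
  rw [coord_eq_coordL, map_smul, norm_smul, norm_inv, norm_norm, inv_mul_le_iff₀ hv'] at h
  linarith

/-- The radial retraction of `ℝ³` onto the closed unit ball. -/
noncomputable def clip (m : EuclideanSpace ℝ (Fin 3)) : Ball3 :=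
  ⟨(max 1 ‖m‖)⁻¹ • m, by
    have h : 0 < max 1 ‖m‖ := lt_max_of_lt_left one_pos
    rw [mem_closedBall_zero_iff, norm_smul, norm_inv, Real.norm_of_nonneg h.le,
      inv_mul_le_iff₀ h, mul_one]
    exact le_max_right _ _⟩

theorem norm_clip_sub_le (m m' : EuclideanSpace ℝ (Fin 3)) :
    ‖(clip m).1 - (clip m').1‖ ≤ 2 * ‖m - m'‖ := by
  set a := max 1 ‖m‖ with ha
  set b := max 1 ‖m'‖ with hb
  have ha1 : 1 ≤ a := le_max_left _ _
  have hb1 : 1 ≤ b := le_max_left _ _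
  have hab : |b - a| ≤ ‖m - m'‖ := by
    rw [abs_sub_comm]
    refine (abs_max_sub_max_le_max _ _ _ _).trans ?_
    simpa using abs_norm_sub_norm_le m m'
  have e : (clip m).1 - (clip m').1 = a⁻¹ • (m - m') + ((b - a) / a) • (clip m').1 := by
    change a⁻¹ • m - b⁻¹ • m' = a⁻¹ • (m - m') + ((b - a) / a) • b⁻¹ • m'
    rw [smul_sub, smul_smul, sub_add, ← sub_smul]
    congr 2
    field_simp
    ring
  have hc : ‖(clip m').1‖ ≤ 1 := mem_closedBall_zero_iff.1 (clip m').2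
  rw [e]
  refine (norm_add_le _ _).trans ?_
  rw [norm_smul, norm_smul, norm_inv, Real.norm_of_nonneg (by linarith : 0 ≤ a), norm_div,
    Real.norm_of_nonneg (by linarith : 0 ≤ a), Real.norm_eq_abs]
  have h1 : a⁻¹ * ‖m - m'‖ ≤ ‖m - m'‖ :=
    mul_le_of_le_one_left (norm_nonneg _) (inv_le_one_of_one_le₀ ha1)
  have h2 : |b - a| / a * ‖(clip m').1‖ ≤ ‖m - m'‖ :=
    (mul_le_of_le_one_right (by positivity) hc).trans
      ((div_le_self (abs_nonneg _) ha1).trans hab)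
  linarith

theorem clip_of_norm_le {m : EuclideanSpace ℝ (Fin 3)} (h : ‖m‖ ≤ 1) : (clip m).1 = m := by
  simp [clip, max_eq_left h]

theorem norm_rep_sub_ofWord_le (M M' : Phase d) {D : ℝ}
    (hD : ∀ p, ‖letterVal M p - letterVal M' p‖ ≤ D) (w : List (Letter d)) :
    ‖(rep (letterVal M) - rep (letterVal M')) (ofWord w)‖ ≤ w.length * D := by
  rw [LinearMap.sub_apply, rep_ofWord, rep_ofWord]
  induction w with
  | nil => simp
  | cons a w ih =>
    simp only [List.map_cons, List.prod_cons]
    have e : letterVal M a * (w.map (letterVal M)).prod -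
        letterVal M' a * (w.map (letterVal M')).prod =
        letterVal M a * ((w.map (letterVal M)).prod - (w.map (letterVal M')).prod) +
        (letterVal M a - letterVal M' a) * (w.map (letterVal M')).prod := by ring
    rw [e]
    refine (norm_add_le _ _).trans ?_
    rw [norm_mul, norm_mul]
    have h1 := mul_le_of_le_one_left (norm_nonneg
      ((w.map (letterVal M)).prod - (w.map (letterVal M')).prod)) (norm_coord_le a.2 (M a.1))
    have h2 := mul_le_of_le_one_right (norm_nonneg (letterVal M a - letterVal M' a))
      (norm_list_prod_letterVal_le M' w)
    push_cast [List.length_cons]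
    have h3 := hD a
    simp only [letterVal] at *
    linarith

theorem summable_rep_adLetter (hV : V.BoundedBy K) (M : Phase d) (p : Letter d) :
    Summable fun α => V α * rep (letterVal M) (adLetter (normalWord α) p) := by
  simpa only [adWord_singleton] using summable_rep_adWord hV M [p]

theorem summable_norm_mul_wnorm_adLetter (hV : V.BoundedBy K) (p : Letter d) :
    Summable fun α => ‖V α‖ * wnorm (1 / 2) (adLetter (normalWord α) p) := by
  simpa only [bracket_ofWord, adWord_singleton] using
    summable_norm_mul_wnorm_bracket hV (ofWord [p])

theorem tsum_norm_mul_wnorm_adLetter_le (hV : V.BoundedBy K) (p : Letter d) :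
    ∑' α, ‖V α‖ * wnorm (1 / 2) (adLetter (normalWord α) p) ≤ K * Real.exp (1 / 2) := by
  refine (summable_norm_mul_wnorm_adLetter hV p).tsum_le_of_sum_le fun F => ?_
  simpa only [adWord_singleton, List.length_singleton, Nat.cast_one, one_mul, mul_one] using
    sum_norm_mul_wnorm_adWord_le hV (r := 1 / 2) (by norm_num) (by norm_num) [p] F

theorem norm_vectorField_le (hV : V.BoundedBy K) (M : Phase d) (x : Site d) (i : Idx) :
    ‖vectorField V M x i‖ ≤ K * Real.exp (1 / 2) := by
  rw [vectorField_eq]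
  refine (tsum_of_norm_bounded (summable_norm_mul_wnorm_adLetter hV (x, i)).hasSum
    fun α => ?_).trans (tsum_norm_mul_wnorm_adLetter_le hV (x, i))
  rw [norm_mul]
  exact mul_le_mul_of_nonneg_left (norm_apply_le_wnorm (norm_rep_ofWord_le M) _) (norm_nonneg _)

/-- The deviation is measured by its supremum over all sites, so the vector field is Lipschitz on
bounded configurations of the infinite lattice. -/
theorem norm_vectorField_sub_le (hV : V.BoundedBy K) (M M' : Phase d) {D : ℝ}
    (hD : ∀ p, ‖letterVal M p - letterVal M' p‖ ≤ D) (x : Site d) (i : Idx) :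
    ‖vectorField V M x i - vectorField V M' x i‖ ≤ 2 * D * (K * Real.exp (1 / 2)) := by
  have hD0 : 0 ≤ D := (norm_nonneg _).trans (hD (x, i))
  rw [vectorField_eq, vectorField_eq,
    ← (summable_rep_adLetter hV M (x, i)).tsum_sub (summable_rep_adLetter hV M' (x, i))]
  refine (tsum_of_norm_bounded ((summable_norm_mul_wnorm_adLetter hV (x, i)).mul_left
    (2 * D)).hasSum fun α => ?_).trans ?_
  · rw [← mul_sub, norm_mul, ← LinearMap.sub_apply, mul_left_comm]
    refine mul_le_mul_of_nonneg_left ?_ (norm_nonneg _)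
    refine norm_apply_le_mul_wnorm (fun w => ?_) _
    refine (norm_rep_sub_ofWord_le M M' hD w).trans ?_
    -- The length factor from telescoping the product is absorbed by the weight: l ≤ 2e^{l/2}.
    have := Real.add_one_le_exp (1 / 2 * (w.length : ℝ))
    nlinarith
  · rw [tsum_mul_left]
    exact mul_le_mul_of_nonneg_left (tsum_norm_mul_wnorm_adLetter_le hV (x, i)) (by positivity)

/-- The real vector with complex coordinates `(a, b, conj a)`. -/
noncomputable def realVec (a b : ℂ) : EuclideanSpace ℝ (Fin 3) :=
  !₂[Real.sqrt 2 * a.re, Real.sqrt 2 * a.im, b.re]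

theorem realVec_sub (a b a' b' : ℂ) :
    realVec a b - realVec a' b' = realVec (a - a') (b - b') := by
  ext k
  fin_cases k <;> simp [realVec, mul_sub]

theorem norm_realVec_le (a b : ℂ) : ‖realVec a b‖ ≤ 2 * ‖a‖ + ‖b‖ := by
  rw [EuclideanSpace.norm_eq]
  refine Real.sqrt_le_iff.2 ⟨by positivity, ?_⟩
  have h2 : Real.sqrt 2 ^ 2 = 2 := Real.sq_sqrt (by norm_num)
  have ha : ‖a‖ ^ 2 = a.re ^ 2 + a.im ^ 2 := by
    rw [← Complex.normSq_eq_norm_sq, Complex.normSq_apply]; ring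
  have hb : b.re ^ 2 ≤ ‖b‖ ^ 2 := by
    rw [← Complex.normSq_eq_norm_sq, Complex.normSq_apply]; nlinarith [sq_nonneg b.im]
  simp only [Fin.sum_univ_three, realVec, Real.norm_eq_abs, sq_abs]
  simp
  rw [mul_pow, mul_pow, h2]
  nlinarith [mul_nonneg (norm_nonneg a) (norm_nonneg b), sq_nonneg ‖a‖]

/-- The vector field in real coordinates. -/
noncomputable def realField (V : Potential d) (M : Phase d) (x : Site d) :
    EuclideanSpace ℝ (Fin 3) :=
  realVec (vectorField V M x .plus) (vectorField V M x .z)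

theorem coordL_realField (hreal : V.IsReal) (M : Phase d) (x : Site d) (i : Idx) :
    coordL i (realField V M x) = vectorField V M x i := by
  have h2 : (Real.sqrt 2 : ℂ) ≠ 0 := by
    rw [Complex.ofReal_ne_zero]; positivity
  have hz := hreal.conj_vectorField M x .z
  have hp := hreal.conj_vectorField M x .plus
  simp only [Idx.bar] at hz hp
  cases i
  · change (((Real.sqrt 2 * (vectorField V M x .plus).re : ℝ) : ℂ) +
      Complex.I * ((Real.sqrt 2 * (vectorField V M x .plus).im : ℝ) : ℂ)) / (Real.sqrt 2 : ℂ) = _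
    conv_rhs => rw [← Complex.re_add_im (vectorField V M x .plus)]
    push_cast
    field_simp
  · change (((vectorField V M x .z).re : ℝ) : ℂ) = _
    exact Complex.conj_eq_iff_re.1 hz
  · change (((Real.sqrt 2 * (vectorField V M x .plus).re : ℝ) : ℂ) -
      Complex.I * ((Real.sqrt 2 * (vectorField V M x .plus).im : ℝ) : ℂ)) / (Real.sqrt 2 : ℂ) = _
    have hc : (starRingEnd ℂ) (vectorField V M x .plus) =
        (vectorField V M x .plus).re - (vectorField V M x .plus).im * Complex.I := by
      apply Complex.ext <;> simp
    rw [← hp, hc]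
    push_cast
    field_simp

/-- The squared spin length 2M_+M_- + M_z² Poisson commutes with everything: by antisymmetry of ε̃
the sum vanishes for every α separately. -/
theorem sum_letterVal_mul_vectorField (hV : V.BoundedBy K) (M : Phase d) (x : Site d) :
    letterVal M (x, .minus) * vectorField V M x .plus +
      letterVal M (x, .z) * vectorField V M x .z +
      letterVal M (x, .plus) * vectorField V M x .minus = 0 := by
  simp only [vectorField_eq]
  have s := fun i => summable_rep_adLetter hV M (x, i)
  rw [← tsum_mul_left, ← tsum_mul_left, ← tsum_mul_left,
    ← ((s .plus).mul_left _).tsum_add ((s .z).mul_left _),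
    ← (((s .plus).mul_left _).add ((s .z).mul_left _)).tsum_add ((s .minus).mul_left _)]
  refine (tsum_congr fun α => ?_).trans tsum_zero
  have hsum : ∀ g : Idx → ℂ, ∑ i, g i = g .plus + g .z + g .minus := by
    intro g
    change ∑ i ∈ {Idx.plus, Idx.z, Idx.minus}, g i = _
    simp [add_assoc]
  simp only [rep_adLetter, hsum, eps]
  push_cast
  ring

theorem inner_realField (hV : V.BoundedBy K) (hreal : V.IsReal) (M : Phase d) (x : Site d) :
    inner ℝ (M x).1 (realField V M x) = 0 := by
  have h := sum_letterVal_mul_vectorField hV M x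
  have hp := hreal.conj_vectorField M x .plus
  simp only [Idx.bar] at hp
  rw [← hp] at h
  have h2 : (Real.sqrt 2) ≠ 0 := by positivity
  have h3 : Real.sqrt 2 * Real.sqrt 2 = 2 := Real.mul_self_sqrt (by norm_num)
  simp only [letterVal, coord] at h
  have hre := congr_arg Complex.re h
  simp [Complex.div_ofReal_re, Complex.div_ofReal_im] at hre
  rw [PiLp.inner_apply]
  simp [Fin.sum_univ_three, realField, realVec]
  field_simp at hre
  refine mul_left_cancel₀ h2 ?_
  linear_combination hre + ((vectorField V M x .plus).re * (M x).1 0 +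
    (vectorField V M x .plus).im * (M x).1 1) * h3

theorem norm_realField_le (hV : V.BoundedBy K) (M : Phase d) (x : Site d) :
    ‖realField V M x‖ ≤ 3 * (K * Real.exp (1 / 2)) := by
  refine (norm_realVec_le _ _).trans ?_
  linarith [norm_vectorField_le hV M x .plus, norm_vectorField_le hV M x .z]

/-- The vector field on bounded families of vectors in `ℝ³`, extended from the phase space by the
radial retraction. -/
noncomputable def clippedField (hV : V.BoundedBy K)
    (m : BoundedContinuousFunction (Site d) (EuclideanSpace ℝ (Fin 3))) :
    BoundedContinuousFunction (Site d) (EuclideanSpace ℝ (Fin 3)) :=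
  BoundedContinuousFunction.ofNormedAddCommGroupDiscrete
    (fun x => realField V (fun y => clip (m y)) x) (3 * (K * Real.exp (1 / 2)))
    (norm_realField_le hV _)

/-- Retracting onto the ball extends the vector field to a bounded Lipschitz field on the Banach
space of bounded configurations, which has global solutions. Such a solution never leaves the phase
space, where the retraction is the identity. -/
theorem exists_solutionCurve (hV : V.BoundedBy K) (hreal : V.IsReal) (M₀ : Phase d) :
    ∃ m : ℝ → Phase d, m 0 = M₀ ∧ IsSolutionCurve V m := by
  have hK := hV.nonneg
  have e0 := Real.exp_pos (1 / 2)
  -- 12 = 3 · 2 · 2, from `norm_realVec_le` with its two field components, from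
  -- `norm_vectorField_sub_le`, and from the Lipschitz constant of `clip`.
  have hlip : LipschitzWith (⟨12 * (K * Real.exp (1 / 2)), by positivity⟩ : NNReal)
      (clippedField hV) := by
    refine LipschitzWith.of_dist_le_mul fun m m' => ?_
    refine (BoundedContinuousFunction.dist_le
      (mul_nonneg (NNReal.coe_nonneg _) dist_nonneg)).2 fun x => ?_
    have hD : ∀ p, ‖letterVal (fun y => clip (m y)) p - letterVal (fun y => clip (m' y)) p‖ ≤
        2 * dist m m' := by
      intro p
      simp only [letterVal, coord_eq_coordL]
      rw [← map_sub]
      refine (norm_coordL_le _ _).trans ((norm_clip_sub_le _ _).trans ?_)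
      rw [← dist_eq_norm]
      exact mul_le_mul_of_nonneg_left (BoundedContinuousFunction.dist_coe_le_dist _) (by norm_num)
    have h1 := norm_vectorField_sub_le hV _ _ hD x .plus
    have h2 := norm_vectorField_sub_le hV _ _ hD x .z
    rw [dist_eq_norm]
    change ‖realField V (fun y => clip (m y)) x - realField V (fun y => clip (m' y)) x‖ ≤
      12 * (K * Real.exp (1 / 2)) * dist m m'
    rw [realField, realField, realVec_sub]
    refine (norm_realVec_le _ _).trans ?_
    linarith
  have hbd : ∀ m, ‖clippedField hV m‖ ≤
      (⟨3 * (K * Real.exp (1 / 2)), by positivity⟩ : NNReal) := fun m =>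
    BoundedContinuousFunction.norm_ofNormedAddCommGroup_le _ (NNReal.coe_nonneg _)
      (norm_realField_le hV _)
  obtain ⟨γ, hγ0, hγ⟩ := exists_global_solution hlip hbd
    (BoundedContinuousFunction.ofNormedAddCommGroupDiscrete (fun x => (M₀ x).1) 1
      fun x => mem_closedBall_zero_iff.1 (M₀ x).2)
  have hγ0x : ∀ x, γ 0 x = (M₀ x).1 := fun x => by rw [hγ0]; rfl
  have hx : ∀ t x, HasDerivAt (fun τ => γ τ x) (realField V (fun y => clip (γ t y)) x) t := by
    intro t x
    exact ((BoundedContinuousFunction.evalCLM ℝ x).hasFDerivAt.comp_hasDerivAt t (hγ t))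
  -- The field is orthogonal to the retracted spin, which is a positive multiple of γ, so each
  -- length is conserved even before γ is known to stay in the ball.
  have hnorm : ∀ t x, ‖γ t x‖ ^ 2 = ‖(M₀ x).1‖ ^ 2 := by
    intro t x
    have hd : ∀ τ, HasDerivAt (fun τ => ‖γ τ x‖ ^ 2) 0 τ := by
      intro τ
      refine (hx τ x).norm_sq.congr_deriv ?_
      have h1 := inner_realField hV hreal (fun y => clip (γ τ y)) x
      have h2 : (clip (γ τ x)).1 = (max 1 ‖γ τ x‖)⁻¹ • γ τ x := rfl
      rw [h2, real_inner_smul_left, mul_eq_zero] at h1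
      have h3 : (max 1 ‖γ τ x‖)⁻¹ ≠ 0 := (inv_pos.2 (lt_max_of_lt_left one_pos)).ne'
      rw [h1.resolve_left h3, mul_zero]
    have := is_const_of_deriv_eq_zero (fun τ => (hd τ).differentiableAt)
      (fun τ => (hd τ).deriv) t 0
    rw [this, hγ0x]
  have hle : ∀ t x, ‖γ t x‖ ≤ 1 := by
    intro t x
    have h1 : ‖(M₀ x).1‖ ≤ 1 := mem_closedBall_zero_iff.1 (M₀ x).2
    rw [pow_left_inj₀ (norm_nonneg _) (norm_nonneg _) two_ne_zero |>.1 (hnorm t x)]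
    exact h1
  refine ⟨fun t x => ⟨γ t x, mem_closedBall_zero_iff.2 (hle t x)⟩, ?_, fun t x i => ?_⟩
  · funext x
    exact Subtype.ext (hγ0x x)
  · simp only [coord_eq_coordL]
    have hclip : (fun y => clip (γ t y)) =
        (fun y => ⟨γ t y, mem_closedBall_zero_iff.2 (hle t y)⟩ : Phase d) := by
      funext y
      exact Subtype.ext (clip_of_norm_le (hle t y))
    have := (coordL i).hasFDerivAt.comp_hasDerivAt t (hx t x)
    rw [hclip, coordL_realField hreal] at this
    exact this

theorem exists_isFlow (hV : V.BoundedBy K) (hreal : V.IsReal) : ∃ φ, IsFlow V φ := by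
  choose m h0 hm using exists_solutionCurve hV hreal
  exact ⟨fun t M => m M t, fun M => ⟨h0 M, hm M⟩⟩

theorem exists_isFlow_restrict (hV : V.BoundedBy K) (hreal : V.IsReal) (Λ : Finset (Site d)) :
    ∃ φ, IsFlow (V.restrict Λ) φ :=
  exists_isFlow (hV.mono (V.norm_restrict_le Λ)) (hreal.restrict Λ)

theorem existsUnique_isClassicalDynamics (hV : V.BoundedBy K) (hreal : V.IsReal) :
    ∃! α, IsClassicalDynamics V α := by
  obtain ⟨φ, hφ⟩ := exists_isFlow hV hreal
  exact ⟨hφ.automorphism hV, hφ.isClassicalDynamics hV (exists_isFlow_restrict hV hreal),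
    fun α hα => hα.eq_automorphism hV hφ⟩

end existence

/-! ### Operators at one site -/

section siteOp

variable {d n : ℕ}

theorem siteOp_apply (x : Site d) (a : Matrix (Fin (n + 1)) (Fin (n + 1)) ℂ) (ψ : Hilb d n)
    (η : Config d n) : siteOp x a ψ η = ∑ k, a (η x) k * ψ (Function.update η x k) := rfl

theorem siteOp_add (x : Site d) (a b : Matrix (Fin (n + 1)) (Fin (n + 1)) ℂ) :
    siteOp x (a + b) = siteOp x a + siteOp x b := by
  ext ψ η
  change siteOp x (a + b) ψ η = siteOp x a ψ η + siteOp x b ψ η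
  simp only [siteOp_apply, Matrix.add_apply, add_mul, Finset.sum_add_distrib]

theorem siteOp_smul (x : Site d) (c : ℂ) (a : Matrix (Fin (n + 1)) (Fin (n + 1)) ℂ) :
    siteOp x (c • a) = c • siteOp x a := by
  ext ψ η
  change siteOp x (c • a) ψ η = c * siteOp x a ψ η
  simp only [siteOp_apply, Matrix.smul_apply, smul_eq_mul, Finset.mul_sum, mul_assoc]

theorem siteOp_one (x : Site d) :
    siteOp x (1 : Matrix (Fin (n + 1)) (Fin (n + 1)) ℂ) = 1 := by
  ext ψ η
  rw [siteOp_apply]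
  simp [Matrix.one_apply]

theorem siteOp_mul (x : Site d) (a b : Matrix (Fin (n + 1)) (Fin (n + 1)) ℂ) :
    siteOp x (a * b) = siteOp x a * siteOp x b := by
  ext ψ η
  change siteOp x (a * b) ψ η = siteOp x a (siteOp x b ψ) η
  simp only [siteOp_apply, Matrix.mul_apply, Function.update_self, Function.update_idem,
    Finset.sum_mul, Finset.mul_sum]
  rw [Finset.sum_comm]
  simp only [mul_assoc]

theorem siteOp_commute {x y : Site d} (hxy : x ≠ y)
    (a b : Matrix (Fin (n + 1)) (Fin (n + 1)) ℂ) : Commute (siteOp x a) (siteOp y b) := by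
  ext ψ η
  change siteOp x a (siteOp y b ψ) η = siteOp y b (siteOp x a ψ) η
  simp only [siteOp_apply, Function.update_of_ne hxy, Function.update_of_ne hxy.symm,
    Finset.mul_sum]
  rw [Finset.sum_comm]
  refine Finset.sum_congr rfl fun k _ => Finset.sum_congr rfl fun l _ => ?_
  rw [Function.update_comm hxy]
  ring

/-- The operators at the site `x`, as an algebra homomorphism. -/
noncomputable def siteHom (x : Site d) :
    Matrix (Fin (n + 1)) (Fin (n + 1)) ℂ →ₐ[ℂ] (Hilb d n →L[ℂ] Hilb d n) :=
  AlgHom.ofLinearMap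
    { toFun := siteOp x
      map_add' := siteOp_add x
      map_smul' := siteOp_smul x } (siteOp_one x) (siteOp_mul x)

@[simp] theorem siteHom_apply (x : Site d) (a : Matrix (Fin (n + 1)) (Fin (n + 1)) ℂ) :
    siteHom x a = siteOp x a := rfl

theorem siteOp_single_apply (x : Site d) (j k : Fin (n + 1)) (c : ℂ) (ψ : Hilb d n)
    (η : Config d n) : siteOp x (Matrix.single j k c) ψ η =
      if η x = j then c * ψ (Function.update η x k) else 0 := by
  rw [siteOp_apply]
  by_cases h : η x = j
  · rw [if_pos h, Finset.sum_eq_single k]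
    · simp [h]
    · intro l _ hl; simp [Ne.symm hl]
    · simp
  · rw [if_neg h]
    exact Finset.sum_eq_zero fun l _ => by simp [Ne.symm h]

/-- By linearity it suffices to treat matrix units, whose two inner products are matched by swapping
the two basis labels at x. -/
theorem star_siteOp (x : Site d) (a : Matrix (Fin (n + 1)) (Fin (n + 1)) ℂ) :
    star (siteOp x a) = siteOp x a.conjTranspose := by
  induction a using Matrix.induction_on with
  | h_add a b ha hb => rw [siteOp_add, star_add, ha, hb, Matrix.conjTranspose_add, siteOp_add]
  | h_std_basis k j c =>
    rw [Matrix.conjTranspose_single]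
    symm
    rw [ContinuousLinearMap.star_eq_adjoint, ContinuousLinearMap.eq_adjoint_iff]
    intro ψ χ
    rw [lp.inner_eq_tsum, lp.inner_eq_tsum, ← (sitePerm x (Equiv.swap k j)).tsum_eq]
    refine tsum_congr fun η => ?_
    rw [siteOp_single_apply, siteOp_single_apply]
    by_cases h : η x = k
    · subst h
      rw [sitePerm_swap]
      simp
      ring
    · have h' : ¬ (sitePerm x (Equiv.swap k j) η) x = j := by
        intro h2
        simp only [sitePerm, Equiv.piCongrRight_apply, Pi.map_apply, if_true] at h2
        rw [Equiv.swap_apply_eq_iff, Equiv.swap_apply_right] at h2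
        exact h h2
      rw [if_neg h, if_neg h']
      simp

theorem norm_siteOp_diagonal_le (x : Site d) (v : Fin (n + 1) → ℂ) {C : ℝ} (hC : 0 ≤ C)
    (hv : ∀ k, ‖v k‖ ≤ C) : ‖siteOp (n := n) x (Matrix.diagonal v)‖ ≤ C := by
  refine ContinuousLinearMap.opNorm_le_bound _ hC fun ψ => ?_
  refine le_of_sq_le_sq ?_ (by positivity)
  have h : ∀ η, siteOp x (Matrix.diagonal v) ψ η = v (η x) * ψ η := by
    intro η
    rw [siteOp_apply]
    simp [Matrix.diagonal_apply]
  rw [mul_pow, hilb_norm_sq, hilb_norm_sq, ← tsum_mul_left]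
  refine Summable.tsum_le_tsum (fun η => ?_) (hilb_summable _) ((hilb_summable ψ).mul_left _)
  rw [h, norm_mul, mul_pow]
  gcongr
  exact hv _

end siteOp

/-! ### Spin matrices -/

section spinMatrix

variable (n : ℕ)

/-- The matrix elements of the rescaled ladder operators. -/
noncomputable def ladder (k : ℕ) : ℝ :=
  Real.sqrt (((k : ℝ) + 1) * ((n : ℝ) - k)) / (Real.sqrt 2 * ((n : ℝ) / 2))

theorem ladder_self : ladder n n = 0 := by simp [ladder]

variable {n}

theorem ladder_sq {k : ℕ} (hk : k ≤ n) :
    ladder n k ^ 2 = ((k : ℝ) + 1) * ((n : ℝ) - k) / (2 * ((n : ℝ) / 2) ^ 2) := by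
  have h : (k : ℝ) ≤ n := by exact_mod_cast hk
  rw [ladder, div_pow, mul_pow, Real.sq_sqrt (mul_nonneg (by positivity) (by linarith)),
    Real.sq_sqrt (by norm_num)]

theorem ladder_ne_zero {k : ℕ} (hk : k < n) : ladder n k ≠ 0 := by
  have h : (k : ℝ) < n := by exact_mod_cast hk
  have h0 : (0 : ℝ) < n := lt_of_le_of_lt (by positivity) h
  have : 0 < ((k : ℝ) + 1) * ((n : ℝ) - k) := mul_pos (by positivity) (by linarith)
  exact (div_pos (Real.sqrt_pos.2 this) (by positivity)).ne'

theorem spinMatrix_plus_apply (k l : Fin (n + 1)) :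
    spinMatrix n .plus k l = if (l : ℕ) = k + 1 then (ladder n k : ℂ) else 0 := rfl

theorem spinMatrix_minus_apply (k l : Fin (n + 1)) :
    spinMatrix n .minus k l = if (k : ℕ) = l + 1 then (ladder n l : ℂ) else 0 := rfl

theorem spinMatrix_z : spinMatrix n .z =
    Matrix.diagonal fun k : Fin (n + 1) => ((((n : ℝ) / 2 - k) / ((n : ℝ) / 2) : ℝ) : ℂ) := by
  ext k l
  simp [spinMatrix, Matrix.diagonal_apply]

theorem conjTranspose_spinMatrix (i : Idx) :
    (spinMatrix n i).conjTranspose = spinMatrix n i.bar := by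
  ext k l
  rw [Matrix.conjTranspose_apply]
  cases i
  · simp only [Idx.bar, spinMatrix_plus_apply, spinMatrix_minus_apply]
    split_ifs <;> simp
  · simp only [Idx.bar, spinMatrix]
    by_cases h : k = l
    · subst h; simp
    · simp [h, Ne.symm h]
  · simp only [Idx.bar, spinMatrix_plus_apply, spinMatrix_minus_apply]
    split_ifs <;> simp

/-- The last index k = n has no neighbour k + 1, consistently with the ladder coefficient vanishing
there. -/
theorem spinMatrix_plus_mul_minus : spinMatrix n .plus * spinMatrix n .minus =
    Matrix.diagonal fun k : Fin (n + 1) => ((ladder n k ^ 2 : ℝ) : ℂ) := by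
  ext k l
  rw [Matrix.mul_apply, Matrix.diagonal_apply]
  simp only [spinMatrix_plus_apply, spinMatrix_minus_apply]
  by_cases hk : (k : ℕ) < n
  · rw [Finset.sum_eq_single (⟨k + 1, by omega⟩ : Fin (n + 1))]
    · by_cases h : k = l
      · subst h; simp [sq]
      · have : ¬ (k : ℕ) = l := fun h' => h (Fin.ext h')
        simp [h, this]
    · intro m _ hm
      rw [if_neg, zero_mul]
      exact fun h => hm (Fin.ext h)
    · simp
  · have hkn : (k : ℕ) = n := by omega
    rw [Finset.sum_eq_zero]
    · by_cases h : k = l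
      · simp [h.symm, hkn, ladder_self]
      · simp [h]
    · intro m _
      rw [if_neg (by omega), zero_mul]

/-- The case k = 0 is separate because natural-number subtraction would send k − 1 to 0, where the
ladder coefficient need not vanish. -/
theorem spinMatrix_minus_mul_plus : spinMatrix n .minus * spinMatrix n .plus =
    Matrix.diagonal fun k : Fin (n + 1) => if (k : ℕ) = 0 then 0 else ((ladder n (k - 1) ^ 2 : ℝ) : ℂ) := by
  ext k l
  rw [Matrix.mul_apply, Matrix.diagonal_apply]
  simp only [spinMatrix_plus_apply, spinMatrix_minus_apply]
  by_cases hk : (k : ℕ) = 0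
  · rw [Finset.sum_eq_zero]
    · simp [hk]
    · intro m _
      rw [if_neg (by omega), zero_mul]
  · rw [Finset.sum_eq_single (⟨k - 1, by omega⟩ : Fin (n + 1))]
    · have h1 : (k : ℕ) = k - 1 + 1 := by omega
      by_cases h : k = l
      · subst h; simp [← h1, hk, sq]
      · have : ¬ (l : ℕ) = k := fun h' => h (Fin.ext h'.symm)
        simp [h, ← h1, this]
    · intro m _ hm
      rw [if_neg, zero_mul]
      intro h
      exact hm (Fin.ext (by simp; omega))
    · simp

/-- The factor n/2 = s compensates the rescaling of the generators, so the structure constants do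
not depend on s. Three commutators are computed; antisymmetry gives the others. -/
theorem spinMatrix_commutator (hn : 1 ≤ n) (i j : Idx) :
    ((n : ℂ) / 2) • (spinMatrix n i * spinMatrix n j - spinMatrix n j * spinMatrix n i) =
      ∑ k : Idx, (eps i j k : ℂ) • spinMatrix n k := by
  have hn0 : (n : ℂ) ≠ 0 := by exact_mod_cast (by omega : n ≠ 0)
  have hn0' : (n : ℝ) ≠ 0 := by exact_mod_cast (by omega : n ≠ 0)
  have hsum : ∀ g : Idx → Matrix (Fin (n + 1)) (Fin (n + 1)) ℂ,
      ∑ i, g i = g .plus + g .z + g .minus := by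
    intro g
    change ∑ i ∈ {Idx.plus, Idx.z, Idx.minus}, g i = _
    simp [add_assoc]
  have hpm : ((n : ℂ) / 2) • (spinMatrix n .plus * spinMatrix n .minus -
      spinMatrix n .minus * spinMatrix n .plus) = spinMatrix n .z := by
    rw [spinMatrix_plus_mul_minus, spinMatrix_minus_mul_plus, spinMatrix_z]
    rw [Matrix.diagonal_sub, ← Matrix.diagonal_smul]
    congr 1
    funext k
    have hk : (k : ℕ) ≤ n := by omega
    rw [Pi.smul_apply, smul_eq_mul, ladder_sq hk]
    by_cases h0 : (k : ℕ) = 0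
    · simp only [h0, if_true]
      push_cast
      field_simp
      ring
    · have h1 : ((k : ℕ) - 1 : ℕ) ≤ n := by omega
      rw [if_neg h0, ladder_sq h1, Nat.cast_sub (by omega)]
      push_cast
      field_simp
      ring
  have hzp : ((n : ℂ) / 2) • (spinMatrix n .z * spinMatrix n .plus -
      spinMatrix n .plus * spinMatrix n .z) = spinMatrix n .plus := by
    rw [spinMatrix_z]
    ext k l
    rw [Matrix.smul_apply, Matrix.sub_apply, Matrix.diagonal_mul, Matrix.mul_diagonal,
      spinMatrix_plus_apply, smul_eq_mul]
    split_ifs with h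
    · rw [h]
      push_cast
      field_simp
      ring
    · simp
  have hzm : ((n : ℂ) / 2) • (spinMatrix n .z * spinMatrix n .minus -
      spinMatrix n .minus * spinMatrix n .z) = -spinMatrix n .minus := by
    rw [spinMatrix_z]
    ext k l
    rw [Matrix.smul_apply, Matrix.sub_apply, Matrix.diagonal_mul, Matrix.mul_diagonal,
      Matrix.neg_apply, spinMatrix_minus_apply, smul_eq_mul]
    split_ifs with h
    · rw [h]
      push_cast
      field_simp
      ring
    · simp
  have hneg : ∀ a b : Matrix (Fin (n + 1)) (Fin (n + 1)) ℂ,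
      ((n : ℂ) / 2) • (a * b - b * a) = -(((n : ℂ) / 2) • (b * a - a * b)) := by
    intro a b
    rw [← smul_neg, neg_sub]
  rw [hsum]
  cases i <;> cases j <;> simp only [eps, sub_self, smul_zero] <;> simp only [Int.cast_zero,
    Int.cast_one, Int.cast_neg, zero_smul, one_smul, neg_smul, add_zero, zero_add, hpm, hzp, hzm]
  · rw [hneg, hzp]
  · rw [hneg, hpm]
  · rw [hneg, hzm, neg_neg]

/-- The spin matrices generate the full matrix algebra. -/
theorem adjoin_spinMatrix (hn : 1 ≤ n) : Algebra.adjoin ℂ (Set.range (spinMatrix n)) = ⊤ := by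
  set 𝒜 := Algebra.adjoin ℂ (Set.range (spinMatrix n)) with h𝒜
  have hn0' : (n : ℝ) ≠ 0 := by exact_mod_cast (by omega : n ≠ 0)
  have hspin : ∀ i, spinMatrix n i ∈ 𝒜 := fun i => Algebra.subset_adjoin ⟨i, rfl⟩
  set ev : Fin (n + 1) → ℂ := fun k => ((((n : ℝ) / 2 - k) / ((n : ℝ) / 2) : ℝ) : ℂ) with hev
  have hinj : Function.Injective ev := by
    intro k l h
    have h2 := Complex.ofReal_injective h
    field_simp at h2
    have h3 : (k : ℝ) = l := by linarith
    exact Fin.ext (by exact_mod_cast h3)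
  -- S_z has distinct eigenvalues, so its spectral projections are Lagrange interpolation
  -- polynomials in S_z.
  have hdiag : ∀ k, Matrix.single k k (1 : ℂ) ∈ 𝒜 := by
    intro k
    have h1 : Polynomial.aeval (spinMatrix n .z) (Lagrange.basis Finset.univ ev k) =
        Matrix.single k k (1 : ℂ) := by
      have : spinMatrix n .z = Matrix.diagonalAlgHom ℂ ev := spinMatrix_z
      rw [this, Polynomial.aeval_algHom_apply, Matrix.diagonalAlgHom_apply,
        ← Matrix.diagonal_single]
      congr 1
      funext l
      rw [Polynomial.aeval_pi_apply₂, Polynomial.coe_aeval_eq_eval]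
      by_cases h : l = k
      · subst h
        rw [Lagrange.eval_basis_self hinj.injOn (Finset.mem_univ _), Pi.single_eq_same]
      · rw [Lagrange.eval_basis_of_ne (Ne.symm h) (Finset.mem_univ _), Pi.single_eq_of_ne h]
    rw [← h1]
    exact Algebra.adjoin_mono (by simp)
      (Polynomial.aeval_mem_adjoin_singleton ℂ (spinMatrix n .z))
  -- Sandwiching a spin matrix between two such projections isolates a single entry.
  have hunit : ∀ k l i, spinMatrix n i k l ≠ 0 → Matrix.single k l (1 : ℂ) ∈ 𝒜 := by
    intro k l i hne
    have h1 := 𝒜.mul_mem (𝒜.mul_mem (hdiag k) (hspin i)) (hdiag l)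
    rw [Matrix.single_mul_mul_single, one_mul, mul_one] at h1
    have h2 := 𝒜.smul_mem h1 (spinMatrix n i k l)⁻¹
    rwa [Matrix.smul_single, smul_eq_mul, inv_mul_cancel₀ hne] at h2
  -- The ladder entries between neighbouring weights are nonzero, so neighbouring matrix units chain
  -- together to connect every index with 0.
  have hrow : ∀ (k : ℕ) (hk : k < n + 1), Matrix.single (0 : Fin (n + 1)) ⟨k, hk⟩ (1 : ℂ) ∈ 𝒜 ∧
      Matrix.single ⟨k, hk⟩ (0 : Fin (n + 1)) (1 : ℂ) ∈ 𝒜 := by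
    intro k
    induction k with
    | zero => exact fun hk => ⟨hdiag 0, hdiag 0⟩
    | succ k ih =>
      intro hk
      have hl : (ladder n k : ℂ) ≠ 0 := by
        exact_mod_cast ladder_ne_zero (by omega : k < n)
      obtain ⟨h1, h2⟩ := ih (by omega)
      have h3 := hunit ⟨k, by omega⟩ ⟨k + 1, hk⟩ .plus (by simpa [spinMatrix_plus_apply] using hl)
      have h4 := hunit ⟨k + 1, hk⟩ ⟨k, by omega⟩ .minus
        (by simpa [spinMatrix_minus_apply] using hl)
      have h5 := 𝒜.mul_mem h1 h3
      have h6 := 𝒜.mul_mem h4 h2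
      rw [Matrix.single_mul_single_same, one_mul] at h5 h6
      exact ⟨h5, h6⟩
  rw [eq_top_iff]
  rintro a -
  induction a using Matrix.induction_on with
  | h_add a b ha hb => exact 𝒜.add_mem ha hb
  | h_std_basis k l c =>
    have h := 𝒜.smul_mem (𝒜.mul_mem (hrow k k.2).2 (hrow l l.2).1) c
    rwa [Matrix.single_mul_single_same, one_mul, Matrix.smul_single, smul_eq_mul, mul_one] at h

end spinMatrix

/-! ### Quantum evaluation of words -/

section quantum

variable {d n : ℕ}

instance isClosed_quasiLocal (d n : ℕ) :
    IsClosed (quasiLocal d n : Set (Hilb d n →L[ℂ] Hilb d n)) :=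
  StarSubalgebra.isClosed_topologicalClosure _

theorem star_quantumSpin (p : Letter d) :
    star (quantumSpin n p) = quantumSpin n (letterBar p) := by
  apply Subtype.ext
  change star (siteOp p.1 (spinMatrix n p.2)) = siteOp p.1 (spinMatrix n p.2.bar)
  rw [star_siteOp, conjTranspose_spinMatrix]

theorem norm_one_quantumAlg_le : ‖(1 : QuantumAlg d n)‖ ≤ 1 := ContinuousLinearMap.norm_id_le

/-- By the C*-identity ‖S_+‖² = ‖S_-S_+‖ ≤ 2 ≤ e. The value 2 occurs at s = 1/2, so quantum letters
can exceed norm 1; this is why words are measured down to radius 1/2 and not 0. -/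
theorem norm_quantumSpin_le (hn : 1 ≤ n) (p : Letter d) :
    ‖quantumSpin n p‖ ≤ Real.exp (1 / 2) := by
  have hn0 : (1 : ℝ) ≤ n := by exact_mod_cast hn
  have hplus : ∀ x : Site d, ‖quantumSpin n (x, .plus)‖ ≤ Real.exp (1 / 2) := by
    intro x
    refine le_of_sq_le_sq ?_ (Real.exp_pos _).le
    rw [sq, ← CStarRing.norm_star_mul_self, ← Real.exp_nat_mul, star_quantumSpin]
    change ‖siteOp x (spinMatrix n .minus) * siteOp x (spinMatrix n .plus)‖ ≤ _
    rw [← siteOp_mul, spinMatrix_minus_mul_plus]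
    refine (norm_siteOp_diagonal_le x _ (C := 2) (by norm_num) fun k => ?_).trans ?_
    · split_ifs with hk
      · simp
      · have h1 : ((k : ℕ) - 1 : ℕ) ≤ n := by omega
        have hkn : (k : ℝ) ≤ n := by exact_mod_cast (by omega : (k : ℕ) ≤ n)
        have hk1 : (1 : ℝ) ≤ (k : ℕ) := by exact_mod_cast (by omega : 1 ≤ (k : ℕ))
        rw [Complex.norm_real, Real.norm_of_nonneg (sq_nonneg _), ladder_sq h1,
          Nat.cast_sub (by omega), div_le_iff₀ (by positivity)]
        push_cast
        nlinarith [mul_nonneg (by linarith : (0 : ℝ) ≤ (n : ℝ) - k)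
          (by linarith : (0 : ℝ) ≤ (k : ℝ) - 1)]
    · have := Real.add_one_le_exp 1
      norm_num
      linarith
  rcases p with ⟨x, i⟩
  cases i
  · exact hplus x
  · refine le_trans ?_ (Real.one_le_exp (by norm_num))
    change ‖siteOp x (spinMatrix n .z)‖ ≤ 1
    rw [spinMatrix_z]
    refine norm_siteOp_diagonal_le x _ zero_le_one fun k => ?_
    have hkn : (k : ℝ) ≤ n := by exact_mod_cast (by omega : (k : ℕ) ≤ n)
    have hk0 : (0 : ℝ) ≤ (k : ℕ) := by positivity
    rw [Complex.norm_real, Real.norm_eq_abs, abs_div, abs_of_pos (by positivity : 0 < (n : ℝ) / 2),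
      div_le_one (by positivity), abs_le]
    constructor <;> linarith
  · have h := hplus x
    rw [← norm_star, star_quantumSpin] at h
    exact h

theorem norm_rep_quantumSpin_ofWord_le (hn : 1 ≤ n) (w : List (Letter d)) :
    ‖rep (quantumSpin n) (ofWord w)‖ ≤ Real.exp (1 / 2 * w.length) := by
  rw [rep_ofWord]
  induction w with
  | nil =>
    rw [List.map_nil, List.prod_nil, List.length_nil, Nat.cast_zero, mul_zero, Real.exp_zero]
    exact norm_one_quantumAlg_le
  | cons a w ih =>
    rw [List.map_cons, List.prod_cons]
    refine (norm_mul_le _ _).trans ((mul_le_mul (norm_quantumSpin_le hn a) ih (norm_nonneg _)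
      (Real.exp_pos _).le).trans (le_of_eq ?_))
    rw [← Real.exp_add]
    congr 1
    push_cast [List.length_cons]
    ring

theorem quantumSpin_commutator (hn : 1 ≤ n) (a b : Letter d) :
    ((n : ℂ) / 2) • (quantumSpin n a * quantumSpin n b - quantumSpin n b * quantumSpin n a) =
      if a.1 = b.1 then ∑ k : Idx, (eps a.2 b.2 k : ℂ) • quantumSpin n (b.1, k) else 0 := by
  apply Subtype.ext
  rcases a with ⟨x, i⟩
  rcases b with ⟨y, j⟩
  by_cases hxy : x = y
  · subst hxy
    rw [if_pos rfl]
    have h := congr_arg (siteHom (d := d) x) (spinMatrix_commutator hn i j)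
    rw [map_smul, map_sub, map_mul, map_mul, map_sum] at h
    simp only [map_smul, siteHom_apply] at h
    refine h.trans ?_
    push_cast
    rfl
  · rw [if_neg hxy]
    have h := (siteOp_commute hxy (spinMatrix n i) (spinMatrix n j)).eq
    change ((n : ℂ) / 2) • (siteOp x (spinMatrix n i) * siteOp y (spinMatrix n j) -
      siteOp y (spinMatrix n j) * siteOp x (spinMatrix n i)) = 0
    rw [h, sub_self, smul_zero]

/-- Since `adLetter` preserves the order of factors, it reproduces the Leibniz rule of the
commutator without any ordering error. -/
theorem rep_adLetter_quantumSpin (hn : 1 ≤ n) (u : List (Letter d)) (b : Letter d) :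
    rep (quantumSpin n) (adLetter u b) = (Complex.I * ((n : ℂ) / 2)) •
      ((u.map (quantumSpin n)).prod * quantumSpin n b -
        quantumSpin n b * (u.map (quantumSpin n)).prod) := by
  induction u with
  | nil => simp [adLetter]
  | cons a u ih =>
    have h1 : rep (quantumSpin n) (letterBracket a b u) = (Complex.I * ((n : ℂ) / 2)) •
        ((quantumSpin n a * quantumSpin n b - quantumSpin n b * quantumSpin n a) *
          (u.map (quantumSpin n)).prod) := by
      rw [← smul_mul_assoc, mul_smul, quantumSpin_commutator hn, letterBracket]
      split_ifs
      · simp only [map_sum, map_smul, rep_ofWord, List.map_cons, List.prod_cons, Finset.smul_sum,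
          Finset.sum_mul, smul_smul, smul_mul_assoc]
      · simp
    rw [adLetter, map_add, rep_lcons, ih, h1, List.map_cons, List.prod_cons, mul_smul_comm,
      ← smul_add]
    congr 1
    noncomm_ring

theorem rep_adWord_quantumSpin (hn : 1 ≤ n) (u w : List (Letter d)) :
    rep (quantumSpin n) (adWord u w) = (Complex.I * ((n : ℂ) / 2)) •
      ((u.map (quantumSpin n)).prod * (w.map (quantumSpin n)).prod -
        (w.map (quantumSpin n)).prod * (u.map (quantumSpin n)).prod) := by
  induction w with
  | nil => simp [adWord]
  | cons b w ih =>
    rw [adWord, map_add, rep_rappend, rep_lcons, ih, rep_adLetter_quantumSpin hn, List.map_cons,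
      List.prod_cons, mul_smul_comm, smul_mul_assoc, ← smul_add]
    congr 1
    noncomm_ring

theorem prod_wordPart (i : Idx) (α : MultiIndex d) :
    ((wordPart i α).map (quantumSpin n)).prod = spinPower n i α := by
  rw [wordPart, spinPower]
  induction (α.support.image Prod.fst).toList with
  | nil => simp
  | cons x l ih => simp [ih]

theorem quantizeMonomial_eq (α : MultiIndex d) :
    quantizeMonomial n α = ((normalWord α).map (quantumSpin n)).prod := by
  rw [normalWord, List.map_append, List.map_append, List.prod_append, List.prod_append,
    prod_wordPart, prod_wordPart, prod_wordPart, quantizeMonomial]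

theorem MultiIndex.image_support_bar (α : MultiIndex d) :
    α.bar.support.image Prod.fst = α.support.image Prod.fst := by
  ext x
  simp only [Finset.mem_image, Finsupp.mem_support_iff, MultiIndex.bar_apply]
  constructor
  · rintro ⟨p, hp, rfl⟩
    exact ⟨letterBar p, hp, rfl⟩
  · rintro ⟨p, hp, rfl⟩
    exact ⟨letterBar p, by simpa [letterBar, Idx.bar_bar] using hp, rfl⟩

theorem quantumSpin_commute (i : Idx) (x y : Site d) :
    Commute (quantumSpin n (x, i)) (quantumSpin n (y, i)) := by
  by_cases h : x = y
  · rw [h]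
  · exact Subtype.ext (siteOp_commute h (spinMatrix n i) (spinMatrix n i)).eq

/-- The adjoint reverses the product, but factors of one type commute, so the order can be restored.
-/
theorem star_spinPower (i : Idx) (α : MultiIndex d) :
    star (spinPower n i α) = spinPower n i.bar α.bar := by
  rw [spinPower, spinPower, MultiIndex.image_support_bar]
  generalize (α.support.image Prod.fst).toList = l
  have h1 : star (l.map fun x => quantumSpin n (x, i) ^ α (x, i)).prod =
      (l.map fun x => quantumSpin n (x, i.bar) ^ α.bar (x, i.bar)).reverse.prod := by
    induction l with
    | nil => simp
    | cons x l ih =>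
      rw [List.map_cons, List.prod_cons, star_mul, ih, List.map_cons, List.reverse_cons,
        List.prod_append, List.prod_singleton, star_pow, star_quantumSpin, MultiIndex.bar_apply]
      simp [letterBar, Idx.bar_bar]
  rw [h1]
  refine (List.reverse_perm _).prod_eq' ?_
  rw [List.pairwise_reverse, List.pairwise_map]
  exact List.pairwise_of_forall fun x y => (quantumSpin_commute i.bar y x).pow_pow _ _

/-- Normal ordering is invariant under adjoints: reversing the factors and exchanging + with −
restores it. With the reality of V this makes the Hamiltonians self-adjoint. -/
theorem star_quantizeMonomial (α : MultiIndex d) :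
    star (quantizeMonomial n α) = quantizeMonomial n α.bar := by
  rw [quantizeMonomial, quantizeMonomial, star_mul, star_mul, star_spinPower, star_spinPower,
    star_spinPower, mul_assoc]
  rfl

theorem rep_quantumSpin_coe (B : Words d) : (rep (quantumSpin n) B : Hilb d n →L[ℂ] Hilb d n) =
    rep (fun p => (quantumSpin n p : Hilb d n →L[ℂ] Hilb d n)) B := by
  induction B using Finsupp.induction_linear with
  | zero => simp
  | add f g hf hg => rw [map_add, map_add, ← hf, ← hg]; rfl
  | single w c =>
    have : ∀ w : List (Letter d), (((w.map (quantumSpin n)).prod : QuantumAlg d n) :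
        Hilb d n →L[ℂ] Hilb d n) =
        (w.map fun p => (quantumSpin n p : Hilb d n →L[ℂ] Hilb d n)).prod := by
      intro w
      induction w with
      | nil => rfl
      | cons a w ih =>
        rw [List.map_cons, List.prod_cons, List.map_cons, List.prod_cons, ← ih]
        rfl
    simp only [rep, Finsupp.linearCombination_single]
    rw [← this]
    rfl

theorem localAlg_mono {Λ Λ' : Finset (Site d)} (h : Λ ⊆ Λ') : localAlg d n Λ ≤ localAlg d n Λ' :=
  StarAlgebra.adjoin_mono fun _ ⟨x, hx, a, ha⟩ => ⟨x, h hx, a, ha⟩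

theorem exists_rep_mem_localAlg (n : ℕ) (B : Words d) : ∃ Λ : Finset (Site d),
    (rep (quantumSpin n) B : Hilb d n →L[ℂ] Hilb d n) ∈ localAlg d n Λ := by
  classical
  induction B using Finsupp.induction_linear with
  | zero => exact ⟨∅, by rw [map_zero]; exact zero_mem _⟩
  | add f g hf hg =>
    obtain ⟨Λ₁, h₁⟩ := hf
    obtain ⟨Λ₂, h₂⟩ := hg
    refine ⟨Λ₁ ∪ Λ₂, ?_⟩
    rw [map_add]
    exact add_mem (localAlg_mono Finset.subset_union_left h₁)
      (localAlg_mono Finset.subset_union_right h₂)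
  | single w c =>
    refine ⟨(w.map Prod.fst).toFinset, ?_⟩
    rw [rep_quantumSpin_coe]
    simp only [rep, Finsupp.linearCombination_single]
    refine SMulMemClass.smul_mem _ (list_prod_mem ?_)
    intro T hT
    obtain ⟨p, hp, rfl⟩ := List.mem_map.1 hT
    exact StarAlgebra.subset_adjoin ℂ _
      ⟨p.1, by rw [List.mem_toFinset]; exact List.mem_map_of_mem hp, _, rfl⟩

/-- The spins at a site generate all matrices there, hence all local algebras. -/
theorem dense_range_rep_quantumSpin (hn : 1 ≤ n) :
    Dense (Set.range (rep (quantumSpin n : Letter d → QuantumAlg d n))) := by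
  set s : Letter d → (Hilb d n →L[ℂ] Hilb d n) := fun p => quantumSpin n p with hs
  have hstar : ∀ p, star (s p) ∈ Set.range s := fun p =>
    ⟨letterBar p, congr_arg Subtype.val (star_quantumSpin (n := n) p).symm⟩
  have hle : (⨆ Λ : Finset (Site d), localAlg d n Λ) ≤ StarAlgebra.adjoin ℂ (Set.range s) := by
    refine iSup_le fun Λ => StarAlgebra.adjoin_le ?_
    rintro _ ⟨x, -, a, rfl⟩
    have ha : a ∈ Algebra.adjoin ℂ (Set.range (spinMatrix n)) := by
      rw [adjoin_spinMatrix hn]; trivial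
    have h2 : siteHom (d := d) x a ∈ (Algebra.adjoin ℂ (Set.range (spinMatrix n))).map
        (siteHom (d := d) x) := ⟨a, ha, rfl⟩
    rw [AlgHom.map_adjoin] at h2
    refine Algebra.adjoin_le ?_ h2
    rintro _ ⟨_, ⟨i, rfl⟩, rfl⟩
    exact StarAlgebra.subset_adjoin ℂ _ ⟨(x, i), rfl⟩
  rw [dense_iff_closure_eq, Set.eq_univ_iff_forall]
  intro a
  rw [closure_subtype]
  have ha : (a : Hilb d n →L[ℂ] Hilb d n) ∈
      closure ((⨆ Λ : Finset (Site d), localAlg d n Λ : StarSubalgebra ℂ _) : Set _) := a.2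
  refine closure_mono ?_ ha
  intro T hT
  obtain ⟨B, rfl⟩ := mem_range_rep_of_mem_star_adjoin s hstar (hle hT)
  exact ⟨rep (quantumSpin n) B, ⟨B, rfl⟩, rep_quantumSpin_coe B⟩

end quantum

/-! ### Heisenberg dynamics in C*-algebras -/

section heisenberg

variable {𝔅 : Type*} [CStarAlgebra 𝔅]

/-- The Heisenberg evolution `e^{iκtH} a e^{-iκtH}`. -/
noncomputable def evolve (κ : ℝ) (H : 𝔅) (t : ℝ) (a : 𝔅) : 𝔅 :=
  star (NormedSpace.exp ((-(Complex.I * (κ : ℂ) * (t : ℂ))) • H)) * a *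
    NormedSpace.exp ((-(Complex.I * (κ : ℂ) * (t : ℂ))) • H)

variable {κ : ℝ} {H : 𝔅}

theorem exp_smul_eq (κ : ℝ) (H : 𝔅) (t : ℝ) :
    (-(Complex.I * (κ : ℂ) * (t : ℂ))) • H = t • ((-(Complex.I * (κ : ℂ))) • H) := by
  rw [← Complex.coe_smul, smul_smul]
  congr 1
  ring

theorem star_exp_smul (hH : IsSelfAdjoint H) (t : ℝ) :
    star (NormedSpace.exp ((-(Complex.I * (κ : ℂ) * (t : ℂ))) • H)) =
      NormedSpace.exp (t • -((-(Complex.I * (κ : ℂ))) • H)) := by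
  rw [NormedSpace.star_exp, star_smul, hH.star_eq, ← neg_smul, ← Complex.coe_smul, smul_smul]
  congr 2
  simp
  ring

theorem evolve_eq (hH : IsSelfAdjoint H) (t : ℝ) (a : 𝔅) :
    evolve κ H t a = NormedSpace.exp (t • -((-(Complex.I * (κ : ℂ))) • H)) * a *
      NormedSpace.exp (t • ((-(Complex.I * (κ : ℂ))) • H)) := by
  rw [evolve, star_exp_smul hH, exp_smul_eq]

theorem exp_neg_mul_exp (Y : 𝔅) (t : ℝ) :
    NormedSpace.exp (t • -Y) * NormedSpace.exp (t • Y) = 1 := by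
  let _ : NormedAlgebra ℚ 𝔅 := NormedAlgebra.restrictScalars ℚ ℂ 𝔅
  rw [smul_neg, ← NormedSpace.exp_add_of_commute (Commute.refl (t • Y)).neg_left, neg_add_cancel,
    NormedSpace.exp_zero]

theorem exp_mul_exp_neg (Y : 𝔅) (t : ℝ) :
    NormedSpace.exp (t • Y) * NormedSpace.exp (t • -Y) = 1 := by
  simpa using exp_neg_mul_exp (-Y) t

theorem exp_add_smul (Y : 𝔅) (t u : ℝ) :
    NormedSpace.exp ((t + u) • Y) = NormedSpace.exp (t • Y) * NormedSpace.exp (u • Y) := by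
  let _ : NormedAlgebra ℚ 𝔅 := NormedAlgebra.restrictScalars ℚ ℂ 𝔅
  rw [add_smul, NormedSpace.exp_add_of_commute]
  exact ((Commute.refl Y).smul_left t).smul_right u

theorem evolve_zero (a : 𝔅) : evolve κ H 0 a = a := by
  simp [evolve]

theorem evolve_add_time (hH : IsSelfAdjoint H) (t u : ℝ) (a : 𝔅) :
    evolve κ H (t + u) a = evolve κ H t (evolve κ H u a) := by
  simp only [evolve_eq hH]
  rw [exp_add_smul _ t u, add_comm t u, exp_add_smul _ u t]
  simp only [mul_assoc]

theorem evolve_add (t : ℝ) (a b : 𝔅) :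
    evolve κ H t (a + b) = evolve κ H t a + evolve κ H t b := by
  simp only [evolve, mul_add, add_mul]

theorem evolve_smul (t : ℝ) (c : ℂ) (a : 𝔅) :
    evolve κ H t (c • a) = c • evolve κ H t a := by
  simp only [evolve, mul_smul_comm, smul_mul_assoc]

theorem evolve_star (t : ℝ) (a : 𝔅) : evolve κ H t (star a) = star (evolve κ H t a) := by
  simp only [evolve, star_mul, star_star, mul_assoc]

theorem evolve_mul (hH : IsSelfAdjoint H) (t : ℝ) (a b : 𝔅) :
    evolve κ H t (a * b) = evolve κ H t a * evolve κ H t b := by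
  simp only [evolve_eq hH]
  set Y := (-(Complex.I * (κ : ℂ))) • H
  calc NormedSpace.exp (t • -Y) * (a * b) * NormedSpace.exp (t • Y)
      = NormedSpace.exp (t • -Y) * a * 1 * b * NormedSpace.exp (t • Y) := by
        simp only [mul_assoc, one_mul]
    _ = _ := by
        rw [← exp_mul_exp_neg Y t]
        simp only [mul_assoc]

theorem norm_evolve_le (hH : IsSelfAdjoint H) (t : ℝ) (a : 𝔅) : ‖evolve κ H t a‖ ≤ ‖a‖ := by
  set U := NormedSpace.exp ((-(Complex.I * (κ : ℂ) * (t : ℂ))) • H) with hU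
  have h1 : star U * U = 1 := by
    rw [hU, star_exp_smul hH, exp_smul_eq, exp_neg_mul_exp]
  have h2 : ‖U‖ ≤ 1 := by
    have h3 := CStarRing.norm_star_mul_self (x := U)
    rw [h1] at h3
    have h4 : ‖(1 : 𝔅)‖ ≤ 1 := by
      have h5 := CStarRing.norm_star_mul_self (x := (1 : 𝔅))
      rw [star_one, one_mul] at h5
      nlinarith [norm_nonneg (1 : 𝔅)]
    nlinarith [norm_nonneg U]
  calc ‖star U * a * U‖ ≤ ‖star U‖ * ‖a‖ * ‖U‖ :=
        (norm_mul_le _ _).trans (mul_le_mul_of_nonneg_right (norm_mul_le _ _) (norm_nonneg _))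
    _ ≤ 1 * ‖a‖ * 1 := by
        rw [norm_star]
        gcongr
    _ = ‖a‖ := by ring

theorem evolve_sub (t : ℝ) (a b : 𝔅) :
    evolve κ H t (a - b) = evolve κ H t a - evolve κ H t b := by
  simp only [evolve, mul_sub, sub_mul]

theorem norm_evolve_sub_le (hH : IsSelfAdjoint H) (t : ℝ) (a b : 𝔅) :
    ‖evolve κ H t a - evolve κ H t b‖ ≤ ‖a - b‖ := by
  rw [← evolve_sub]
  exact norm_evolve_le hH t _

theorem hasDerivAt_evolve (hH : IsSelfAdjoint H) (t : ℝ) (a : 𝔅) :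
    HasDerivAt (fun τ => evolve κ H τ a)
      (evolve κ H t ((Complex.I * (κ : ℂ)) • (H * a - a * H))) t := by
  have e : (fun τ => evolve κ H τ a) = fun τ : ℝ =>
      NormedSpace.exp (τ • -((-(Complex.I * (κ : ℂ))) • H)) * a *
        NormedSpace.exp (τ • ((-(Complex.I * (κ : ℂ))) • H)) := by
    funext τ
    exact evolve_eq hH τ a
  rw [e, evolve_eq hH]
  have h1 := hasDerivAt_exp_smul_const (𝕂 := ℝ) (-((-(Complex.I * (κ : ℂ))) • H)) t
  have h2 := hasDerivAt_exp_smul_const' (𝕂 := ℝ) ((-(Complex.I * (κ : ℂ))) • H) t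
  refine ((h1.mul_const a).mul h2).congr_deriv ?_
  simp only [neg_smul, neg_neg, smul_sub, mul_sub, sub_mul, mul_smul_comm, smul_mul_assoc,
    mul_neg, neg_mul, mul_assoc]
  abel

/-- The Heisenberg evolution as a linear map. -/
noncomputable def evolveL (κ : ℝ) (H : 𝔅) (t : ℝ) : 𝔅 →ₗ[ℂ] 𝔅 where
  toFun := evolve κ H t
  map_add' := evolve_add t
  map_smul' := evolve_smul t

@[simp] theorem evolveL_apply (κ : ℝ) (H : 𝔅) (t : ℝ) (a : 𝔅) :
    evolveL κ H t a = evolve κ H t a := rfl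

theorem hasSum_evolve {ι : Type*} {g : ι → 𝔅} {a : 𝔅} (h : HasSum g a) (t : ℝ) :
    HasSum (fun i => evolve κ H t (g i)) (evolve κ H t a) :=
  (h.mul_left _).mul_right _

/-- The evolution of words under the Hamiltonian with interaction `V`. -/
theorem isWordSolution_evolve {d : ℕ} {V : Potential d} (hH : IsSelfAdjoint H) (s : Letter d → 𝔅)
    (hs : ∀ w, ‖rep s (ofWord w)‖ ≤ Real.exp (1 / 2 * w.length))
    (hbr : ∀ u w : List (Letter d), rep s (adWord u w) = (Complex.I * (κ : ℂ)) •
      ((u.map s).prod * (w.map s).prod - (w.map s).prod * (u.map s).prod))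
    (hHV : HasSum (fun α => V α • ((normalWord α).map s).prod) H) :
    IsWordSolution V fun t => evolveL κ H t ∘ₗ rep s where
  bound t w := (norm_evolve_le hH t _).trans (hs w)
  deriv t w := by
    refine (hasDerivAt_evolve hH t (rep s (ofWord w))).congr_deriv ?_
    have h1 := ((hHV.mul_right (rep s (ofWord w))).sub
      (hHV.mul_left (rep s (ofWord w)))).const_smul (Complex.I * (κ : ℂ))
    refine (hasSum_evolve h1 t).tsum_eq.symm.trans (tsum_congr fun α => ?_)
    rw [LinearMap.comp_apply, bracket_ofWord, hbr, evolveL_apply, ← evolve_smul, rep_ofWord]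
    congr 1
    rw [smul_mul_assoc, mul_smul_comm, ← smul_sub, smul_comm]

/-- The thermodynamic limit of Heisenberg evolutions. -/
theorem exists_limit_dynamics {ι : Type*} [SemilatticeSup ι] [Nonempty ι] {H : ι → 𝔅}
    (hH : ∀ i, IsSelfAdjoint (H i)) {S : Set 𝔅} (hS : Dense S)
    (hlim : ∀ a ∈ S, ∀ (t ε : ℝ), 0 < ε → ∃ b, ∀ᶠ i in atTop, ‖evolve κ (H i) t a - b‖ ≤ ε)
    (hlip : ∀ a ∈ S, ∃ C, ∀ i t u, ‖evolve κ (H i) t a - evolve κ (H i) u a‖ ≤ C * |t - u|) :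
    ∃ α : ℝ → 𝔅 ≃⋆ₐ[ℂ] 𝔅, (∀ a, α 0 a = a) ∧ (∀ t u a, α (t + u) a = α t (α u a)) ∧
      (∀ a, Continuous fun t => α t a) ∧
      ∀ t a, Tendsto (fun i => evolve κ (H i) t a) atTop (𝓝 (α t a)) := by
  have hex : ∀ t a, ∃ b, Tendsto (fun i => evolve κ (H i) t a) atTop (𝓝 b) := by
    intro t a
    refine cauchySeq_tendsto_of_complete ?_
    rw [Metric.cauchySeq_iff']
    intro ε hε
    obtain ⟨a', ha', haS⟩ := Metric.dense_iff.1 hS a (ε / 6) (by positivity)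
    rw [Metric.mem_ball, dist_comm, dist_eq_norm] at ha'
    obtain ⟨b, hb⟩ := hlim a' haS t (ε / 6) (by positivity)
    obtain ⟨N, hN⟩ := eventually_atTop.1 hb
    -- All late evolutions are close to one common element, which yields the Cauchy property.
    have key : ∀ i ≥ N, dist (evolve κ (H i) t a) b ≤ ε / 6 + ε / 6 := by
      intro i hi
      rw [dist_eq_norm]
      calc ‖evolve κ (H i) t a - b‖ = ‖(evolve κ (H i) t a - evolve κ (H i) t a') +
            (evolve κ (H i) t a' - b)‖ := by congr 1; abel
        _ ≤ ε / 6 + ε / 6 := (norm_add_le _ _).trans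
            (add_le_add ((norm_evolve_sub_le (hH i) t a a').trans ha'.le) (hN i hi))
    refine ⟨N, fun i hi => ?_⟩
    have := dist_triangle_right (evolve κ (H i) t a) (evolve κ (H N) t a) b
    linarith [key i hi, key N le_rfl]
  choose T hT using hex
  have hzero : ∀ a, T 0 a = a := fun a =>
    tendsto_nhds_unique (hT 0 a) (by simpa only [evolve_zero] using tendsto_const_nhds)
  have hcontr : ∀ t a b, ‖T t a - T t b‖ ≤ ‖a - b‖ := fun t a b =>
    le_of_tendsto ((hT t a).sub (hT t b)).norm
      (Eventually.of_forall fun i => norm_evolve_sub_le (hH i) t a b)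
  have hadd : ∀ t u a, T (t + u) a = T t (T u a) := by
    intro t u a
    refine tendsto_nhds_unique (hT (t + u) a) ?_
    -- The evolutions do not expand distances uniformly in i, so the inner one may be replaced by
    -- its limit.
    have h1 : Tendsto (fun i => evolve κ (H i) t (evolve κ (H i) u a) -
        evolve κ (H i) t (T u a)) atTop (𝓝 0) := by
      refine squeeze_zero_norm (fun i => norm_evolve_sub_le (hH i) t _ _) ?_
      exact tendsto_iff_norm_sub_tendsto_zero.1 (hT u a)
    have h2 := h1.add (hT t (T u a))
    rw [zero_add] at h2
    refine h2.congr fun i => ?_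
    rw [evolve_add_time (hH i), sub_add_cancel]
  refine ⟨fun t =>
    { toFun := T t
      invFun := T (-t)
      left_inv := fun a => by rw [← hadd, neg_add_cancel, hzero]
      right_inv := fun a => by rw [← hadd, add_neg_cancel, hzero]
      map_mul' := fun a b => tendsto_nhds_unique (hT t (a * b))
        (((hT t a).mul (hT t b)).congr fun i => (evolve_mul (hH i) t a b).symm)
      map_add' := fun a b => tendsto_nhds_unique (hT t (a + b))
        (((hT t a).add (hT t b)).congr fun i => (evolve_add t a b).symm)
      map_star' := fun a => tendsto_nhds_unique (hT t (star a))
        ((hT t a).star.congr fun i => (evolve_star t a).symm)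
      map_smul' := fun c a => tendsto_nhds_unique (hT t (c • a))
        (((hT t a).const_smul c).congr fun i => (evolve_smul t c a).symm) },
    hzero, hadd, fun a => ?_, hT⟩
  rw [continuous_iff_continuousAt]
  intro t
  refine tendsto_of_dense hcontr (hcontr t) hS (fun a ha => ?_) a
  obtain ⟨C, hC⟩ := hlip a ha
  have h1 : ∀ u, ‖T u a - T t a‖ ≤ C * |u - t| := fun u =>
    le_of_tendsto ((hT u a).sub (hT t a)).norm (Eventually.of_forall fun i => hC i u t)
  rw [tendsto_iff_norm_sub_tendsto_zero]
  refine squeeze_zero (fun _ => norm_nonneg _) h1 ?_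
  have : Continuous fun u : ℝ => C * |u - t| := by fun_prop
  simpa using this.tendsto t

end heisenberg

/-! ### The quantum dynamics -/

section quantumDynamics

variable {d n : ℕ} {V : Potential d} {K : ℝ}

theorem MultiIndex.one_le_at {α : MultiIndex d} {p : Letter d} (hp : p ∈ α.support) :
    1 ≤ α.at p.1 := by
  have h1 : 1 ≤ α p := Nat.one_le_iff_ne_zero.2 (Finsupp.mem_support_iff.1 hp)
  exact h1.trans (Finset.single_le_sum (f := fun i => α (p.1, i)) (fun _ _ => Nat.zero_le _)
    (Finset.mem_univ p.2))

/-- A nonzero α supported in Λ has |α(x)| ≥ 1 at some x in Λ, so these terms sum to at most |Λ| K.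
The constant term α = 0 is invisible to the norm of V and is added by hand. -/
theorem summable_restrict_mul_exp (hV : V.BoundedBy K) (Λ : Finset (Site d)) :
    Summable fun α => ‖V.restrict Λ α‖ * Real.exp (α.degree : ℝ) := by
  classical
  have hK := hV.nonneg
  refine summable_of_sum_le (c := ‖V 0‖ + Λ.card * K) (fun α => by positivity) fun F => ?_
  have h1 : ∀ α ∈ F, ‖V.restrict Λ α‖ * Real.exp (α.degree : ℝ) ≤
      (if α = 0 then ‖V 0‖ else 0) +
        ∑ x ∈ Λ, (α.at x : ℝ) * ‖V α‖ * Real.exp (α.degree : ℝ) := by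
    intro α _
    have hsum : 0 ≤ ∑ x ∈ Λ, (α.at x : ℝ) * ‖V α‖ * Real.exp (α.degree : ℝ) :=
      Finset.sum_nonneg fun x _ => by positivity
    by_cases h0 : α = 0
    · subst h0
      rw [if_pos rfl]
      have : ‖V.restrict Λ 0‖ * Real.exp ((0 : MultiIndex d).degree : ℝ) ≤ ‖V 0‖ := by
        simpa using V.norm_restrict_le Λ 0
      linarith
    · rw [if_neg h0, zero_add]
      by_cases hsupp : ∀ p ∈ α.support, p.1 ∈ Λ
      · obtain ⟨p, hp⟩ := Finsupp.support_nonempty_iff.2 h0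
        refine le_trans ?_ (Finset.single_le_sum
          (f := fun x => (α.at x : ℝ) * ‖V α‖ * Real.exp (α.degree : ℝ))
          (fun x _ => by positivity) (hsupp p hp))
        have h2 : (1 : ℝ) ≤ α.at p.1 := by exact_mod_cast MultiIndex.one_le_at hp
        refine mul_le_mul_of_nonneg_right ((V.norm_restrict_le Λ α).trans ?_) (by positivity)
        exact le_mul_of_one_le_left (norm_nonneg _) h2
      · rw [Potential.restrict, if_neg hsupp]
        simpa using hsum
  refine (Finset.sum_le_sum h1).trans ?_
  rw [Finset.sum_add_distrib, Finset.sum_comm]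
  refine add_le_add ?_ ?_
  · rw [Finset.sum_ite_eq']
    split_ifs <;> simp
  · refine (Finset.sum_le_sum fun x _ => hV x F).trans (le_of_eq ?_)
    simp

theorem hasSum_hamiltonian (hn : 1 ≤ n) (hV : V.BoundedBy K) (Λ : Finset (Site d)) :
    HasSum (fun α => V.restrict Λ α • quantizeMonomial n α) (hamiltonian V n Λ) := by
  refine Summable.hasSum (Summable.of_norm_bounded (summable_restrict_mul_exp hV Λ) fun α => ?_)
  rw [norm_smul]
  refine mul_le_mul_of_nonneg_left ?_ (norm_nonneg _)
  have h := norm_rep_quantumSpin_ofWord_le hn (normalWord α)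
  rw [rep_ofWord, ← quantizeMonomial_eq, length_normalWord] at h
  refine h.trans (Real.exp_le_exp.2 ?_)
  have : (0 : ℝ) ≤ (α.degree : ℝ) := by positivity
  linarith

theorem isSelfAdjoint_hamiltonian (hreal : V.IsReal) (Λ : Finset (Site d)) :
    IsSelfAdjoint (hamiltonian V n Λ) := by
  rw [IsSelfAdjoint, hamiltonian, tsum_star, ← MultiIndex.barEquiv.tsum_eq
    (f := fun α => V.restrict Λ α • quantizeMonomial n α)]
  refine tsum_congr fun α => ?_
  rw [star_smul, star_quantizeMonomial]
  congr 1
  exact hreal.restrict Λ α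

theorem star_propagator_mul (Λ : Finset (Site d)) (t : ℝ) (a : QuantumAlg d n) :
    star (propagator V n Λ t) * a * propagator V n Λ t =
      evolve ((n : ℝ) / 2) (hamiltonian V n Λ) t a := by
  rw [evolve, propagator]
  push_cast
  rfl

theorem isWordSolution_quantum (hn : 1 ≤ n) (hV : V.BoundedBy K) (hreal : V.IsReal)
    (Λ : Finset (Site d)) : IsWordSolution (V.restrict Λ) fun t =>
      evolveL ((n : ℝ) / 2) (hamiltonian V n Λ) t ∘ₗ rep (quantumSpin n) := by
  refine isWordSolution_evolve (isSelfAdjoint_hamiltonian hreal Λ) _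
    (norm_rep_quantumSpin_ofWord_le hn) (fun u w => ?_) ?_
  · rw [rep_adWord_quantumSpin hn]
    push_cast
    rfl
  · simpa only [quantizeMonomial_eq] using hasSum_hamiltonian hn hV Λ

theorem IsQuantumDynamics.tendsto_rep {α : ℝ → QuantumAlg d n ≃⋆ₐ[ℂ] QuantumAlg d n}
    (hα : IsQuantumDynamics V n α) (t : ℝ) (B : Words d) :
    Tendsto (fun Λ => evolve ((n : ℝ) / 2) (hamiltonian V n Λ) t (rep (quantumSpin n) B)) atTop
      (𝓝 (α t (rep (quantumSpin n) B))) := by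
  obtain ⟨Λ₀, h⟩ := exists_rep_mem_localAlg n B
  simpa only [star_propagator_mul] using hα.limit Λ₀ _ h t

theorem IsQuantumDynamics.unique (hn : 1 ≤ n)
    {α β : ℝ → QuantumAlg d n ≃⋆ₐ[ℂ] QuantumAlg d n} (hα : IsQuantumDynamics V n α)
    (hβ : IsQuantumDynamics V n β) : α = β := by
  funext t
  have hcont : ∀ T : QuantumAlg d n ≃⋆ₐ[ℂ] QuantumAlg d n, Continuous T :=
    fun T => (StarAlgEquiv.isometry T).continuous
  refine DFunLike.coe_injective ((hcont (α t)).ext_on (dense_range_rep_quantumSpin hn)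
    (hcont (β t)) ?_)
  rintro _ ⟨B, rfl⟩
  exact tendsto_nhds_unique (hα.tendsto_rep t B) (hβ.tendsto_rep t B)

/-- For large Λ the evolved word is close to the quantization of a `B` not depending on Λ, which
gives convergence; a Lipschitz bound in time uniform in Λ gives strong continuity of the limit. -/
theorem existsUnique_isQuantumDynamics (hn : 1 ≤ n) (hV : V.BoundedBy K) (hreal : V.IsReal) :
    ∃! α, IsQuantumDynamics V n α := by
  have hΛ : ∀ Λ, (V.restrict Λ).BoundedBy K := fun Λ => hV.mono (V.norm_restrict_le Λ)
  obtain ⟨α, h0, hadd, hcont, hlim⟩ := exists_limit_dynamics (κ := (n : ℝ) / 2)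
    (H := fun Λ => hamiltonian V n Λ) (isSelfAdjoint_hamiltonian hreal)
    (dense_range_rep_quantumSpin (d := d) hn) (by
      rintro _ ⟨A, rfl⟩ t ε hε
      obtain ⟨B, F, h⟩ := exists_approx hV t A hε
      refine ⟨rep (quantumSpin n) B, ?_⟩
      filter_upwards [eventually_restrict_approximates V F] with Λ hΛ'
      have := h _ hΛ' (isWordSolution_quantum hn hV hreal Λ)
      simpa only [LinearMap.comp_apply, evolveL_apply, evolve_zero] using this) (by
      rintro _ ⟨A, rfl⟩
      exact ⟨2 * K * wnorm 1 A, fun Λ t u =>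
        (isWordSolution_quantum hn hV hreal Λ).lipschitz (hΛ Λ) t u A⟩)
  have hα : IsQuantumDynamics V n α :=
    { zero := h0
      add := hadd
      continuous := hcont
      limit := fun Λ₀ a _ t => by simpa only [star_propagator_mul] using hlim t a }
  exact ⟨α, hα, fun β hβ => hβ.unique hn hα⟩

end quantumDynamics

/-! ### The classical limit -/

section classicalLimit

variable {d : ℕ}

/-- Only here does 1/s enter: the commutator is 1/s times at most one spin operator. -/
theorem norm_quantumSpin_commutator_le {n : ℕ} (hn : 1 ≤ n) (a b : Letter d) :
    ‖quantumSpin n a * quantumSpin n b - quantumSpin n b * quantumSpin n a‖ ≤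
      Real.exp (1 / 2) / ((n : ℝ) / 2) := by
  have hn0 : (0 : ℝ) < (n : ℝ) / 2 := by
    have : (1 : ℝ) ≤ n := by exact_mod_cast hn
    linarith
  have h1 : ‖(if a.1 = b.1 then ∑ k : Idx, (eps a.2 b.2 k : ℂ) • quantumSpin n (b.1, k)
      else 0 : QuantumAlg d n)‖ ≤ Real.exp (1 / 2) := by
    split_ifs
    · refine (norm_sum_le _ _).trans ?_
      have h2 : ∀ k ∈ Finset.univ, ‖(eps a.2 b.2 k : ℂ) • quantumSpin n (b.1, k)‖ ≤
          ((|eps a.2 b.2 k| : ℤ) : ℝ) * Real.exp (1 / 2) := by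
        intro k _
        rw [norm_smul, Complex.norm_intCast, Int.cast_abs]
        exact mul_le_mul_of_nonneg_left (norm_quantumSpin_le hn _) (abs_nonneg _)
      refine (Finset.sum_le_sum h2).trans ?_
      rw [← Finset.sum_mul, ← Int.cast_sum]
      exact mul_le_of_le_one_left (Real.exp_pos _).le (by exact_mod_cast sum_abs_eps_le a.2 b.2)
    · rw [norm_zero]
      exact (Real.exp_pos _).le
  rw [← quantumSpin_commutator hn, norm_smul, norm_div, Complex.norm_natCast,
    Complex.norm_ofNat, mul_comm] at h1
  rwa [le_div_iff₀ hn0]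

/-- Reordering the letters of a word changes its quantization by terms of order `1 / s`. -/
theorem exists_norm_sub_le_of_perm {w w' : List (Letter d)} (h : w.Perm w') :
    ∃ C : ℝ, ∀ n : ℕ, 1 ≤ n →
      ‖(w.map (quantumSpin n)).prod - (w'.map (quantumSpin n)).prod‖ ≤ C / ((n : ℝ) / 2) := by
  induction h with
  | nil => exact ⟨0, fun n _ => by rw [sub_self, norm_zero, zero_div]⟩
  | cons a _ ih =>
    obtain ⟨C, hC⟩ := ih
    refine ⟨Real.exp (1 / 2) * C, fun n hn => ?_⟩
    rw [List.map_cons, List.prod_cons, List.map_cons, List.prod_cons, ← mul_sub, mul_div_assoc]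
    exact (norm_mul_le _ _).trans (mul_le_mul (norm_quantumSpin_le hn a) (hC n hn)
      (norm_nonneg _) (Real.exp_pos _).le)
  | swap a b l =>
    refine ⟨Real.exp (1 / 2) * Real.exp (1 / 2 * l.length), fun n hn => ?_⟩
    simp only [List.map_cons, List.prod_cons]
    rw [← mul_assoc, ← mul_assoc, ← sub_mul, mul_div_right_comm]
    refine (norm_mul_le _ _).trans (mul_le_mul (norm_quantumSpin_commutator_le hn b a) ?_
      (norm_nonneg _) (by positivity))
    rw [← rep_ofWord]
    exact norm_rep_quantumSpin_ofWord_le hn l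
  | trans _ _ ih₁ ih₂ =>
    obtain ⟨C₁, h₁⟩ := ih₁
    obtain ⟨C₂, h₂⟩ := ih₂
    refine ⟨C₁ + C₂, fun n hn => ?_⟩
    rw [add_div, ← sub_add_sub_cancel]
    exact (norm_add_le _ _).trans (add_le_add (h₁ n hn) (h₂ n hn))

/-! ### Comparison of words with polynomials and their quantization -/

/-- The normally ordered words of a polynomial. -/
noncomputable def Poly.toWords (A : Poly d) : Words d :=
  ∑ α ∈ A.support, A.coeff α • ofWord (normalWord α)

/-- The commutative image of words. -/
noncomputable def Words.toPoly : Words d →ₗ[ℂ] Poly d := rep MvPolynomial.X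

theorem rep_toWords (n : ℕ) (A : Poly d) : rep (quantumSpin n) A.toWords = quantize n A := by
  rw [Poly.toWords, map_sum, quantize]
  refine Finset.sum_congr rfl fun α _ => ?_
  rw [map_smul, rep_ofWord, ← quantizeMonomial_eq]

theorem toFun_toPoly (B : Words d) : Poly.toFun B.toPoly = rep classicalSpin B := by
  induction B using Finsupp.induction_linear with
  | zero => simp
  | add f g hf hg => rw [map_add, map_add, map_add, hf, hg]
  | single w c =>
    simp only [Words.toPoly, rep, Finsupp.linearCombination_single]
    rw [map_smul, map_list_prod, List.map_map]
    congr 3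
    funext p
    simp [Poly.toFun]

theorem toPoly_toWords (A : Poly d) : A.toWords.toPoly = A := by
  rw [Poly.toWords, map_sum]
  conv_rhs => rw [A.as_sum]
  refine Finset.sum_congr rfl fun α _ => ?_
  rw [map_smul, Words.toPoly, rep_ofWord, prod_X_normalWord, MvPolynomial.smul_monomial,
    smul_eq_mul, mul_one]

theorem quantize_eq_sum (n : ℕ) (A : Poly d) {S : Finset (MultiIndex d)} (hS : A.support ⊆ S) :
    quantize n A = ∑ α ∈ S, A.coeff α • quantizeMonomial n α := by
  refine Finset.sum_subset hS fun α _ hα => ?_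
  rw [MvPolynomial.notMem_support_iff.1 hα, zero_smul]

theorem quantize_add (n : ℕ) (A B : Poly d) : quantize n (A + B) = quantize n A + quantize n B := by
  classical
  rw [quantize_eq_sum n (A + B) MvPolynomial.support_add,
    quantize_eq_sum n A (Finset.subset_union_left (s₂ := B.support)),
    quantize_eq_sum n B (Finset.subset_union_right (s₁ := A.support)), ← Finset.sum_add_distrib]
  refine Finset.sum_congr rfl fun α _ => ?_
  rw [MvPolynomial.coeff_add, add_smul]

theorem quantize_monomial (n : ℕ) (α : MultiIndex d) (c : ℂ) :
    quantize n (MvPolynomial.monomial α c) = c • quantizeMonomial n α := by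
  rw [quantize_eq_sum n _ MvPolynomial.support_monomial_subset, Finset.sum_singleton,
    MvPolynomial.coeff_monomial, if_pos rfl]

theorem prod_X_eq_monomial (w : List (Letter d)) : ∃ α : MultiIndex d, w.Perm (normalWord α) ∧
    (w.map (MvPolynomial.X (R := ℂ))).prod = MvPolynomial.monomial α 1 := by
  classical
  refine ⟨Multiset.toFinsupp (w : Multiset (Letter d)), ?_, ?_⟩
  · rw [← Multiset.coe_eq_coe, ← toMultiset_eq_normalWord, Multiset.toFinsupp_toMultiset]
  · rw [← prod_X_normalWord, ← Multiset.prod_coe, ← Multiset.prod_coe, ← Multiset.map_coe,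
      ← Multiset.map_coe, ← toMultiset_eq_normalWord, Multiset.toFinsupp_toMultiset]

/-- Up to terms of order `1 / s`, the value of words is the quantization of their commutative
image. -/
theorem exists_norm_rep_sub_quantize_le (B : Words d) : ∃ C : ℝ, ∀ n : ℕ, 1 ≤ n →
    ‖rep (quantumSpin n) B - quantize n B.toPoly‖ ≤ C / ((n : ℝ) / 2) := by
  induction B using Finsupp.induction_linear with
  | zero =>
    refine ⟨0, fun n _ => ?_⟩
    rw [map_zero, map_zero, quantize_eq_sum n 0 (S := ∅) (by simp), Finset.sum_empty, sub_zero,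
      norm_zero, zero_div]
  | add f g hf hg =>
    obtain ⟨C₁, h₁⟩ := hf
    obtain ⟨C₂, h₂⟩ := hg
    refine ⟨C₁ + C₂, fun n hn => ?_⟩
    rw [map_add, map_add, quantize_add, add_sub_add_comm, add_div]
    exact (norm_add_le _ _).trans (add_le_add (h₁ n hn) (h₂ n hn))
  | single w c =>
    obtain ⟨α, hperm, hα⟩ := prod_X_eq_monomial w
    obtain ⟨C, hC⟩ := exists_norm_sub_le_of_perm hperm
    refine ⟨‖c‖ * C, fun n hn => ?_⟩
    simp only [Words.toPoly, rep, Finsupp.linearCombination_single]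
    rw [hα, MvPolynomial.smul_monomial, smul_eq_mul, mul_one, quantize_monomial,
      quantizeMonomial_eq, ← smul_sub, norm_smul, mul_div_assoc]
    exact mul_le_mul_of_nonneg_left (hC n hn) (norm_nonneg c)

end classicalLimit

end SpinSystem

/-! ### The theorem: existence, uniqueness and the classical limit -/

theorem mainTheorem2 {d : ℕ} (V : SpinSystem.Potential d) (hreal : V.IsReal)
    (hnorm : V.norm < ⊤) :
    (∃! α, SpinSystem.IsClassicalDynamics V α) ∧
    (∀ n : ℕ, 1 ≤ n → ∃! αq, SpinSystem.IsQuantumDynamics V n αq) ∧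
    ∀ (α : ℝ → SpinSystem.ClassicalAlg d ≃⋆ₐ[ℂ] SpinSystem.ClassicalAlg d)
      (αq : ∀ n : ℕ, ℝ → SpinSystem.QuantumAlg d n ≃⋆ₐ[ℂ] SpinSystem.QuantumAlg d n),
      SpinSystem.IsClassicalDynamics V α →
      (∀ n : ℕ, 1 ≤ n → SpinSystem.IsQuantumDynamics V n (αq n)) →
      ∀ (A : SpinSystem.Poly d) (ε : ℝ), 0 < ε →
        ∃ At : ℝ → SpinSystem.Poly d,
          (∀ t : ℝ, ‖α t (SpinSystem.Poly.toFun A) - SpinSystem.Poly.toFun (At t)‖ ≤ ε) ∧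
          ∀ t : ℝ, ∃ C : ℝ, ∀ n : ℕ, 1 ≤ n →
            ‖αq n t (SpinSystem.quantize n A) - SpinSystem.quantize n (At t)‖
              ≤ ε + C / ((n : ℝ) / 2) := by
  have hV := SpinSystem.Potential.boundedBy_of_norm_lt_top hnorm
  refine ⟨SpinSystem.existsUnique_isClassicalDynamics hV hreal,
    fun n hn => SpinSystem.existsUnique_isQuantumDynamics hn hV hreal,
    fun α αq hα hαq A ε hε => ?_⟩
  -- For each t, one `B t` serves both systems and all n, and n/2 is the spin s.
  choose B F hcl hword using fun t => SpinSystem.exists_flow_approx hV t A.toWords hε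
  refine ⟨fun t => (B t).toPoly, fun t => ?_, fun t => ?_⟩
  · obtain ⟨φ, hφ, hαφ⟩ := hα.flow
    rw [SpinSystem.toFun_toPoly, ContinuousMap.norm_le _ hε.le]
    intro M
    have h := hcl t V (SpinSystem.Potential.Approximates.refl V _) φ hφ M
    rwa [← SpinSystem.rep_classicalSpin_apply, ← SpinSystem.rep_classicalSpin_apply,
      ← SpinSystem.toFun_toPoly, SpinSystem.toPoly_toWords, ← hαφ] at h
  · obtain ⟨C, hC⟩ := SpinSystem.exists_norm_rep_sub_quantize_le (B t)
    refine ⟨C, fun n hn => ?_⟩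
    have h1 : ‖αq n t (SpinSystem.quantize n A) -
        SpinSystem.rep (SpinSystem.quantumSpin n) (B t)‖ ≤ ε := by
      rw [← SpinSystem.rep_toWords]
      -- The bound by ε holds for all large finite volumes and passes to the thermodynamic limit.
      -- How large Λ must be depends only on `F t`.
      refine le_of_tendsto (((hαq n hn).tendsto_rep t A.toWords).sub_const _).norm ?_
      filter_upwards [SpinSystem.eventually_restrict_approximates V (F t)] with Λ hΛ
      have := hword t _ hΛ (SpinSystem.isWordSolution_quantum hn hV hreal Λ)
      simpa only [LinearMap.comp_apply, SpinSystem.evolveL_apply, SpinSystem.evolve_zero]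
        using this
    rw [← sub_add_sub_cancel]
    exact (norm_add_le _ _).trans (add_le_add h1 (hC n hn))
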